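/- Let $X_0$ be a complex analytic space, $Y_0\subseteq X_0$ a closed analytic subspace (of arbitrary codimension) with ideal sheaf $\mathcal J=\mathcal J_{Y_0|X_0}\subseteq\mathcal O_{X_0}$, and let $W_0$ be a vector bundle (a locally free sheaf of finite rank) on $Y_0$. A framed vector bundle on $X_0$ is a pair $(E_0,\alpha_0)$ of a vector bundle $E_0$ on $X_0$ and an isomorphism $\alpha_0\colon E_0|_{Y_0}\to W_0$; fix one. For a finite-dimensional local $\mathbb C$-algebra $A$, let $\mathrm{Def}(E_0,\alpha_0)(A)$ be the set of isomorphism classes of deformations $(E,\alpha,\psi)$ of $(E_0,\alpha_0)$ over $\mathrm{Spec}\,A$: $E$ is a vector bundle on $\mathrm{Spec}\,A\times X_0$, $\alpha\colon E|_{\mathrm{Spec}A\times Y_0}\to p^*W_0$ is an isomorphism, where $p\colon \mathrm{Spec}\,A\times Y_0\to Y_0$ is the projection, and $\psi$ is an isomorphism from the restriction of $E$ to the closed fibre $X_0$ to $E_0$ such that $\alpha_0\circ\psi|_{Y_0}$ is the restriction of $\alpha$ to the closed fibre; isomorphisms of deformations are isomorphisms of the bundles $E$ over $\mathrm{Spec}\,A\times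 X_0$ that are compatible with $\alpha$ and $\psi$. Inverse image makes this a functor of $A$. Let $\mathbb C[\varepsilon]$ be the algebra of dual numbers. **Theorem.** (a) The canonical map $$\mathrm{Def}(E_0,\alpha_0)(\mathbb C[\varepsilon]\times_{\mathbb C}\mathbb C[\varepsilon])\to \mathrm{Def}(E_0,\alpha_0)(\mathbb C[\varepsilon])\times \mathrm{Def}(E_0,\alpha_0)(\mathbb C[\varepsilon])$$ is bijective, and $\mathrm{Def}(E_0,\alpha_0)(\mathbb C[\varepsilon])$ is a complex vector space whose addition is induced, through this bijection, by $(x+y\varepsilon,x+z\varepsilon)\mapsto x+(y+z)\varepsilon$ and whose multiplication by $\lambda\in\mathbb C$ is induced by $x+y\varepsilon\mapsto x+\lambda y\varepsilon$. (b) There is a canonical $\mathbb C$-linear isomorphism $$\nu\colon \mathrm{Ext}^1_{X_0}(E_0,E_0\otimes_{\mathcal O_{X_0}}\mathcal J)\;\xrightarrow{\ \sim\ }\;\mathrm{Def}(E_0,\alpha_0)(\mathbb C[\varepsilon]).$$ It is canonical in the following sense. Let $j\colon E_0\otimes\mathcal J\to E_0$ be the canonical map. For each extension $0\to E_0\otimes\mathcal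 J\xrightarrow{\,i\,}F\xrightarrow{\,q\,}E_0\to 0$ of $\mathcal O_{X_0}$-modules and each deformation $(E,\alpha,\psi)$ over $\mathbb C[\varepsilon]$, the map $\nu$ sends the class of the extension to the class of $(E,\alpha,\psi)$ if and only if there is an $\mathcal O_{X_0}$-linear map $u\colon F\to E$ such that, for all local sections, $\psi(u(s))=q(s)$; $u(i(z))=\varepsilon e$ whenever $\psi(e)=j(z)$; and $\alpha$ sends the restriction of $u(s)$ to the constant section $p^*(\alpha_0(q(s)|_{Y_0}))$ of $p^*W_0$. (Thus $E$ is the pushout $F\sqcup_{E_0\otimes\mathcal J}E_0$ of $i$ and $j$, with its natural framing.) -/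

import Mathlib

open CategoryTheory Limits TopologicalSpace Opposite AlgebraicGeometry
open scoped TensorProduct

namespace FramedDeformations

noncomputable section

/-- The forgetful functor from commutative `ℂ`-algebras to types is corepresented by `ℂ[t]`. -/
def commAlgCatForgetCorepresentable :
    (forget (CommAlgCat.{0} ℂ)).CorepresentableBy (CommAlgCat.of ℂ (Polynomial ℂ)) where
  homEquiv {A} :=
    { toFun := fun f => f.hom Polynomial.X
      invFun := fun a => CommAlgCat.ofHom (Polynomial.aeval (R := ℂ) (A := A) a)
      left_inv := fun f => by
        apply CommAlgCat.hom_ext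
        apply Polynomial.algHom_ext
        simp
      right_inv := fun a => by simp }
  homEquiv_comp f g := rfl

instance : PreservesLimits (forget (CommAlgCat.{0} ℂ)) :=
  preservesLimits_of_natIso commAlgCatForgetCorepresentable.toIso

instance : PreservesLimits (forget₂ (CommAlgCat.{0} ℂ) CommRingCat.{0}) :=
  have : PreservesLimits (forget₂ (CommAlgCat.{0} ℂ) CommRingCat.{0} ⋙ forget CommRingCat.{0}) :=
    inferInstanceAs (PreservesLimits (forget (CommAlgCat.{0} ℂ)))
  have : ReflectsLimits (forget CommRingCat.{0}) := reflectsLimits_of_reflectsIsomorphisms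
  preservesLimits_of_reflects_of_preserves _ (forget CommRingCat.{0})

/-- A `ℂ`-ringed space: a topological space with a sheaf of commutative `ℂ`-algebras. -/
abbrev CSpace := SheafedSpace (CommAlgCat.{0} ℂ)

variable {X Y Z : CSpace}

/-- The structure sheaf as a presheaf of commutative rings. -/
def commRingPresheaf (X : CSpace) : TopCat.Presheaf CommRingCat.{0} X.carrier :=
  X.presheaf ⋙ forget₂ (CommAlgCat.{0} ℂ) CommRingCat.{0}

/-- The structure sheaf as a sheaf of rings. -/
def ringSheaf (X : CSpace) : Sheaf (Opens.grothendieckTopology X.carrier) RingCat.{0} :=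
  (sheafCompose _ (forget₂ CommRingCat.{0} RingCat.{0})).obj
   ((sheafCompose _ (forget₂ (CommAlgCat.{0} ℂ) CommRingCat.{0})).obj X.sheaf)

/-- The comorphism `O_Y → f_* O_X` of a morphism `f : X → Y`, as a morphism of sheaves of rings. -/
def ringHom (f : X ⟶ Y) : ringSheaf Y ⟶
    ((Opens.map f.hom.base).sheafPushforwardContinuous _ _ _).obj (ringSheaf X) where
  hom := Functor.whiskerRight (Functor.whiskerRight f.hom.c _) _

/-- The category of `O_X`-modules. -/
abbrev OMod (X : CSpace) := SheafOfModules.{0} (ringSheaf X)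

/-- The direct image functor `f_*` on modules. -/
def pushforward (f : X ⟶ Y) : OMod X ⥤ OMod Y := SheafOfModules.pushforward (ringHom f)

lemma presheafPushforward_isRightAdjoint {C D : Type} [SmallCategory C] [SmallCategory D] (F : C ⥤ D)
   (R : Dᵒᵖ ⥤ RingCat.{0}) (S : Cᵒᵖ ⥤ RingCat.{0}) (φ : S ⟶ F.op ⋙ R) :
   (PresheafOfModules.pushforward.{0} φ).IsRightAdjoint := inferInstance

instance (f : X ⟶ Y) : (SheafOfModules.pushforward.{0} (ringHom f)).IsRightAdjoint := by
  have : (PresheafOfModules.pushforward.{0} (ringHom f).hom).IsRightAdjoint :=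
    presheafPushforward_isRightAdjoint (Opens.map f.hom.base) _ _ _
  infer_instance

/-- The inverse image functor `f^*` on modules, the left adjoint of `f_*`. -/
def pullback (f : X ⟶ Y) : OMod Y ⥤ OMod X := SheafOfModules.pullback (ringHom f)
/-- The adjunction `f^* ⊣ f_*`. -/
def adj (f : X ⟶ Y) : pullback f ⊣ pushforward f := SheafOfModules.pullbackPushforwardAdjunction _

/-- Sections `Γ(U, M)` of an `O_X`-module. -/
abbrev Sec (M : OMod X) (U : Opens X.carrier) : Type := M.val.obj (op U)

/-- Functions `Γ(U, O_X)`. -/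
abbrev Fun (X : CSpace) (U : Opens X.carrier) : Type := X.presheaf.obj (op U)

instance (M : OMod X) (U : Opens X.carrier) : Module (Fun X U) (Sec M U) :=
  inferInstanceAs (Module ((ringSheaf X).obj.obj (op U)) (M.val.obj (op U)))

/-- Restriction of functions. -/
def funRest {U V : Opens X.carrier} (h : V ≤ U) : Fun X U →ₐ[ℂ] Fun X V :=
  (X.presheaf.map (homOfLE h).op).hom

/-- Restriction of sections of a module. -/
def rest (M : OMod X) {U V : Opens X.carrier} (h : V ≤ U) : Sec M U →+ Sec M V where
  toFun x := M.val.map (homOfLE h).op x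
  map_zero' := (M.val.map (homOfLE h).op).hom.map_zero
  map_add' := (M.val.map (homOfLE h).op).hom.map_add

lemma rest_smul (M : OMod X) {U V : Opens X.carrier} (h : V ≤ U) (r : Fun X U) (x : Sec M U) :
    rest M h (r • x) = funRest h r • rest M h x :=
  M.val.map_smul (homOfLE h).op r x

lemma rest_self (M : OMod X) {U : Opens X.carrier} (h : U ≤ U) (x : Sec M U) :
    rest M h x = x := by
  have := congrArg (fun f => f x) (M.val.presheaf.map_id (op U))
  exact ConcreteCategory.congr_hom (M.val.presheaf.map_id (op U)) x

lemma rest_rest (M : OMod X) {U V W : Opens X.carrier} (h : V ≤ U) (h' : W ≤ V) (x : Sec M U) :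
    rest M h' (rest M h x) = rest M (h'.trans h) x :=
  (ConcreteCategory.congr_hom (M.val.presheaf.map_comp (homOfLE h).op (homOfLE h').op) x).symm

/-- The action of a morphism of `O_X`-modules on sections over `U`. -/
def onSec {M N : OMod X} (f : M ⟶ N) (U : Opens X.carrier) : Sec M U →ₗ[Fun X U] Sec N U where
  toFun x := f.val.app (op U) x
  map_add' := (f.val.app (op U)).hom.map_add
  map_smul' := (f.val.app (op U)).hom.map_smul

lemma onSec_rest {M N : OMod X} (f : M ⟶ N) {U V : Opens X.carrier} (h : V ≤ U) (x : Sec M U) :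
    onSec f V (rest M h x) = rest N h (onSec f U x) :=
  PresheafOfModules.naturality_apply f.val (homOfLE h).op x

lemma hom_ext' {M N : OMod X} {f g : M ⟶ N} (h : ∀ U x, onSec f U x = onSec g U x) : f = g := by
  apply SheafOfModules.hom_ext
  apply PresheafOfModules.hom_ext
  intro U
  ext x
  exact h U.unop x

/-- Pullback of functions along `f : X → Y`, from `U ⊆ Y` to `V ⊆ f⁻¹ U`. -/
def funPull (f : X ⟶ Y) {U : Opens Y.carrier} {V : Opens X.carrier}
    (h : V ≤ (Opens.map f.hom.base).obj U) : Fun Y U →ₐ[ℂ] Fun X V :=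
  (funRest h).comp (f.hom.c.app (op U)).hom

/-- A morphism of modules over `f : X → Y`, from the `O_Y`-module `M` to the `O_X`-module `N`: compatible
additive maps `Γ(U, M) → Γ(V, N)` for `V ⊆ f⁻¹ U`, linear over pullback of functions. These are
the same as morphisms `M → f_* N` (see `SemiHom.equiv`) and as morphisms `f^* M → N` (see
`adjEquiv`). -/
structure SemiHom (f : X ⟶ Y) (M : OMod Y) (N : OMod X) where
  toFun (U : Opens Y.carrier) (V : Opens X.carrier) (h : V ≤ (Opens.map f.hom.base).obj U) :
    Sec M U →+ Sec N V
  map_smul' (U V h) (r : Fun Y U) (x : Sec M U) :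
    toFun U V h (r • x) = funPull f h r • toFun U V h x
  map_rest' (U V h) (U' V') (hU : U' ≤ U) (hV : V' ≤ V) (h' : V' ≤ (Opens.map f.hom.base).obj U') (x : Sec M U) :
    toFun U' V' h' (rest M hU x) = rest N hV (toFun U V h x)

/-- The morphism over `f` given by a morphism `M → f_* N`. -/
def SemiHom.ofHom (f : X ⟶ Y) {M : OMod Y} {N : OMod X} (a : M ⟶ (pushforward f).obj N) : SemiHom f M N where
  toFun U V h := (rest N h).comp (onSec a U).toAddMonoidHom
  map_smul' U V h r x := by
    have h1 : onSec a U (r • x) = r • onSec a U x := map_smul _ _ _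
    show rest N h (onSec a U (r • x)) = _
    rw [h1]
    exact rest_smul N h ((f.hom.c.app (op U)).hom r : Fun X ((Opens.map f.hom.base).obj U))
      (onSec a U x : Sec N ((Opens.map f.hom.base).obj U))
  map_rest' U V h U' V' hU hV h' x := by
    show rest N h' (onSec a U' (rest M hU x)) = rest N hV (rest N h (onSec a U x))
    rw [onSec_rest]
    have h2 : rest ((pushforward f).obj N) hU (onSec a U x) = rest N (show (Opens.map f.hom.base).obj U' ≤ (Opens.map f.hom.base).obj U from fun x hx => hU hx) (onSec a U x : Sec N _) := rfl
    rw [h2]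
    exact (rest_rest N _ _ _).trans (rest_rest N _ _ _).symm

/-- The morphism `M → f_* N` given by a morphism over `f`. -/
def SemiHom.toHom (f : X ⟶ Y) {M : OMod Y} {N : OMod X} (a : SemiHom f M N) : M ⟶ (pushforward f).obj N where
  val :=
   { app U := ModuleCat.ofHom (X := M.val.obj U) (Y := ((pushforward f).obj N).val.obj U)
       { toFun := fun x => a.toFun U.unop ((Opens.map f.hom.base).obj U.unop) le_rfl x
         map_add' := (a.toFun U.unop ((Opens.map f.hom.base).obj U.unop) le_rfl).map_add
         map_smul' := fun r x => (a.map_smul' _ _ _ r x).trans (by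
           have : funPull f (le_refl ((Opens.map f.hom.base).obj U.unop)) r = (f.hom.c.app U).hom r :=
              ConcreteCategory.congr_hom (X.presheaf.map_id _) _
           rw [this]; rfl) }
     naturality {U V} g := by
       ext x
       exact (a.map_rest' U.unop _ le_rfl V.unop ((Opens.map f.hom.base).obj V.unop) g.unop.le (fun x hx => g.unop.le hx) le_rfl x) }

lemma SemiHom.ext' {f : X ⟶ Y} {M : OMod Y} {N : OMod X} {a b : SemiHom f M N}
    (h : ∀ U x, a.toFun U _ le_rfl x = b.toFun U _ le_rfl x) : a = b := by
  cases a with | mk a ha ha' => cases b with | mk b hb hb' =>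
  congr
  ext U V hV x
  have h1 := ha' U _ le_rfl U V le_rfl hV hV x
  have h2 := hb' U _ le_rfl U V le_rfl hV hV x
  rw [rest_self] at h1 h2
  rw [h1, h2]
  exact congrArg _ (h U x)

/-- Morphisms `M → f_* N` are the same as morphisms from `M` to `N` over `f`. -/
def SemiHom.equiv (f : X ⟶ Y) (M : OMod Y) (N : OMod X) : (M ⟶ (pushforward f).obj N) ≃ SemiHom f M N where
  toFun := SemiHom.ofHom f
  invFun := SemiHom.toHom f
  left_inv a := by
    apply hom_ext'
    intro U x
    exact rest_self N _ _
  right_inv a := by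
    apply SemiHom.ext'
    intro U x
    exact rest_self N _ _

/-- Morphisms `f^* M → N` are the same as morphisms from `M` to `N` over `f`. -/
def adjEquiv (f : X ⟶ Y) (M : OMod Y) (N : OMod X) :
    ((pullback f).obj M ⟶ N) ≃ SemiHom f M N :=
  ((adj f).homEquiv M N).trans (SemiHom.equiv f M N)

/-- Composition of a morphism over `f` with a morphism of `O_X`-modules. -/
def SemiHom.post {f : X ⟶ Y} {M : OMod Y} {N N' : OMod X} (a : SemiHom f M N) (g : N ⟶ N') :
    SemiHom f M N' where
  toFun U V h := (onSec g V).toAddMonoidHom.comp (a.toFun U V h)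
  map_smul' U V h r x := by
    show onSec g V (a.toFun U V h (r • x)) = _
    rw [a.map_smul', map_smul]; rfl
  map_rest' U V h U' V' hU hV h' x := by
    show onSec g V' (a.toFun U' V' h' (rest M hU x)) = _
    rw [a.map_rest' U V h U' V' hU hV, onSec_rest]; rfl

lemma adjEquiv_post {f : X ⟶ Y} {M : OMod Y} {N N' : OMod X} (a : (pullback f).obj M ⟶ N) (g : N ⟶ N') :
    adjEquiv f M N' (a ≫ g) = (adjEquiv f M N a).post g := by
  apply SemiHom.ext'
  intro U x
  have := (adj f).homEquiv_naturality_right a g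
  show rest N' _ (onSec ((adj f).homEquiv M N' (a ≫ g)) U x) = onSec g _ (rest N _ (onSec ((adj f).homEquiv M N a) U x))
  rw [this]
  exact (onSec_rest g _ _).symm

lemma funPull_comp {f : X ⟶ Y} {g : Z ⟶ X} {U : Opens Y.carrier} {V : Opens Z.carrier}
    (h : V ≤ (Opens.map (g ≫ f).hom.base).obj U) (r : Fun Y U) :
    funPull (g ≫ f) h r =
      funPull g (U := (Opens.map f.hom.base).obj U) h (funPull f le_rfl r) := by
  have : funPull f (le_refl ((Opens.map f.hom.base).obj U)) r = (f.hom.c.app (op U)).hom r :=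
    ConcreteCategory.congr_hom (X.presheaf.map_id _) _
  rw [this]
  rfl

lemma funPull_rest {f : X ⟶ Y} {U U' : Opens Y.carrier} {V V' : Opens X.carrier}
    (h : V ≤ (Opens.map f.hom.base).obj U) (hU : U' ≤ U) (hV : V' ≤ V)
    (h' : V' ≤ (Opens.map f.hom.base).obj U') (r : Fun Y U) :
    funPull f h' (funRest hU r) = funRest hV (funPull f h r) := by
  have h1 := ConcreteCategory.congr_hom (f.hom.c.naturality (homOfLE hU).op) r
  have h2 : ∀ {A B C : Opens X.carrier} (p : B ≤ A) (q : C ≤ B) (x : Fun X A),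
      funRest q (funRest p x) = funRest (q.trans p) x := fun p q x =>
    (ConcreteCategory.congr_hom (X.presheaf.map_comp (homOfLE p).op (homOfLE q).op) x).symm
  have h3 : (f.hom.c.app (op U')).hom (funRest hU r) =
      funRest (show (Opens.map f.hom.base).obj U' ≤ (Opens.map f.hom.base).obj U from
        fun x hx => hU hx) ((f.hom.c.app (op U)).hom r) := h1
  show funRest h' ((f.hom.c.app (op U')).hom (funRest hU r)) =
    funRest hV (funRest h ((f.hom.c.app (op U)).hom r))
  rw [h3]
  exact (h2 _ _ _).trans (h2 _ _ _).symm

/-- Composition of a morphism over `f` with a morphism over `g`, a morphism over `k = f ∘ g`. -/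
def SemiHom.comp {f : X ⟶ Y} {g : Z ⟶ X} {k : Z ⟶ Y} (hk : g ≫ f = k)
    {M : OMod Y} {N : OMod X} {K : OMod Z} (a : SemiHom f M N) (b : SemiHom g N K) :
    SemiHom k M K where
  toFun U V h := (b.toFun ((Opens.map f.hom.base).obj U) V (by subst hk; exact h)).comp
    (a.toFun U _ le_rfl)
  map_smul' U V h r x := by
    subst hk
    show b.toFun _ V _ (a.toFun U _ le_rfl (r • x)) = _
    rw [a.map_smul', b.map_smul', funPull_comp]
    rfl
  map_rest' U V h U' V' hU hV h' x := by
    subst hk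
    show b.toFun _ V' _ (a.toFun U' _ le_rfl (rest M hU x)) = rest K hV (b.toFun _ V _ (a.toFun U _ le_rfl x))
    rw [a.map_rest' U _ le_rfl U' _ hU (show (Opens.map f.hom.base).obj U' ≤ (Opens.map f.hom.base).obj U from fun x hx => hU hx) le_rfl]
    exact b.map_rest' _ _ _ _ _ _ _ _ _

lemma SemiHom.comp_apply {f : X ⟶ Y} {g : Z ⟶ X} {k : Z ⟶ Y} (hk : g ≫ f = k)
    {M : OMod Y} {N : OMod X} {K : OMod Z} (a : SemiHom f M N) (b : SemiHom g N K)
    {U : Opens Y.carrier} {V : Opens X.carrier} {W : Opens Z.carrier}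
    (h : V ≤ (Opens.map f.hom.base).obj U) (h' : W ≤ (Opens.map g.hom.base).obj V)
    (h'' : W ≤ (Opens.map k.hom.base).obj U) (x : Sec M U) :
    (a.comp hk b).toFun U W h'' x = b.toFun V W h' (a.toFun U V h x) := by
  show b.toFun _ W _ (a.toFun U _ le_rfl x) = _
  have h1 := a.map_rest' U _ le_rfl U V le_rfl h h x
  rw [rest_self] at h1
  rw [h1]
  have h2 := b.map_rest' _ W (by subst hk; exact h'') V W h le_rfl h' (a.toFun U _ le_rfl x)
  rw [h2, rest_self]

/-- The morphism `a : M → N` over `f` exhibits `N` as the inverse image `f^* M`. -/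
def SemiHom.IsPull {f : X ⟶ Y} {M : OMod Y} {N : OMod X} (a : SemiHom f M N) : Prop :=
  IsIso ((adjEquiv f M N).symm a)

lemma SemiHom.isPull_iff {f : X ⟶ Y} {M : OMod Y} {N : OMod X} (a : SemiHom f M N) :
    a.IsPull ↔ ∀ K : OMod X, Function.Bijective (fun g : N ⟶ K => a.post g) := by
  unfold IsPull
  rw [isIso_iff_coyoneda_map_bijective]
  refine forall_congr' fun K => ?_
  rw [← (adjEquiv f M K).bijective.of_comp_iff']
  have : (adjEquiv f M K ∘ fun x : N ⟶ K => (adjEquiv f M N).symm a ≫ x) = fun g : N ⟶ K => a.post g := by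
    funext g
    simp [adjEquiv_post]
  rw [this]

lemma SemiHom.IsPull.comp_bijective {f : X ⟶ Y} {g : Z ⟶ X} {k : Z ⟶ Y} (hk : g ≫ f = k)
    {M : OMod Y} {N : OMod X} {a : SemiHom f M N} (ha : a.IsPull) (K : OMod Z) :
    Function.Bijective (fun b : SemiHom g N K => a.comp hk b) := by
  subst hk
  rw [a.isPull_iff] at ha
  have h1 := (ha ((pushforward g).obj K)).comp (SemiHom.equiv g N K).symm.bijective
  let e : SemiHom f M ((pushforward g).obj K) ≃ SemiHom (g ≫ f) M K :=
    (SemiHom.equiv f M ((pushforward g).obj K)).symm.trans (SemiHom.equiv (g ≫ f) M K)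
  have h2 := e.bijective.comp h1
  convert h2 using 1
  funext b
  apply SemiHom.ext'
  intro U x
  symm
  have h3 : ∀ (y : Sec K ((Opens.map (g ≫ f).hom.base).obj U)), rest K le_rfl y = y :=
    fun y => rest_self K _ y
  refine (h3 _).trans ?_
  rfl

lemma SemiHom.isPull_comp_iff {f : X ⟶ Y} {g : Z ⟶ X} {k : Z ⟶ Y} (hk : g ≫ f = k)
    {M : OMod Y} {N : OMod X} {K : OMod Z} {a : SemiHom f M N} (ha : a.IsPull) (b : SemiHom g N K) :
    (a.comp hk b).IsPull ↔ b.IsPull := by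
  rw [isPull_iff, isPull_iff]
  refine forall_congr' fun L => ?_
  have := (ha.comp_bijective hk L).of_comp_iff' (fun c : K ⟶ L => b.post c)
  rw [← this]
  rfl

lemma isPull_adjEquiv {f : X ⟶ Y} {M : OMod Y} {N : OMod X} (e : (pullback f).obj M ⟶ N) [IsIso e] :
    (adjEquiv f M N e).IsPull := by
  unfold SemiHom.IsPull
  simpa

/-- The isomorphism `f^* M ≅ N` given by a morphism that exhibits `N` as the inverse image. -/
def SemiHom.IsPull.iso {f : X ⟶ Y} {M : OMod Y} {N : OMod X} {a : SemiHom f M N} (h : a.IsPull) :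
    (pullback f).obj M ≅ N :=
  have : IsIso ((adjEquiv f M N).symm a) := h
  asIso ((adjEquiv f M N).symm a)

lemma SemiHom.IsPull.adjEquiv_iso {f : X ⟶ Y} {M : OMod Y} {N : OMod X} {a : SemiHom f M N} (h : a.IsPull) :
    adjEquiv f M N h.iso.hom = a := by
  have : IsIso ((adjEquiv f M N).symm a) := h
  exact (adjEquiv f M N).apply_symm_apply a

/-- The canonical morphism `M → f^* M` over `f`. -/
def unitSemi (f : X ⟶ Y) (M : OMod Y) : SemiHom f M ((pullback f).obj M) :=
  adjEquiv f M _ (𝟙 _)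

lemma unitSemi_isPull (f : X ⟶ Y) (M : OMod Y) : (unitSemi f M).IsPull := isPull_adjEquiv _

/-- The identity of `M`, as a morphism over the identity of `X`. -/
def idSemi (M : OMod X) : SemiHom (𝟙 X) M M where
  toFun U V h := rest M h
  map_smul' U V h r x := by
    exact rest_smul M (V := V) (U := U) h r x
  map_rest' U V h U' V' hU hV h' x := by
    exact (rest_rest M _ _ x).trans (rest_rest M _ _ x).symm

lemma idSemi_isPull (M : OMod X) : (idSemi M).IsPull := by
  rw [SemiHom.isPull_iff]
  intro K
  constructor
  · intro a b h
    apply hom_ext'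
    intro U x
    have : ((idSemi M).post a).toFun U U le_rfl x = ((idSemi M).post b).toFun U U le_rfl x := by
      have h' : (idSemi M).post a = (idSemi M).post b := h
      rw [h']
    change onSec a U (rest M le_rfl x) = onSec b U (rest M le_rfl x) at this
    rwa [rest_self] at this
  · intro b
    refine ⟨SemiHom.toHom (𝟙 X) b, ?_⟩
    apply SemiHom.ext'
    intro U x
    show b.toFun U U le_rfl (rest M le_rfl x) = b.toFun U U le_rfl x
    rw [rest_self]

/-- The functor `W ↦ V ∩ W` on open subsets. -/
def capFunctor (V : Opens X.carrier) : Opens X.carrier ⥤ Opens X.carrier :=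
  Opens.map V.inclusion' ⋙ V.isOpenEmbedding.isOpenMap.functor

lemma capFunctor_le_left (V W : Opens X.carrier) : (capFunctor V).obj W ≤ V := by
  rintro _ ⟨x, _, rfl⟩; exact x.2

lemma capFunctor_le_right (V W : Opens X.carrier) : (capFunctor V).obj W ≤ W := by
  rintro _ ⟨x, hx, rfl⟩; exact hx

lemma le_capFunctor {V W T : Opens X.carrier} (h : T ≤ V) (h' : T ≤ W) :
    T ≤ (capFunctor V).obj W := fun x hx => ⟨⟨x, h hx⟩, h' hx, rfl⟩

instance (V : Opens X.carrier) : (capFunctor V).IsContinuous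
    (Opens.grothendieckTopology X.carrier) (Opens.grothendieckTopology X.carrier) :=
  have := V.isOpenEmbedding.functor_isContinuous
  Functor.isContinuous_comp _ _ _
    (Opens.grothendieckTopology ((Opens.toTopCat X.carrier).obj V)) _

/-- The restriction maps `Γ(W, O_X) → Γ(V ∩ W, O_X)`. -/
def capRing (V : Opens X.carrier) : ringSheaf X ⟶
    ((capFunctor V).sheafPushforwardContinuous _ _ _).obj (ringSheaf X) where
  hom :=
    { app U := (ringSheaf X).obj.map (homOfLE (capFunctor_le_right V U.unop)).op
      naturality U U' g := by
        show (ringSheaf X).obj.map _ ≫ (ringSheaf X).obj.map _ =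
          (ringSheaf X).obj.map _ ≫ (ringSheaf X).obj.map _
        rw [← Functor.map_comp, ← Functor.map_comp]
        rfl }

/-- The `O_X`-module `W ↦ Γ(V ∩ W, N)`. -/
def capMod (V : Opens X.carrier) (N : OMod X) : OMod X :=
  (SheafOfModules.pushforward (capRing V)).obj N

/-- A section of `capMod V N` over `W`, read as a section of `N` over `V ∩ W`. -/
def capSec {V : Opens X.carrier} {N : OMod X} {W : Opens X.carrier}
   (x : Sec (capMod V N) W) : Sec N ((capFunctor V).obj W) := x

lemma capSec_smul {V : Opens X.carrier} {N : OMod X} {W : Opens X.carrier}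
   (r : Fun X W) (x : Sec (capMod V N) W) : capSec (r • x) = funRest (capFunctor_le_right V W) r • capSec x := rfl

lemma capSec_rest {V : Opens X.carrier} {N : OMod X} {W W' : Opens X.carrier} (h : W' ≤ W)
   (x : Sec (capMod V N) W) : capSec (rest _ h x) = rest N (show (capFunctor V).obj W' ≤ (capFunctor V).obj W from
    le_capFunctor (capFunctor_le_left _ _) ((capFunctor_le_right _ _).trans h)) (capSec x) := rfl

/-- A morphism of `O_X`-modules from compatible linear maps on sections. -/
def mkHom {M N : OMod X} (f : ∀ U, Sec M U →ₗ[Fun X U] Sec N U)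
    (hf : ∀ {U V : Opens X.carrier} (h : V ≤ U) (x : Sec M U), f V (rest M h x) = rest N h (f U x)) :
    M ⟶ N where
  val :=
    { app U := ModuleCat.ofHom (X := M.val.obj U) (Y := N.val.obj U)
        { toFun := f U.unop
          map_add' := (f U.unop).map_add
          map_smul' := (f U.unop).map_smul }
      naturality {U V} g := by
        ext x
        exact hf g.unop.le x }

lemma onSec_mkHom {M N : OMod X} (f : ∀ U, Sec M U →ₗ[Fun X U] Sec N U)
    (hf : ∀ {U V : Opens X.carrier} (h : V ≤ U) (x : Sec M U), f V (rest M h x) = rest N h (f U x))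
    (U : Opens X.carrier) (x : Sec M U) : onSec (mkHom f hf) U x = f U x := rfl

/-- The structure sheaf `O_X` as an `O_X`-module. -/
def structMod (X : CSpace) : OMod X := SheafOfModules.unit (ringSheaf X)

/-- The sections `e₁, …, eₙ` over `U` are a basis of `M` over `U`: they give an isomorphism
`O_Uⁿ ≅ M|_U`. -/
def IsBasisOn {M : OMod X} {U : Opens X.carrier} {n : ℕ} (e : Fin n → Sec M U) : Prop :=
  ∀ (V : Opens X.carrier) (h : V ≤ U),
    Function.Bijective (fun c : Fin n → Fun X V => ∑ i, c i • rest M h (e i))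

/-- `M` is a vector bundle: a locally free `O_X`-module of finite rank. -/
def IsVectorBundle (M : OMod X) : Prop :=
  ∀ x : X.carrier, ∃ U : Opens X.carrier, x ∈ U ∧ ∃ (n : ℕ) (e : Fin n → Sec M U), IsBasisOn e

namespace IsBasisOn
variable {M : OMod X} {U : Opens X.carrier} {n : ℕ} {e : Fin n → Sec M U} (he : IsBasisOn e)

/-- Coordinates of a section with respect to a local basis. -/
def coord {V : Opens X.carrier} (h : V ≤ U) : Sec M V →ₗ[Fun X V] (Fin n → Fun X V) :=
  (LinearEquiv.ofBijective
    ({ toFun := fun c => ∑ i, c i • rest M h (e i)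
       map_add' := fun c d => by simp [add_smul, Finset.sum_add_distrib]
       map_smul' := fun r c => by simp [mul_smul, Finset.smul_sum] } :
      (Fin n → Fun X V) →ₗ[Fun X V] Sec M V) (he V h)).symm.toLinearMap

lemma sum_coord {V : Opens X.carrier} (h : V ≤ U) (x : Sec M V) :
    ∑ i, he.coord h x i • rest M h (e i) = x :=
  LinearEquiv.apply_symm_apply (LinearEquiv.ofBijective
    ({ toFun := fun c => ∑ i, c i • rest M h (e i)
       map_add' := fun c d => by simp [add_smul, Finset.sum_add_distrib]
       map_smul' := fun r c => by simp [mul_smul, Finset.smul_sum] } :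
      (Fin n → Fun X V) →ₗ[Fun X V] Sec M V) (he V h)) x

lemma coord_unique {V : Opens X.carrier} (h : V ≤ U) (x : Sec M V) (c : Fin n → Fun X V)
    (hc : ∑ i, c i • rest M h (e i) = x) : he.coord h x = c :=
  (he V h).1 ((he.sum_coord h x).trans hc.symm)

lemma coord_rest {V V' : Opens X.carrier} (h : V ≤ U) (h' : V' ≤ V) (x : Sec M V) (i : Fin n) :
    he.coord (h'.trans h) (rest M h' x) i = funRest h' (he.coord h x i) := by
  have := he.coord_unique (h'.trans h) (rest M h' x) (fun i => funRest h' (he.coord h x i)) (by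
    conv_rhs => rw [← he.sum_coord h x]
    rw [map_sum]
    refine Finset.sum_congr rfl fun i _ => ?_
    rw [rest_smul, rest_rest])
  rw [this]

end IsBasisOn

lemma funRest_funRest {U V W : Opens X.carrier} (h : V ≤ U) (h' : W ≤ V) (x : Fun X U) :
    funRest h' (funRest h x) = funRest (h'.trans h) x :=
  (ConcreteCategory.congr_hom (X.presheaf.map_comp (homOfLE h).op (homOfLE h').op) x).symm

lemma funRest_self {U : Opens X.carrier} (h : U ≤ U) (x : Fun X U) : funRest h x = x :=
  ConcreteCategory.congr_hom (X.presheaf.map_id (op U)) x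

/-- A section of the module `O_X`, read as a function. -/
def structSec {U : Opens X.carrier} (x : Sec (structMod X) U) : Fun X U := x

theorem SemiHom.IsPull.isBasisOn {f : X ⟶ Y} {M : OMod Y} {N : OMod X} {a : SemiHom f M N}
    (ha : a.IsPull) {U : Opens Y.carrier} {n : ℕ} {e : Fin n → Sec M U} (he : IsBasisOn e)
    {U' : Opens X.carrier} (hU' : U' ≤ (Opens.map f.hom.base).obj U) :
    IsBasisOn (fun i => a.toFun U U' hU' (e i)) := by
  rw [SemiHom.isPull_iff] at ha
  intro V hV
  have capU : ∀ (W : Opens Y.carrier) (T : Opens X.carrier) (hT : T ≤ (Opens.map f.hom.base).obj W),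
      (capFunctor V).obj T ≤ (Opens.map f.hom.base).obj (W ⊓ U) := fun W T hT x hx =>
    ⟨hT (capFunctor_le_right V T hx), hU' (hV (capFunctor_le_left V T hx))⟩
  let p : Fin n → SemiHom f M (capMod V (structMod X)) := fun i =>
    { toFun := fun W T hT =>
        { toFun := fun x => (show Fun X ((capFunctor V).obj T) from
            funPull f (capU W T hT) (he.coord (inf_le_right : W ⊓ U ≤ U) (rest M inf_le_left x) i))
          map_zero' := by
            simp only [map_zero, Pi.zero_apply]
            rfl
          map_add' := fun x y => by
            simp only [map_add, Pi.add_apply]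
            rfl }
      map_smul' := fun W T hT r x => by
        show funPull f (capU W T hT) (he.coord (inf_le_right : W ⊓ U ≤ U) (rest M inf_le_left (r • x)) i) =
          funRest (capFunctor_le_right V T) (funPull f hT r) *
            funPull f (capU W T hT) (he.coord (inf_le_right : W ⊓ U ≤ U) (rest M inf_le_left x) i)
        rw [rest_smul, map_smul, Pi.smul_apply, smul_eq_mul, map_mul,
          ← funPull_rest hT inf_le_left (capFunctor_le_right V T) (capU W T hT)]
      map_rest' := fun W T hT W' T' hW hT' h x => by
        show funPull f (capU W' T' h) (he.coord (inf_le_right : W' ⊓ U ≤ U)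
            (rest M inf_le_left (rest M hW x)) i) =
          funRest (le_capFunctor (capFunctor_le_left _ _) ((capFunctor_le_right _ _).trans hT'))
            (funPull f (capU W T hT) (he.coord (inf_le_right : W ⊓ U ≤ U) (rest M inf_le_left x) i))
        rw [← funPull_rest (capU W T hT) (inf_le_inf_right U hW) _ (capU W' T' h), ← he.coord_rest,
          rest_rest, rest_rest] }
  choose q hq using fun i => (ha (capMod V (structMod X))).2 (p i)
  let m : ∀ T : Opens X.carrier, Fin n → Sec N ((capFunctor V).obj T) := fun T i =>
    rest N ((capFunctor_le_left V T).trans hV) (a.toFun U U' hU' (e i))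
  have hm : ∀ {T T' : Opens X.carrier} (h : T' ≤ T) (i : Fin n),
      m T' i = rest N (le_capFunctor (capFunctor_le_left _ _) ((capFunctor_le_right _ _).trans h)) (m T i) :=
    fun h i => (rest_rest N _ _ _).symm
  let co : ∀ (T : Opens X.carrier) (i : Fin n), Sec N T → Fun X ((capFunctor V).obj T) :=
    fun T i x => structSec (capSec (onSec (q i) T x))
  have co_add : ∀ T i x y, co T i (x + y) = co T i x + co T i y := fun T i x y => by
    show structSec (capSec (onSec (q i) T (x + y))) = _
    rw [map_add]; rfl
  have co_smul : ∀ T i (r : Fun X T) x, co T i (r • x) = funRest (capFunctor_le_right V T) r * co T i x :=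
    fun T i r x => by
    show structSec (capSec (onSec (q i) T (r • x))) = _
    rw [map_smul]; rfl
  have co_rest : ∀ {T T' : Opens X.carrier} (h : T' ≤ T) i x, co T' i (rest N h x) =
      funRest (le_capFunctor (capFunctor_le_left _ _) ((capFunctor_le_right _ _).trans h)) (co T i x) :=
    fun {T T'} h i x => by
    show structSec (capSec (onSec (q i) T' (rest N h x))) = _
    rw [onSec_rest]; rfl
  have co_a : ∀ W T hT i x, co T i (a.toFun W T hT x) =
      funPull f (capU W T hT) (he.coord (inf_le_right : W ⊓ U ≤ U) (rest M inf_le_left x) i) :=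
    fun W T hT i x => by
    have h1 : ((a.post (q i)).toFun W T hT x) = (p i).toFun W T hT x := by
      have := hq i
      rw [← this]
    exact h1
  let ρ : N ⟶ capMod V N := mkHom (fun T =>
    { toFun := fun x => (rest N (capFunctor_le_right V T) x : Sec N _)
      map_add' := fun x y => map_add (rest N (capFunctor_le_right V T)) x y
      map_smul' := fun r x => rest_smul N (capFunctor_le_right V T) r x })
    (fun {T T'} h x => by
      have h1 : (capFunctor V).obj T' ≤ (capFunctor V).obj T :=
        le_capFunctor (capFunctor_le_left _ _) ((capFunctor_le_right _ _).trans h)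
      show rest N (capFunctor_le_right V T') (rest N h x) = rest N h1 (rest N (capFunctor_le_right V T) x)
      rw [rest_rest, rest_rest])
  let τ : N ⟶ capMod V N := mkHom (fun T =>
    { toFun := fun x => (∑ i, co T i x • m T i : Sec N _)
      map_add' := fun x y => by
        simp only [co_add, add_smul, Finset.sum_add_distrib]; rfl
      map_smul' := fun r x => by
        simp only [co_smul, mul_smul, ← Finset.smul_sum]; rfl })
    (fun {T T'} h x => by
      show ∑ i, co T' i (rest N h x) • m T' i =
        rest N (le_capFunctor (capFunctor_le_left _ _) ((capFunctor_le_right _ _).trans h)) (∑ i, co T i x • m T i)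
      rw [map_sum]
      refine Finset.sum_congr rfl fun i _ => ?_
      rw [rest_smul, co_rest, hm h])
  have hρτ : ρ = τ := by
    apply (ha (capMod V N)).1
    apply SemiHom.ext'
    intro W x
    set T := (Opens.map f.hom.base).obj W
    show rest N (capFunctor_le_right V T) (a.toFun W T le_rfl x) = ∑ i, co T i (a.toFun W T le_rfl x) • m T i
    have h1 : rest N (capFunctor_le_right V T) (a.toFun W T le_rfl x) =
        a.toFun (W ⊓ U) _ (capU W T le_rfl) (rest M inf_le_left x) :=
      (a.map_rest' _ _ _ _ _ _ _ _ _).symm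
    rw [h1]
    conv_lhs => rw [← he.sum_coord (inf_le_right : W ⊓ U ≤ U) (rest M inf_le_left x)]
    rw [map_sum]
    refine Finset.sum_congr rfl fun i _ => ?_
    rw [a.map_smul', co_a]
    congr 1
    exact a.map_rest' _ _ _ _ _ _ _ _ _
  have key : ∀ T x, rest N (capFunctor_le_right V T) x = ∑ i, co T i x • m T i := fun T x =>
    congrArg (fun g => onSec g T x) hρτ
  have hVV : V ≤ (capFunctor V).obj V := le_capFunctor le_rfl le_rfl
  constructor
  · intro c d hcd
    funext j
    have hc : ∀ c : Fin n → Fun X V, co V j (∑ i, c i • rest N hV (a.toFun U U' hU' (e i))) =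
        funRest (capFunctor_le_right V V) (c j) := by
      intro c
      have hsum : co V j (∑ i, c i • rest N hV (a.toFun U U' hU' (e i))) =
          ∑ i, co V j (c i • rest N hV (a.toFun U U' hU' (e i))) :=
        map_sum (AddMonoidHom.mk' (co V j) (co_add V j)) _ _
      rw [hsum]
      rw [Finset.sum_eq_single j]
      · rw [co_smul, co_rest hV, co_a]
        have : he.coord (inf_le_right : U ⊓ U ≤ U) (rest M inf_le_left (e j)) = Pi.single j 1 := by
          apply he.coord_unique
          rw [Finset.sum_eq_single j]
          · simp
          · intro i _ hij
            simp [hij]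
          · simp
        rw [this]
        simp
      · intro i _ hij
        rw [co_smul, co_rest hV, co_a]
        have : he.coord (inf_le_right : U ⊓ U ≤ U) (rest M inf_le_left (e i)) = Pi.single i 1 := by
          apply he.coord_unique
          rw [Finset.sum_eq_single i]
          · simp
          · intro k _ hik
            simp [hik]
          · simp
        rw [this]
        simp [Ne.symm hij]
      · simp
    have h1 : funRest (capFunctor_le_right V V) (c j) = funRest (capFunctor_le_right V V) (d j) := by
      rw [← hc c, ← hc d]
      exact congrArg (co V j) hcd
    have h2 := congrArg (funRest hVV) h1
    rwa [funRest_funRest, funRest_funRest, funRest_self, funRest_self] at h2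
  · intro x
    refine ⟨fun i => funRest hVV (co V i x), ?_⟩
    have h1 := congrArg (rest N hVV) (key V x)
    rw [rest_rest, rest_self, map_sum] at h1
    refine Eq.trans ?_ h1.symm
    refine Finset.sum_congr rfl fun i _ => ?_
    rw [rest_smul]
    congr 1
    exact (rest_rest N _ _ _).symm

theorem SemiHom.IsPull.isVectorBundle {f : X ⟶ Y} {M : OMod Y} {N : OMod X} {a : SemiHom f M N}
    (ha : a.IsPull) (hM : IsVectorBundle M) : IsVectorBundle N := by
  intro x
  obtain ⟨U, hxU, n, e, he⟩ := hM (f.hom.base x)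
  exact ⟨(Opens.map f.hom.base).obj U, hxU, n, _, ha.isBasisOn he le_rfl⟩

section Thick

/-- The functor `R ↦ A ⊗_ℂ R` on commutative `ℂ`-algebras. -/
def tensorFunctor (A : Type) [CommRing A] [Algebra ℂ A] : CommAlgCat.{0} ℂ ⥤ CommAlgCat.{0} ℂ where
  obj R := CommAlgCat.of ℂ (A ⊗[ℂ] R)
  map f := CommAlgCat.ofHom (Algebra.TensorProduct.map (AlgHom.id ℂ A) f.hom)
  map_id R := by
    apply CommAlgCat.hom_ext
    exact Algebra.TensorProduct.map_id
  map_comp {R S T} f g := by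
    apply CommAlgCat.hom_ext
    show Algebra.TensorProduct.map (AlgHom.id ℂ A) (g.hom.comp f.hom) =
      (Algebra.TensorProduct.map (AlgHom.id ℂ A) g.hom).comp
        (Algebra.TensorProduct.map (AlgHom.id ℂ A) f.hom)
    ext <;> simp

/-- For finite `A`, the functor `R ↦ A ⊗_ℂ R` to types is corepresented by a polynomial ring. -/
def tensorFunctorForgetCorepresentable (A : Type) [CommRing A] [Algebra ℂ A] [Module.Finite ℂ A] :
    (tensorFunctor A ⋙ forget (CommAlgCat.{0} ℂ)).CorepresentableBy
      (CommAlgCat.of ℂ (MvPolynomial (Module.Free.ChooseBasisIndex ℂ A) ℂ)) where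
  homEquiv {R} :=
    (show ((CommAlgCat.of ℂ (MvPolynomial (Module.Free.ChooseBasisIndex ℂ A) ℂ)) ⟶ R) ≃
        (Module.Free.ChooseBasisIndex ℂ A → R) from
      { toFun := fun f i => f.hom (MvPolynomial.X i)
        invFun := fun a => CommAlgCat.ofHom (MvPolynomial.aeval (R := ℂ) (S₁ := R) a)
        left_inv := fun f => by
          apply CommAlgCat.hom_ext
          apply MvPolynomial.algHom_ext
          simp
        right_inv := fun a => by funext i; simp }).trans
    (Finsupp.equivFunOnFinite.symm.trans
      (TensorProduct.equivFinsuppOfBasisLeft (Module.Free.chooseBasis ℂ A) (N := R)).symm.toEquiv)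
  homEquiv_comp {R S} g f := by
    show (TensorProduct.equivFinsuppOfBasisLeft (Module.Free.chooseBasis ℂ A) (N := S)).symm
        (Finsupp.equivFunOnFinite.symm fun i => g.hom (f.hom (MvPolynomial.X i))) =
      Algebra.TensorProduct.map (AlgHom.id ℂ A) g.hom
        ((TensorProduct.equivFinsuppOfBasisLeft (Module.Free.chooseBasis ℂ A) (N := R)).symm
          (Finsupp.equivFunOnFinite.symm fun i => f.hom (MvPolynomial.X i)))
    simp [Finsupp.sum_fintype]

instance (A : Type) [CommRing A] [Algebra ℂ A] [Module.Finite ℂ A] :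
    PreservesLimits (tensorFunctor A) :=
  have : PreservesLimits (tensorFunctor A ⋙ forget (CommAlgCat.{0} ℂ)) :=
    preservesLimits_of_natIso (tensorFunctorForgetCorepresentable A).toIso
  have : ReflectsLimits (forget (CommAlgCat.{0} ℂ)) := reflectsLimits_of_reflectsIsomorphisms
  preservesLimits_of_reflects_of_preserves _ (forget (CommAlgCat.{0} ℂ))

/-- The product `Spec A × X` for a finite-dimensional local `ℂ`-algebra `A`, where `Spec A` is the
one-point analytic space with algebra of functions `A`: the space of `X` with the sheaf
`A ⊗_ℂ O_X`. -/
def thick (A : Type) [CommRing A] [Algebra ℂ A] [Module.Finite ℂ A] (X : CSpace) : CSpace where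
  carrier := X.carrier
  presheaf := X.presheaf ⋙ tensorFunctor A
  IsSheaf := ((sheafCompose _ (tensorFunctor A)).obj X.sheaf).2

lemma tensorMap_comm {A B R S : Type} [CommRing A] [Algebra ℂ A] [CommRing B] [Algebra ℂ B]
    [CommRing R] [Algebra ℂ R] [CommRing S] [Algebra ℂ S] (φ : A →ₐ[ℂ] B) (g : R →ₐ[ℂ] S) :
    (Algebra.TensorProduct.map φ (AlgHom.id ℂ S)).comp
        (Algebra.TensorProduct.map (AlgHom.id ℂ A) g) =
      (Algebra.TensorProduct.map (AlgHom.id ℂ B) g).comp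
        (Algebra.TensorProduct.map φ (AlgHom.id ℂ R)) := by
  ext <;> simp

/-- The evaluation `A ⊗_ℂ R → R` at a point `φ : A → ℂ`. -/
def tensorEval {A : Type} [CommRing A] [Algebra ℂ A] (φ : A →ₐ[ℂ] ℂ) (R : Type) [CommRing R]
    [Algebra ℂ R] : A ⊗[ℂ] R →ₐ[ℂ] R :=
  (Algebra.TensorProduct.lid ℂ R).toAlgHom.comp (Algebra.TensorProduct.map φ (AlgHom.id ℂ R))

lemma tensorEval_tmul {A : Type} [CommRing A] [Algebra ℂ A] (φ : A →ₐ[ℂ] ℂ) {R : Type} [CommRing R]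
    [Algebra ℂ R] (a : A) (r : R) : tensorEval φ R (a ⊗ₜ r) = φ a • r := by
  simp [tensorEval]

lemma tensorEval_comm {A R S : Type} [CommRing A] [Algebra ℂ A]
    [CommRing R] [Algebra ℂ R] [CommRing S] [Algebra ℂ S] (φ : A →ₐ[ℂ] ℂ) (g : R →ₐ[ℂ] S) :
    (tensorEval φ S).comp (Algebra.TensorProduct.map (AlgHom.id ℂ A) g) =
      g.comp (tensorEval φ R) := by
  ext <;> simp [tensorEval_tmul]

variable (A : Type) [CommRing A] [Algebra ℂ A] [Module.Finite ℂ A]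
variable (B : Type) [CommRing B] [Algebra ℂ B] [Module.Finite ℂ B]

/-- The projection `Spec A × X → X`. -/
def thickProj (X : CSpace) : thick A X ⟶ X := InducedCategory.homMk
  { base := 𝟙 _
    c :=
      { app U := CommAlgCat.ofHom
          (Algebra.TensorProduct.includeRight : Fun X U.unop →ₐ[ℂ] A ⊗[ℂ] Fun X U.unop)
        naturality U V f := by
          apply CommAlgCat.hom_ext
          apply AlgHom.ext
          intro x
          exact (Algebra.TensorProduct.map_tmul (AlgHom.id ℂ A) (X.presheaf.map f).hom 1 x).symm } }

/-- The morphism `id × f : Spec A × X → Spec A × Y`. -/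
def thickHom {X Y : CSpace} (f : X ⟶ Y) : thick A X ⟶ thick A Y := InducedCategory.homMk
  { base := f.hom.base
    c := Functor.whiskerRight f.hom.c (tensorFunctor A) }

variable {A B}

/-- The morphism `Spec φ × id : Spec B × X → Spec A × X`. -/
def thickMap (φ : A →ₐ[ℂ] B) (X : CSpace) : thick B X ⟶ thick A X := InducedCategory.homMk
  { base := 𝟙 _
    c :=
      { app U := CommAlgCat.ofHom (Algebra.TensorProduct.map φ (AlgHom.id ℂ (Fun X U.unop)))
        naturality U V f := by
          apply CommAlgCat.hom_ext
          exact tensorMap_comm φ (X.presheaf.map f).hom } }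

/-- The inclusion `X → Spec A × X` of the fibre over the point `φ : A → ℂ` of `Spec A`. -/
def thickPoint (φ : A →ₐ[ℂ] ℂ) (X : CSpace) : X ⟶ thick A X := InducedCategory.homMk
  { base := 𝟙 _
    c :=
      { app U := CommAlgCat.ofHom (tensorEval φ (Fun X U.unop))
        naturality U V f := by
          apply CommAlgCat.hom_ext
          exact tensorEval_comm φ (X.presheaf.map f).hom } }

lemma cspace_hom_ext {X Y : CSpace} {f g : X ⟶ Y} (h : f.hom.base = g.hom.base)
    (h' : ∀ (U : Opens Y.carrier) (V : Opens X.carrier) (hf : V ≤ (Opens.map f.hom.base).obj U)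
       (hg : V ≤ (Opens.map g.hom.base).obj U) (x : Fun Y U), funPull f hf x = funPull g hg x) : f = g := by
  obtain ⟨f, fc⟩ := f
  obtain ⟨g, gc⟩ := g
  obtain rfl : f = g := h
  congr
  ext U x
  have := h' U ((Opens.map f).obj U) le_rfl le_rfl x
  have h1 : ∀ y : Fun X ((Opens.map f).obj U), funRest (le_refl _) y = y := fun y =>
    ConcreteCategory.congr_hom (X.presheaf.map_id _) y
  exact (h1 _).symm.trans (this.trans (h1 _))

lemma funPull_eq {X Y : CSpace} (f : X ⟶ Y) {U : Opens Y.carrier} {V : Opens X.carrier}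
    (h : V ≤ (Opens.map f.hom.base).obj U) (x : Fun Y U) :
    funPull f h x = funRest h ((f.hom.c.app (op U)).hom x) := rfl

lemma thickMap_comp_proj (φ : A →ₐ[ℂ] B) (X : CSpace) :
    thickMap φ X ≫ thickProj A X = thickProj B X := by
  refine cspace_hom_ext rfl fun U V hf hg x => ?_
  have h1 : Algebra.TensorProduct.map φ (AlgHom.id ℂ (Fun X U)) (1 ⊗ₜ[ℂ] x) = 1 ⊗ₜ[ℂ] x := by simp
  exact congrArg (funRest (X := thick B X) hf) h1

lemma thickPoint_comp_proj (φ : A →ₐ[ℂ] ℂ) (X : CSpace) :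
    thickPoint φ X ≫ thickProj A X = 𝟙 X := by
  refine cspace_hom_ext rfl fun U V hf hg x => ?_
  have h1 : tensorEval φ (Fun X U) (1 ⊗ₜ[ℂ] x) = x := by simp [tensorEval_tmul]
  exact congrArg (funRest (X := X) hf) h1

lemma thickPoint_comp_map (φ : A →ₐ[ℂ] B) (ε : B →ₐ[ℂ] ℂ) (X : CSpace) :
    thickPoint ε X ≫ thickMap φ X = thickPoint (ε.comp φ) X := by
  refine cspace_hom_ext rfl fun U V hf hg x => ?_
  have h1 : (tensorEval ε (Fun X U)).comp (Algebra.TensorProduct.map φ (AlgHom.id ℂ (Fun X U))) =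
      tensorEval (ε.comp φ) (Fun X U) := by
    ext <;> simp [tensorEval_tmul]
  exact congrArg (funRest (X := X) hf) (DFunLike.congr_fun h1 x)

lemma thickHom_comp_map (φ : A →ₐ[ℂ] B) {X Y : CSpace} (f : X ⟶ Y) :
    thickHom B f ≫ thickMap φ Y = thickMap φ X ≫ thickHom A f := by
  refine cspace_hom_ext rfl fun U V hf hg x => ?_
  exact congrArg (funRest (X := thick B X) hf)
    (DFunLike.congr_fun (tensorMap_comm φ (f.hom.c.app (op U)).hom).symm x)

lemma thickPoint_comp_hom (ε : A →ₐ[ℂ] ℂ) {X Y : CSpace} (f : X ⟶ Y) :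
    thickPoint ε X ≫ thickHom A f = f ≫ thickPoint ε Y := by
  refine cspace_hom_ext rfl fun U V hf hg x => ?_
  exact congrArg (funRest (X := X) hf)
    (DFunLike.congr_fun (tensorEval_comm ε (f.hom.c.app (op U)).hom) x)

end Thick

lemma SemiHom.comp_assoc {T : CSpace} {f : X ⟶ Y} {g : Z ⟶ X} {k : Z ⟶ Y} {l : T ⟶ Z} {m : T ⟶ X} {n : T ⟶ Y}
    (hk : g ≫ f = k) (hm : l ≫ g = m) (hn : l ≫ k = n) (hn' : m ≫ f = n)
    {M : OMod Y} {N : OMod X} {K : OMod Z} {L : OMod T}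
    (a : SemiHom f M N) (b : SemiHom g N K) (c : SemiHom l K L) :
    (a.comp hk b).comp hn c = a.comp hn' (b.comp hm c) := by
  subst hk hm hn
  apply SemiHom.ext'
  intro U x
  rfl

lemma SemiHom.comp_post {f : X ⟶ Y} {g : Z ⟶ X} {k : Z ⟶ Y} (hk : g ≫ f = k)
    {M : OMod Y} {N : OMod X} {K K' : OMod Z} (a : SemiHom f M N) (b : SemiHom g N K) (t : K ⟶ K') :
    (a.comp hk b).post t = a.comp hk (b.post t) := rfl

/-- Composition of a morphism of `O_Y`-modules with a morphism over `f`. -/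
def SemiHom.pre {f : X ⟶ Y} {M M' : OMod Y} {N : OMod X} (t : M' ⟶ M) (a : SemiHom f M N) :
    SemiHom f M' N where
  toFun U V h := (a.toFun U V h).comp (onSec t U).toAddMonoidHom
  map_smul' U V h r x := by
    show a.toFun U V h (onSec t U (r • x)) = _
    rw [map_smul, a.map_smul']; rfl
  map_rest' U V h U' V' hU hV h' x := by
    show a.toFun U' V' h' (onSec t U' (rest M' hU x)) = _
    rw [onSec_rest, a.map_rest' U V h U' V' hU hV]; rfl

lemma adjEquiv_pre {f : X ⟶ Y} {M M' : OMod Y} {N : OMod X} (t : M' ⟶ M) (a : (pullback f).obj M ⟶ N) :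
    adjEquiv f M' N ((pullback f).map t ≫ a) = (adjEquiv f M N a).pre t := by
  apply SemiHom.ext'
  intro U x
  have := (adj f).homEquiv_naturality_left t a
  show rest N _ (onSec ((adj f).homEquiv M' N ((pullback f).map t ≫ a)) U x) =
    rest N _ (onSec ((adj f).homEquiv M N a) U (onSec t U x))
  rw [this]
  rfl

lemma SemiHom.post_comp {f : X ⟶ Y} {g : Z ⟶ X} {k : Z ⟶ Y} (hk : g ≫ f = k)
    {M : OMod Y} {N N' : OMod X} {K : OMod Z} (a : SemiHom f M N) (t : N ⟶ N') (b : SemiHom g N' K) :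
    (a.post t).comp hk b = a.comp hk (b.pre t) := rfl

lemma SemiHom.pre_comp {f : X ⟶ Y} {g : Z ⟶ X} {k : Z ⟶ Y} (hk : g ≫ f = k)
    {M M' : OMod Y} {N : OMod X} {K : OMod Z} (t : M' ⟶ M) (a : SemiHom f M N) (b : SemiHom g N K) :
    (a.pre t).comp hk b = (a.comp hk b).pre t := rfl

/-- If `N = f^* M` via `a`, a morphism over `f ∘ g` from `M` factors uniquely through `a`. -/
def SemiHom.IsPull.desc {f : X ⟶ Y} {g : Z ⟶ X} {k : Z ⟶ Y} (hk : g ≫ f = k)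
    {M : OMod Y} {N : OMod X} {K : OMod Z} {a : SemiHom f M N} (ha : a.IsPull) (c : SemiHom k M K) :
    SemiHom g N K :=
  ((ha.comp_bijective hk K).2 c).choose

lemma SemiHom.IsPull.comp_desc {f : X ⟶ Y} {g : Z ⟶ X} {k : Z ⟶ Y} (hk : g ≫ f = k)
    {M : OMod Y} {N : OMod X} {K : OMod Z} {a : SemiHom f M N} (ha : a.IsPull) (c : SemiHom k M K) :
    a.comp hk (ha.desc hk c) = c :=
  ((ha.comp_bijective hk K).2 c).choose_spec

lemma SemiHom.IsPull.hom_ext {f : X ⟶ Y} {g : Z ⟶ X} {k : Z ⟶ Y} (hk : g ≫ f = k)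
    {M : OMod Y} {N : OMod X} {K : OMod Z} {a : SemiHom f M N} (ha : a.IsPull) {b c : SemiHom g N K}
    (h : a.comp hk b = a.comp hk c) : b = c :=
  (ha.comp_bijective hk K).1 h

lemma SemiHom.IsPull.desc_isPull {f : X ⟶ Y} {g : Z ⟶ X} {k : Z ⟶ Y} (hk : g ≫ f = k)
    {M : OMod Y} {N : OMod X} {K : OMod Z} {a : SemiHom f M N} (ha : a.IsPull) {c : SemiHom k M K}
    (hc : c.IsPull) : (ha.desc hk c).IsPull := by
  rw [← SemiHom.isPull_comp_iff hk ha, ha.comp_desc hk]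
  exact hc

section Deform

variable (A : Type) [CommRing A] [Algebra ℂ A] [Module.Finite ℂ A] [IsLocalRing A]
variable (B : Type) [CommRing B] [Algebra ℂ B] [Module.Finite ℂ B] [IsLocalRing B]

lemma residue_bijective : Function.Bijective (algebraMap ℂ (IsLocalRing.ResidueField A)) := by
  have : Module.Finite ℂ (IsLocalRing.ResidueField A) :=
    Module.Finite.of_surjective (IsScalarTower.toAlgHom ℂ A (IsLocalRing.ResidueField A)).toLinearMap
      IsLocalRing.residue_surjective
  exact IsAlgClosed.algebraMap_bijective_of_isIntegral

/-- The closed point `A → ℂ` of a finite-dimensional local `ℂ`-algebra; it is unique, see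
`aug_unique`. -/
def aug : A →ₐ[ℂ] ℂ :=
  (AlgEquiv.ofBijective (Algebra.ofId ℂ (IsLocalRing.ResidueField A))
    (residue_bijective A)).symm.toAlgHom.comp
    (IsScalarTower.toAlgHom ℂ A (IsLocalRing.ResidueField A))

variable {A B}
lemma aug_unique (f : A →ₐ[ℂ] ℂ) : f = aug A := by
  have hker : ∀ (g : A →ₐ[ℂ] ℂ) (a : A), g a = 0 ↔ ¬ IsUnit a := by
    intro g a
    constructor
    · intro h hu
      exact (hu.map g).ne_zero h
    · intro h
      by_contra h0
      have h1 : g (a - algebraMap ℂ A (g a)) = 0 := by simp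
      have h2 : ¬ IsUnit (a - algebraMap ℂ A (g a)) := fun hu => (hu.map g).ne_zero h1
      have h3 : algebraMap ℂ A (g a) ∈ nonunits A := by
        have : algebraMap ℂ A (g a) = a + - (a - algebraMap ℂ A (g a)) := by ring
        rw [this]
        exact IsLocalRing.nonunits_add h (fun hu => h2 (by simpa using hu.neg))
      exact h3 ((isUnit_iff_ne_zero.mpr h0).map (algebraMap ℂ A))
  apply AlgHom.ext
  intro a
  have h1 : aug A (a - algebraMap ℂ A (f a)) = 0 := by
    rw [hker, ← hker f]; simp
  rw [map_sub, sub_eq_zero] at h1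
  rw [h1]; simp

lemma aug_comp (φ : A →ₐ[ℂ] B) : (aug B).comp φ = aug A := aug_unique _

/-- A vector bundle `E` on `X`, framed along the closed subspace `i : Y → X` with fixed bundle `W` on
`Y`: the framing is an isomorphism `i^* E ≅ W`. -/
structure FramedBundle (i : Y ⟶ X) (W : OMod Y) where
  E : OMod X
  isVectorBundle : IsVectorBundle E
  framing : (pullback i).obj E ≅ W

/-- The framing of `E`, read as the map `E → i^* E ≅ W` over `i`. -/
def FramedBundle.restr {i : Y ⟶ X} {W : OMod Y} (F : FramedBundle i W) : SemiHom i F.E W :=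
  adjEquiv i F.E W F.framing.hom

variable (A) in
/-- The inverse image `p^* W` of `W` under the projection `p : Spec A × Y → Y`. -/
def constFamily (W : OMod Y) : OMod (thick A Y) := (pullback (thickProj A Y)).obj W

variable (A) in
/-- The canonical map `W → p^* W` over the projection `p : Spec A × Y → Y`. -/
def constFamilyUnit (W : OMod Y) : SemiHom (thickProj A Y) W (constFamily A W) :=
  unitSemi (thickProj A Y) W

variable (A) in
lemma constFamilyUnit_isPull (W : OMod Y) : (constFamilyUnit A W).IsPull :=
  unitSemi_isPull (thickProj A Y) W

variable (A) in
/-- The canonical identification of the restriction of `p^* W` to the closed fibre with `W`, as a map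
`p^* W → W` over the inclusion `Y → Spec A × Y`. -/
def constFamilyAt (W : OMod Y) : SemiHom (thickPoint (aug A) Y) (constFamily A W) W :=
  (constFamilyUnit_isPull A W).desc (thickPoint_comp_proj (aug A) Y) (idSemi W)

/-- The canonical identification of the inverse image of `p^* W` under `Spec B × Y → Spec A × Y` with
the constant family over `Spec B`, as a map over this morphism. -/
def constFamilyMap (φ : A →ₐ[ℂ] B) (W : OMod Y) :
    SemiHom (thickMap φ Y) (constFamily A W) (constFamily B W) :=
  (constFamilyUnit_isPull A W).desc (thickMap_comp_proj φ Y) (constFamilyUnit B W)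

variable (A) in
/-- A deformation over `Spec A` of the framed vector bundle `F₀ = (E₀, α₀)`: a vector bundle on
`Spec A × X`, framed along `Spec A × Y` with bundle `p^* W`, and an isomorphism `fibre` of its
restriction to the closed fibre with `E₀` such that, on the closed fibre over `Y`, the framing of
the family agrees with `α₀` through this isomorphism. -/
structure Deformation {i : Y ⟶ X} {W : OMod Y} (F₀ : FramedBundle i W) where
  family : FramedBundle (thickHom A i) (constFamily A W)
  fibre : (pullback (thickPoint (aug A) X)).obj family.E ≅ F₀.E
  compat : (adjEquiv _ _ _ fibre.hom).comp rfl F₀.restr =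
    family.restr.comp (thickPoint_comp_hom (aug A) i) (constFamilyAt A W)

variable {i : Y ⟶ X} {W : OMod Y} {F₀ : FramedBundle i W}

/-- The isomorphism of the closed fibre with `E₀`, read as the map `E → E₀` over `X → Spec A × X`. -/
def Deformation.spec (D : Deformation A F₀) : SemiHom (thickPoint (aug A) X) D.family.E F₀.E :=
  adjEquiv _ _ _ D.fibre.hom

/-- Two deformations are isomorphic if there is an isomorphism of the vector bundles on `Spec A × X`
which is compatible with the framings and with the identifications of the closed fibre with `E₀`. -/
def Deformation.Iso (D D' : Deformation A F₀) : Prop :=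
  ∃ f : D.family.E ≅ D'.family.E,
    (pullback (thickHom A i)).map f.hom ≫ D'.family.framing.hom = D.family.framing.hom ∧
    (pullback (thickPoint (aug A) X)).map f.hom ≫ D'.fibre.hom = D.fibre.hom

variable (A) in
/-- Isomorphism of deformations is an equivalence relation. -/
def Deformation.setoid (F₀ : FramedBundle i W) : Setoid (Deformation A F₀) where
  r := Deformation.Iso
  iseqv :=
    { refl := fun D => ⟨Iso.refl _, by simp, by simp⟩
      symm := by
        rintro D D' ⟨f, h1, h2⟩
        exact ⟨f.symm, by rw [← h1, ← Category.assoc, ← Functor.map_comp]; simp,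
          by rw [← h2, ← Category.assoc, ← Functor.map_comp]; simp⟩
      trans := by
        rintro D D' D'' ⟨f, h1, h2⟩ ⟨g, h3, h4⟩
        exact ⟨f ≪≫ g, by rw [← h1, ← h3]; simp, by rw [← h2, ← h4]; simp⟩ }

variable (A) in
/-- The set `Def(E₀, α₀)(A)` of isomorphism classes of deformations over `Spec A`. -/
def Def (F₀ : FramedBundle i W) : Type 1 := Quotient (Deformation.setoid A F₀)

/-- The isomorphism class of a deformation. -/
def Deformation.cls (D : Deformation A F₀) : Def A F₀ := Quotient.mk (Deformation.setoid A F₀) D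

lemma constFamilyMap_isPull (φ : A →ₐ[ℂ] B) (W : OMod Y) : (constFamilyMap φ W).IsPull :=
  SemiHom.IsPull.desc_isPull _ _ (constFamilyUnit_isPull B W)

lemma constFamilyUnit_comp_map (φ : A →ₐ[ℂ] B) (W : OMod Y) :
    (constFamilyUnit A W).comp (thickMap_comp_proj φ Y) (constFamilyMap φ W) = constFamilyUnit B W :=
  SemiHom.IsPull.comp_desc _ _ _

variable (A) in
lemma constFamilyUnit_comp_at (W : OMod Y) :
    (constFamilyUnit A W).comp (thickPoint_comp_proj (aug A) Y) (constFamilyAt A W) = idSemi W :=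
  SemiHom.IsPull.comp_desc _ _ _

lemma point_comp_map (φ : A →ₐ[ℂ] B) (X : CSpace) :
    thickPoint (aug B) X ≫ thickMap φ X = thickPoint (aug A) X :=
  (thickPoint_comp_map φ (aug B) X).trans (by rw [aug_comp])

lemma constFamilyMap_comp_at (φ : A →ₐ[ℂ] B) (W : OMod Y) :
    (constFamilyMap φ W).comp (point_comp_map φ Y) (constFamilyAt B W) = constFamilyAt A W := by
  refine (constFamilyUnit_isPull A W).hom_ext (thickPoint_comp_proj (aug A) Y) ?_
  rw [constFamilyUnit_comp_at, ← SemiHom.comp_assoc (thickMap_comp_proj φ Y) (point_comp_map φ Y)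
    (thickPoint_comp_proj (aug B) Y), constFamilyUnit_comp_map, constFamilyUnit_comp_at]

lemma FramedBundle.restr_comp_isPull (φ : A →ₐ[ℂ] B)
    (F : FramedBundle (thickHom A i) (constFamily A W)) :
    (F.restr.comp rfl (constFamilyMap φ W)).IsPull :=
  (SemiHom.isPull_comp_iff rfl (isPull_adjEquiv F.framing.hom) _).2 (constFamilyMap_isPull φ W)

/-- The inverse image of a framed family under `Spec B → Spec A`. Its framing is the inverse image of
the framing, followed by the canonical identification of the constant families. -/
def FramedBundle.baseChange (φ : A →ₐ[ℂ] B) (F : FramedBundle (thickHom A i) (constFamily A W)) :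
    FramedBundle (thickHom B i) (constFamily B W) where
  E := (pullback (thickMap φ X)).obj F.E
  isVectorBundle := (unitSemi_isPull _ _).isVectorBundle F.isVectorBundle
  framing := ((unitSemi_isPull (thickMap φ X) F.E).desc_isPull (thickHom_comp_map φ i)
    (F.restr_comp_isPull φ)).iso

/-- The canonical map from a family to its base change. -/
def FramedBundle.baseChangeUnit (φ : A →ₐ[ℂ] B)
    (F : FramedBundle (thickHom A i) (constFamily A W)) :
    SemiHom (thickMap φ X) F.E (F.baseChange φ).E :=
  unitSemi (thickMap φ X) F.E

lemma FramedBundle.baseChangeUnit_isPull (φ : A →ₐ[ℂ] B)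
    (F : FramedBundle (thickHom A i) (constFamily A W)) : (F.baseChangeUnit φ).IsPull :=
  unitSemi_isPull _ _

lemma FramedBundle.baseChange_restr (φ : A →ₐ[ℂ] B)
    (F : FramedBundle (thickHom A i) (constFamily A W)) :
    (F.baseChangeUnit φ).comp (thickHom_comp_map φ i) (F.baseChange φ).restr =
      F.restr.comp rfl (constFamilyMap φ W) := by
  have : (F.baseChange φ).restr = (F.baseChangeUnit_isPull φ).desc (thickHom_comp_map φ i)
      (F.restr.comp rfl (constFamilyMap φ W)) :=
    SemiHom.IsPull.adjEquiv_iso ((unitSemi_isPull (thickMap φ X) F.E).desc_isPull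
      (thickHom_comp_map φ i) (F.restr_comp_isPull φ))
  rw [this, SemiHom.IsPull.comp_desc]

/-- The closed fibre of the base change of a deformation is the closed fibre of the deformation. -/
def Deformation.baseChangeFibre (φ : A →ₐ[ℂ] B) (D : Deformation A F₀) :
    (pullback (thickPoint (aug B) X)).obj (D.family.baseChange φ).E ≅ F₀.E :=
  ((D.family.baseChangeUnit_isPull φ).desc_isPull (point_comp_map φ X)
    (isPull_adjEquiv D.fibre.hom)).iso

lemma Deformation.baseChangeFibre_spec (φ : A →ₐ[ℂ] B) (D : Deformation A F₀) :
    (D.family.baseChangeUnit φ).comp (point_comp_map φ X)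
      (adjEquiv _ _ _ (D.baseChangeFibre φ).hom) = D.spec := by
  rw [Deformation.baseChangeFibre, SemiHom.IsPull.adjEquiv_iso, SemiHom.IsPull.comp_desc]
  rfl

/-- The inverse image of a deformation under `Spec B → Spec A`. -/
def Deformation.baseChange (φ : A →ₐ[ℂ] B) (D : Deformation A F₀) : Deformation B F₀ where
  family := D.family.baseChange φ
  fibre := D.baseChangeFibre φ
  compat := by
    refine (D.family.baseChangeUnit_isPull φ).hom_ext
      (k := i ≫ thickPoint (aug A) X) (by rw [Category.assoc, point_comp_map]) ?_
    rw [← SemiHom.comp_assoc (point_comp_map φ X) rfl rfl, D.baseChangeFibre_spec,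
      ← SemiHom.comp_assoc (thickHom_comp_map φ i) (thickPoint_comp_hom (aug B) i) (by
        rw [← Category.assoc, point_comp_map, thickPoint_comp_hom]), FramedBundle.baseChange_restr,
      SemiHom.comp_assoc rfl (point_comp_map φ Y) _ (thickPoint_comp_hom (aug A) i),
      constFamilyMap_comp_at]
    exact D.compat

lemma unitSemi_pre {f : X ⟶ Y} {M M' : OMod Y} (t : M' ⟶ M) :
    (unitSemi f M).pre t = (unitSemi f M').post ((pullback f).map t) := by
  rw [unitSemi, unitSemi, ← adjEquiv_pre, ← adjEquiv_post, Category.comp_id, Category.id_comp]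

lemma Deformation.iso_iff (D D' : Deformation A F₀) : D.Iso D' ↔
    ∃ f : D.family.E ≅ D'.family.E, D'.family.restr.pre f.hom = D.family.restr ∧
      D'.spec.pre f.hom = D.spec := by
  refine exists_congr fun f => and_congr ?_ ?_
  · rw [FramedBundle.restr, ← adjEquiv_pre]
    exact (adjEquiv _ _ _).injective.eq_iff.symm
  · rw [Deformation.spec, ← adjEquiv_pre]
    exact (adjEquiv _ _ _).injective.eq_iff.symm

lemma Deformation.baseChange_iso (φ : A →ₐ[ℂ] B) {D D' : Deformation A F₀} (h : D.Iso D') :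
    (D.baseChange φ).Iso (D'.baseChange φ) := by
  rw [Deformation.iso_iff] at h ⊢
  obtain ⟨f, h1, h2⟩ := h
  obtain ⟨g, hg⟩ : ∃ g : (D.family.baseChange φ).E ≅ (D'.family.baseChange φ).E,
      (D'.family.baseChangeUnit φ).pre f.hom = (D.family.baseChangeUnit φ).post g.hom :=
    ⟨(pullback (thickMap φ X)).mapIso f, unitSemi_pre f.hom⟩
  refine ⟨g, ?_, ?_⟩
  · show (D'.family.baseChange φ).restr.pre g.hom = (D.family.baseChange φ).restr
    refine (D.family.baseChangeUnit_isPull φ).hom_ext (thickHom_comp_map φ i) ?_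
    refine Eq.trans ?_ (FramedBundle.baseChange_restr φ D.family).symm
    rw [← SemiHom.post_comp, ← hg, SemiHom.pre_comp, ← h1, ← SemiHom.pre_comp]
    exact congrArg (SemiHom.pre f.hom) (FramedBundle.baseChange_restr φ D'.family)
  · show (adjEquiv _ _ _ (D'.baseChangeFibre φ).hom).pre g.hom =
      adjEquiv _ _ _ (D.baseChangeFibre φ).hom
    refine (D.family.baseChangeUnit_isPull φ).hom_ext (point_comp_map φ X) ?_
    refine Eq.trans ?_ (D.baseChangeFibre_spec φ).symm
    rw [← SemiHom.post_comp, ← hg, SemiHom.pre_comp, ← h2]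
    exact congrArg (SemiHom.pre f.hom) (D'.baseChangeFibre_spec φ)

/-- The functoriality of `Def(E₀, α₀)` in the local algebra. -/
def Def.map (φ : A →ₐ[ℂ] B) : Def A F₀ → Def B F₀ :=
  Quotient.map (Deformation.baseChange φ) (fun _ _ h => Deformation.baseChange_iso φ h)

end Deform

section Linear

/-- Multiplication by a complex number on an `O_X`-module. -/
def scaleHom (z : ℂ) (M : OMod X) : M ⟶ M :=
  mkHom (fun U => LinearMap.lsmul (Fun X U) (Sec M U) (algebraMap ℂ (Fun X U) z))
    (fun {U V} h x => by
      have h1 : rest M h (algebraMap ℂ (Fun X U) z • x) =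
          funRest h (algebraMap ℂ (Fun X U) z) • rest M h x := rest_smul M h _ x
      rw [(funRest h).commutes] at h1
      exact h1.symm)

lemma onSec_scaleHom (z : ℂ) (M : OMod X) (U : Opens X.carrier) (x : Sec M U) :
    onSec (scaleHom z M) U x = algebraMap ℂ (Fun X U) z • x := rfl

lemma onSec_add {M N : OMod X} (f g : M ⟶ N) (U : Opens X.carrier) (x : Sec M U) :
    onSec (f + g) U x = onSec f U x + onSec g U x := rfl

lemma onSec_comp {M N K : OMod X} (f : M ⟶ N) (g : N ⟶ K) (U : Opens X.carrier) (x : Sec M U) :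
    onSec (f ≫ g) U x = onSec g U (onSec f U x) := rfl

instance : Linear ℂ (OMod X) where
  homModule M N :=
    { smul := fun z f => f ≫ scaleHom z N
      one_smul := fun f => hom_ext' fun U x => by
        show algebraMap ℂ (Fun X U) 1 • onSec f U x = _
        rw [map_one, one_smul]
      mul_smul := fun a b f => hom_ext' fun U x => by
        show algebraMap ℂ (Fun X U) (a * b) • onSec f U x =
          algebraMap ℂ (Fun X U) a • algebraMap ℂ (Fun X U) b • onSec f U x
        rw [map_mul, mul_smul]
      smul_zero := fun a => zero_comp
      smul_add := fun a f g => Preadditive.add_comp _ _ _ _ _ _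
      add_smul := fun a b f => hom_ext' fun U x => by
        show algebraMap ℂ (Fun X U) (a + b) • onSec f U x =
          algebraMap ℂ (Fun X U) a • onSec f U x + algebraMap ℂ (Fun X U) b • onSec f U x
        rw [map_add, add_smul]
      zero_smul := fun f => hom_ext' fun U x => by
        show algebraMap ℂ (Fun X U) 0 • onSec f U x = 0
        rw [map_zero, zero_smul] }
  smul_comp M N K r f g := hom_ext' fun U x => by
    show onSec g U (algebraMap ℂ (Fun X U) r • onSec f U x) =
      algebraMap ℂ (Fun X U) r • onSec g U (onSec f U x)
    rw [map_smul]
  comp_smul M N K f r g := (Category.assoc _ _ _).symm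

end Linear

instance : HasExt.{1} (OMod X) := HasExt.standard _

/-- The ideal sheaf `J` of the closed subspace `i : Y → X`: the kernel of `O_X → i_* O_Y`. -/
def idealSheaf (i : Y ⟶ X) : OMod X :=
  kernel (SheafOfModules.unitToPushforwardObjUnit (ringHom i))

/-- The inclusion of the ideal sheaf in `O_X`. -/
def idealSheafIncl (i : Y ⟶ X) : idealSheaf i ⟶ structMod X := kernel.ι _

/-- Presheaves of `O_X`-modules. -/
abbrev PreMod (X : CSpace) := PresheafOfModules.{0} (commRingPresheaf X ⋙ forget₂ CommRingCat.{0} RingCat.{0})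

/-- The presheaf `U ↦ Γ(U, M) ⊗_{Γ(U, O_X)} Γ(U, N)`. -/
def preTensor (M N : OMod X) : PreMod X :=
  MonoidalCategory.tensorObj (C := PreMod X) M.val N.val

/-- The tensor product `M ⊗ N` of `O_X`-modules: the sheaf associated with `preTensor M N`. -/
def tensor (M N : OMod X) : OMod X :=
  (PresheafOfModules.sheafification (𝟙 (ringSheaf X).obj)).obj (preTensor M N)

/-- The canonical map `M ⊗ J → M ⊗ O_X = M`, `m ⊗ r ↦ r m`. -/
def tensorIdealHom (i : Y ⟶ X) (M : OMod X) : tensor M (idealSheaf i) ⟶ M :=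
  ((PresheafOfModules.sheafificationAdjunction (𝟙 (ringSheaf X).obj)).homEquiv (preTensor M (idealSheaf i)) M).symm
   (MonoidalCategory.whiskerLeft (C := PreMod X) M.val (idealSheafIncl i).val ≫
    (MonoidalCategory.rightUnitor (C := PreMod X) M.val).hom)

section Analytic

/-- The algebra of holomorphic functions on an open subset of `ℂⁿ`. -/
def holomorphic (n : ℕ) (U : Opens (Fin n → ℂ)) : Subalgebra ℂ (U → ℂ) where
  carrier := {f | ∀ x : U, AnalyticAt ℂ (Function.extend Subtype.val f 0) (x : Fin n → ℂ)}
  mul_mem' {f g} hf hg x := by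
    refine ((hf x).mul (hg x)).congr ?_
    filter_upwards [U.isOpen.mem_nhds x.2] with y hy
    have h : ∀ k : U → ℂ, Function.extend Subtype.val k 0 y = k ⟨y, hy⟩ := fun k =>
      Subtype.val_injective.extend_apply k 0 (⟨y, hy⟩ : U)
    simp [h]
  add_mem' {f g} hf hg x := by
    refine ((hf x).add (hg x)).congr ?_
    filter_upwards [U.isOpen.mem_nhds x.2] with y hy
    have h : ∀ k : U → ℂ, Function.extend Subtype.val k 0 y = k ⟨y, hy⟩ := fun k =>
      Subtype.val_injective.extend_apply k 0 (⟨y, hy⟩ : U)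
    simp [h]
  algebraMap_mem' c x := by
    refine (analyticAt_const (v := c)).congr ?_
    filter_upwards [U.isOpen.mem_nhds x.2] with y hy
    exact (Subtype.val_injective.extend_apply (algebraMap ℂ (U → ℂ) c) 0 (⟨y, hy⟩ : U)).symm

/-- Restriction of holomorphic functions. -/
def holomorphicRest (n : ℕ) {U V : Opens (Fin n → ℂ)} (h : V ≤ U) :
    holomorphic n U →ₐ[ℂ] holomorphic n V where
  toFun f := ⟨fun x => f.1 ⟨x.1, h x.2⟩, fun x => by
    refine (f.2 ⟨x.1, h x.2⟩).congr ?_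
    filter_upwards [V.isOpen.mem_nhds x.2] with y hy
    exact (Subtype.val_injective.extend_apply f.1 0 (⟨y, h hy⟩ : U)).trans
      (Subtype.val_injective.extend_apply (fun x : V => f.1 ⟨x.1, h x.2⟩) 0 (⟨y, hy⟩ : V)).symm⟩
  map_one' := rfl
  map_mul' _ _ := rfl
  map_zero' := rfl
  map_add' _ _ := rfl
  commutes' _ := rfl

/-- The presheaf of holomorphic functions on `ℂⁿ`. -/
def holomorphicPresheaf (n : ℕ) :
    TopCat.Presheaf (CommAlgCat.{0} ℂ) (TopCat.of (Fin n → ℂ)) where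
  obj U := CommAlgCat.of ℂ (holomorphic n U.unop)
  map f := CommAlgCat.ofHom (holomorphicRest n f.unop.le)
  map_id _ := rfl
  map_comp _ _ := rfl

/-- Being holomorphic is a local property. -/
def holomorphicLocal (n : ℕ) :
    TopCat.LocalPredicate (X := TopCat.of (Fin n → ℂ)) (fun _ => ℂ) where
  pred {U} f := f ∈ holomorphic n U
  res {U V} h f hf := (holomorphicRest n h.le ⟨f, hf⟩).2
  locality {U} f hf x := by
    obtain ⟨V, hx, h, hV⟩ := hf x
    refine (hV ⟨x, hx⟩).congr ?_
    filter_upwards [V.isOpen.mem_nhds hx] with y hy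
    exact (Subtype.val_injective.extend_apply (fun x : V => f ⟨x.1, h.le x.2⟩) (0 : (Fin n → ℂ) → ℂ)
      (⟨y, hy⟩ : V)).trans
      (Subtype.val_injective.extend_apply f (0 : (Fin n → ℂ) → ℂ) (⟨y, h.le hy⟩ : U)).symm

lemma holomorphicPresheaf_isSheaf (n : ℕ) : (holomorphicPresheaf n).IsSheaf := by
  have h : TopCat.Presheaf.IsSheaf (holomorphicPresheaf n ⋙ forget (CommAlgCat.{0} ℂ)) :=
    TopCat.subpresheafToTypes.isSheaf (holomorphicLocal n)
  have : ReflectsLimits (forget (CommAlgCat.{0} ℂ)) := reflectsLimits_of_reflectsIsomorphisms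
  exact CategoryTheory.Presheaf.isSheaf_of_isSheaf_comp _ _ (forget (CommAlgCat.{0} ℂ)) h

/-- The space `ℂⁿ` with its sheaf of holomorphic functions. -/
def affineSpace (n : ℕ) : CSpace where
  carrier := TopCat.of (Fin n → ℂ)
  presheaf := holomorphicPresheaf n
  IsSheaf := holomorphicPresheaf_isSheaf n

/-- The value of a holomorphic function at a point. -/
def holValue {n : ℕ} {D : Opens (affineSpace n).carrier} (f : Fun (affineSpace n) D) (z : D) : ℂ :=
  (show holomorphic n D from f).1 z

/-- The map `f⁻¹ O_Y → O_X` is surjective: every function on `X` is locally the pullback of a function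
on `Y`. -/
def FunLocallySurjective (f : X ⟶ Y) : Prop :=
  ∀ (V : Opens X.carrier) (g : Fun X V) (x : X.carrier), x ∈ V →
    ∃ (U : Opens Y.carrier) (V' : Opens X.carrier) (h : V' ≤ (Opens.map f.hom.base).obj U)
      (hV : V' ≤ V) (r : Fun Y U), x ∈ V' ∧ funPull f h r = funRest hV g

/-- The map `χ : X → ℂⁿ` identifies `X` with the closed subspace of the open subset `D` of `ℂⁿ` defined
by the holomorphic functions `f₁, …, f_k` on `D`, that is, with their zero set `Z`, equipped with
the sheaf `(O_D / (f₁, …, f_k))|_Z`. -/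
structure IsModel {n k : ℕ} (χ : X ⟶ affineSpace n) (D : Opens (affineSpace n).carrier)
    (f : Fin k → Fun (affineSpace n) D) : Prop where
  isEmbedding : Topology.IsEmbedding χ.hom.base
  range_eq : Set.range χ.hom.base = {z | ∃ h : z ∈ D, ∀ j, holValue (f j) ⟨z, h⟩ = 0}
  surjective : FunLocallySurjective χ
  ker (U : Opens (affineSpace n).carrier) (hU : U ≤ D) (r : Fun (affineSpace n) U) :
    funPull χ (le_refl ((Opens.map χ.hom.base).obj U)) r = 0 ↔
      ∀ x : X.carrier, χ.hom.base x ∈ U → ∃ (U' : Opens (affineSpace n).carrier) (h : U' ≤ U),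
        χ.hom.base x ∈ U' ∧
          funRest h r ∈ Ideal.span (Set.range fun j => funRest (h.trans hU) (f j))

/-- The open subspace of `X` on the open subset `U`. -/
abbrev openSubspace (X : CSpace) (U : Opens X.carrier) : CSpace := X.restrict U.isOpenEmbedding

/-- `X` is a complex analytic space: every point has an open neighbourhood that is isomorphic to a
local model. Neither a separation nor a countability axiom is imposed, nor is `X` required to be
reduced or of finite dimension. -/
def IsAnalytic (X : CSpace) : Prop :=
  ∀ x : X.carrier, ∃ U : Opens X.carrier, x ∈ U ∧
    ∃ (n k : ℕ) (χ : openSubspace X U ⟶ affineSpace n) (D : Opens (affineSpace n).carrier)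
      (f : Fin k → Fun (affineSpace n) D), IsModel χ D f

/-- `i : Y → X` is a closed immersion: a closed embedding of topological spaces with `O_X → i_* O_Y`
surjective. -/
structure IsClosedSubspace (i : Y ⟶ X) : Prop where
  isClosedEmbedding : Topology.IsClosedEmbedding i.hom.base
  surjective : FunLocallySurjective i

end Analytic

section Dual

/-- The algebra `ℂ[ε]` of dual numbers. -/
abbrev Dual : Type := DualNumber ℂ

instance : Module.Finite ℂ Dual := inferInstanceAs (Module.Finite ℂ (ℂ × ℂ))

/-- The fibre product `ℂ[ε] ×_ℂ ℂ[ε]`. -/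
def doubleDual : Subalgebra ℂ (Dual × Dual) :=
  AlgHom.equalizer
    ((TrivSqZeroExt.fstHom ℂ ℂ ℂ).comp (AlgHom.fst ℂ Dual Dual))
    ((TrivSqZeroExt.fstHom ℂ ℂ ℂ).comp (AlgHom.snd ℂ Dual Dual))

lemma mem_doubleDual (x : Dual × Dual) : x ∈ doubleDual ↔ x.1.fst = x.2.fst := Iff.rfl

lemma doubleDual_isUnit_iff (x : doubleDual) : IsUnit x ↔ x.1.1.fst ≠ 0 := by
  constructor
  · intro h h0
    have := h.map ((TrivSqZeroExt.fstHom ℂ ℂ ℂ).comp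
      ((AlgHom.fst ℂ Dual Dual).comp doubleDual.val))
    exact this.ne_zero h0
  · intro h
    have h2 : x.1.2.fst ≠ 0 := by rw [← (mem_doubleDual x.1).1 x.2]; exact h
    refine IsUnit.of_mul_eq_one (⟨(x.1.1⁻¹, x.1.2⁻¹), ?_⟩ : doubleDual) ?_
    · rw [mem_doubleDual]
      simp [(mem_doubleDual x.1).1 x.2]
    · apply Subtype.ext
      apply Prod.ext
      · exact TrivSqZeroExt.mul_inv_cancel h
      · exact TrivSqZeroExt.mul_inv_cancel h2

instance : IsLocalRing doubleDual := by
  refine IsLocalRing.of_nonunits_add fun a b ha hb => ?_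
  rw [mem_nonunits_iff, doubleDual_isUnit_iff, not_not] at *
  show a.1.1.fst + b.1.1.fst = 0
  rw [ha, hb, add_zero]

/-- The algebra map `a + b ε ↦ a + c b ε`. -/
def dualScale (c : ℂ) : Dual →ₐ[ℂ] Dual := TrivSqZeroExt.map (c • LinearMap.id)

/-- The first projection `ℂ[ε] ×_ℂ ℂ[ε] → ℂ[ε]`. -/
def doubleDualFst : doubleDual →ₐ[ℂ] Dual := (AlgHom.fst ℂ Dual Dual).comp doubleDual.val

/-- The second projection `ℂ[ε] ×_ℂ ℂ[ε] → ℂ[ε]`. -/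
def doubleDualSnd : doubleDual →ₐ[ℂ] Dual := (AlgHom.snd ℂ Dual Dual).comp doubleDual.val

/-- The addition map `ℂ[ε] ×_ℂ ℂ[ε] → ℂ[ε]`, `(a + b ε, a + b′ ε) ↦ a + (b + b′) ε`. -/
def doubleDualAdd : doubleDual →ₐ[ℂ] Dual where
  toFun x := TrivSqZeroExt.inl x.1.1.fst + TrivSqZeroExt.inr (x.1.1.snd + x.1.2.snd)
  map_one' := by simp
  map_mul' x y := by
    have hx := (mem_doubleDual x.1).1 x.2
    have hy := (mem_doubleDual y.1).1 y.2
    ext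
    · simp
    · simp [← hx, ← hy]
      ring
  map_zero' := by simp
  map_add' x y := by
    ext
    · simp
    · simp
      ring
  commutes' c := by
    ext <;> simp [TrivSqZeroExt.algebraMap_eq_inl]

end Dual

section Extensions

lemma thickHom_comp_proj (A : Type) [CommRing A] [Algebra ℂ A] [Module.Finite ℂ A]
    {X Y : CSpace} (f : X ⟶ Y) :
    thickHom A f ≫ thickProj A Y = thickProj A X ≫ f := by
  refine cspace_hom_ext rfl fun U V hf hg x => ?_
  have h1 : Algebra.TensorProduct.map (AlgHom.id ℂ A) (f.hom.c.app (op U)).hom (1 ⊗ₜ[ℂ] x) =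
      1 ⊗ₜ[ℂ] (f.hom.c.app (op U)).hom x := by simp
  exact congrArg (funRest (X := thick A X) hf) h1

/-- The function `ε` on `Spec ℂ[ε] × X`. -/
def epsFun (X : CSpace) (U : Opens (thick Dual X).carrier) : Fun (thick Dual X) U :=
  (show Dual ⊗[ℂ] Fun X U from DualNumber.eps ⊗ₜ[ℂ] 1)

/-- Multiplication by `ε` on the sections of a module on `Spec ℂ[ε] × X`. -/
def epsMul {M : OMod (thick Dual X)} {U : Opens (thick Dual X).carrier} (e : Sec M U) : Sec M U :=
  epsFun X U • e

variable {i : Y ⟶ X} {W : OMod Y} {F₀ : FramedBundle i W}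

/-- The map `u` from `F` to the bundle `E` of the deformation `D = (E, α, ψ)` over `Spec ℂ[ε]` (an
`O_X`-linear map, where `O_X` acts on `E` through the projection `Spec ℂ[ε] × X → X`) shows that
`D` is the deformation defined by the extension `0 → E₀ ⊗ J → F → E₀ → 0` with maps `a` and `p`.
Here `j : E₀ ⊗ J → E₀` is the canonical map. The conditions say:

* `ψ (u s) = p s` for sections `s` of `F`;
* `u (a z) = ε e` for sections `z` of `E₀ ⊗ J` and `e` of `E` with `ψ e = j z`. As `E` is flat,
  `e₀ ↦ ε e` for `ψ e = e₀` is an isomorphism `E₀ ≅ ε E`, so that this says that `u`, together with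
  `E₀ ≅ ε E ⊆ E`, is a map from the pushout `F ⊔_{E₀ ⊗ J} E₀` to `E`;
* the framing of `E` sends `u s` to the constant section of `p^* W` given by `α₀ (p s)`. -/
structure IsInducedBy {F : OMod X} (a : tensor F₀.E (idealSheaf i) ⟶ F) (p : F ⟶ F₀.E)
    (D : Deformation Dual F₀) (u : SemiHom (thickProj Dual X) F D.family.E) : Prop where
  fibre : u.comp (thickPoint_comp_proj (aug Dual) X) D.spec = (idSemi F).post p
  eps (U : Opens X.carrier) (z : Sec (tensor F₀.E (idealSheaf i)) U)
    (e : Sec D.family.E U) :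
    D.spec.toFun U U le_rfl e = onSec (tensorIdealHom i F₀.E) U z →
      u.toFun U U le_rfl (onSec a U z) = epsMul e
  framing : u.comp (thickHom_comp_proj Dual i) D.family.restr =
    (F₀.restr.pre p).comp rfl (constFamilyUnit Dual W)

end Extensions
end
end FramedDeformations

open FramedDeformations

/-! Why the theorem holds. Let `A` be a local `ℂ`-algebra whose maximal ideal has a basis `ε_k` with
all products `ε_k ε_l` equal to zero (`SqZeroBasis`). A deformation `E` over `Spec A × X` is, as an
`O_X`-module, an extension `0 → ⨁_k E₀ → E → E₀ → 0` whose sub-object consists of the multiples of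
the `ε_k` (`thick_shortExact`), and conversely the `O_X`-module `E` with these two maps determines
the action of `A`. The sections of `p^* W` have coefficients in `W` with respect to `1` and the
`ε_k`; the `ε_k`-coefficients of the framing form a map `r : E → ⨁_k i_* W`, and they extend the
canonical map `⨁_k E₀ → ⨁_k i_* W`. So a deformation is the same as an extension of `E₀` by
`⨁_k E₀` together with a trivialization of its image under `E₀ → i_* W`. This is the structure
`RelExt`, formed with the exact sequence `0 → E₀ ⊗ J → E₀ → i_* W → 0` (`tensorIdeal_shortExact`).

In any abelian category such a pair `(E, r)` is recovered, as a pushout, from the kernel of `r`,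
which is an extension of `E₀` by `⨁_k E₀ ⊗ J` (`RelExt.ker_shortExact`). Hence deformations over `A`
up to isomorphism correspond to classes in `Ext¹(E₀, ⨁_k E₀ ⊗ J)`, that is, to families of classes
in `Ext¹(E₀, E₀ ⊗ J)` indexed by the `ε_k` (`Def.comps_bijective`). Injectivity says that an
isomorphism of extensions is `A`-linear and respects the framing (`Deformation.iso_of_relExt`);
surjectivity says that an extension `E` on which the `ε_k` act through `E → E₀ → ⨁_k E₀ → E` is a
vector bundle over `Spec A × X` (`isBasisOn_of_shortExact`, `exists_relExt_isMap`).

A homomorphism `A → B` acts on the components of the class by its matrix on the maximal ideals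
(`Def.comps_map`). For `ℂ[ε]` and `ℂ[ε] ×_ℂ ℂ[ε]` there are one and two components; the projections
`ℂ[ε] ×_ℂ ℂ[ε] → ℂ[ε]` read off the two components, `a + b ε ↦ a + c b ε` multiplies the component
by `c`, and the addition map adds the two components. This gives the bijection and the vector space
structure. Finally, the class of an extension `F` is the class of the kernel of `r` if and only if
there is a map `u : F → E` that is compatible with the inclusions and the projections and is zero
after `r` (`RelExt.extClass_eq_cls_iff`). On local sections these are the conditions by which the
theorem relates an extension to a deformation (`exists_isInducedBy_iff`). -/

namespace FramedDeformations

noncomputable section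

/-! ### Extensions with a trivialization in an abelian category -/

section AbelianExtensions

open Abelian Pretriangulated DerivedCategory

universe w v u

variable {𝒞 : Type u} [Category.{v} 𝒞] [Abelian 𝒞]

section
variable [HasExt.{w} 𝒞]

/-- Every class in `Ext¹` is the class of an extension. In the derived category, the class is the
third map of a distinguished triangle, whose middle term is concentrated in degree `0`. -/
lemma exists_extClass_eq {C K : 𝒞} (x : Ext.{w} C K 1) :
    ∃ (F : 𝒞) (a : K ⟶ F) (p : F ⟶ C) (z : a ≫ p = 0) (hF : (ShortComplex.mk a p z).ShortExact),
      hF.extClass = x := by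
  let := HasDerivedCategory.standard 𝒞
  let s := singleFunctor 𝒞 0
  let h : s.obj C ⟶ (s.obj K)⟦(1 : ℤ)⟧ := x.hom
  have hι : ∀ ⦃A B : 𝒞⦄ ⦃n : ℤ⦄ (f : s.obj A ⟶ (s.obj B)⟦n⟧), n < 0 → f = 0 := by
    intro A B n f hn
    have h1 : TStructure.t.IsGE ((s.obj B)⟦n⟧) (-n) :=
      TStructure.t.isGE_shift (s.obj B) 0 n (-n) (by lia)
    exact TStructure.t.zero f 0 (-n) (by lia)
  obtain ⟨Z, f, g, hT⟩ := distinguished_cocone_triangle₂ h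
  -- the middle term comes from an object `F` of the abelian category
  have : TStructure.t.IsLE Z 0 := TStructure.t.isLE₂ _ hT 0
    (inferInstanceAs ((s.obj K).IsLE 0)) (inferInstanceAs ((s.obj C).IsLE 0))
  have : TStructure.t.IsGE Z 0 := TStructure.t.isGE₂ _ hT 0
    (inferInstanceAs ((s.obj K).IsGE 0)) (inferInstanceAs ((s.obj C).IsGE 0))
  obtain ⟨F, ⟨e⟩⟩ := exists_iso_singleFunctor_obj_of_isGE_of_isLE Z 0
  obtain ⟨a, ha⟩ := s.map_surjective (f ≫ e.hom)
  obtain ⟨p, hp⟩ := s.map_surjective (e.inv ≫ g)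
  have hT' : Triangle.mk (s.map a) (s.map p) h ∈ distTriang (DerivedCategory 𝒞) := by
    refine isomorphic_distinguished _ hT _
      (Triangle.isoMk _ _ (Iso.refl _) e.symm (Iso.refl _) ?_ ?_ ?_)
    · show s.map a ≫ e.inv = 𝟙 _ ≫ f
      rw [ha, Category.assoc, e.hom_inv_id, Category.comp_id, Category.id_comp]
    · show s.map p ≫ 𝟙 _ = e.inv ≫ g
      rw [hp, Category.comp_id]
    · show h ≫ (𝟙 (s.obj K))⟦(1 : ℤ)⟧' = 𝟙 _ ≫ h
      rw [CategoryTheory.Functor.map_id, Category.comp_id, Category.id_comp]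
  have hker := Triangulated.AbelianSubcategory.isLimitKernelForkOfDistTriang hι a p h hT'
  have hcok := Triangulated.AbelianSubcategory.isColimitCokernelCoforkOfDistTriang hι a p h hT'
  have z : a ≫ p = 0 := s.map_injective (by
    rw [Functor.map_comp, Functor.map_zero]; exact comp_distTriang_mor_zero₁₂ _ hT')
  have hF : (ShortComplex.mk a p z).ShortExact :=
    { exact := ShortComplex.exact_of_f_is_kernel _ hker
      mono_f := mono_of_isLimit_fork hker
      epi_g := epi_of_isColimit_cofork hcok }
  refine ⟨F, a, p, z, hF, ?_⟩
  ext
  rw [ShortComplex.ShortExact.extClass_hom]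
  -- the two triangles on `K → F → C` are compared by the identity on `K`, on `F` and on `C`
  obtain ⟨t, ht1, ht2⟩ := complete_distinguished_triangle_morphism _ _ hT'
    hF.singleTriangle_distinguished (𝟙 _) (𝟙 _)
    ((Category.comp_id _).trans (Category.id_comp _).symm)
  obtain ⟨t, rfl⟩ := s.map_surjective t
  have ht : t = 𝟙 C := by
    have := hF.epi_g
    have h1 : p ≫ t = p := s.map_injective (by
      rw [Functor.map_comp]
      exact ht1.trans (Category.id_comp _))
    exact (cancel_epi p).1 (by simpa using h1)
  subst ht
  have h2 : h ≫ (𝟙 (s.obj K))⟦(1 : ℤ)⟧' = s.map (𝟙 C) ≫ hF.singleδ := ht2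
  rw [CategoryTheory.Functor.map_id, CategoryTheory.Functor.map_id, Category.comp_id,
    Category.id_comp] at h2
  exact h2.symm

/-- Two extensions with the same class are equivalent. -/
lemma exists_map_of_extClass_eq {C K F F' : 𝒞} {a : K ⟶ F} {p : F ⟶ C} {z : a ≫ p = 0}
    {a' : K ⟶ F'} {p' : F' ⟶ C} {z' : a' ≫ p' = 0}
    (hF : (ShortComplex.mk a p z).ShortExact) (hF' : (ShortComplex.mk a' p' z').ShortExact)
    (h : hF.extClass = hF'.extClass) : ∃ g : F ⟶ F', a ≫ g = a' ∧ g ≫ p' = p := by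
  -- `p` lifts to `g₀`; the map `t` that `g₀` induces on `K` is corrected to the identity
  obtain ⟨g₀, hg₀⟩ := Ext.covariant_sequence_exact₃ _ hF' (Ext.mk₀ p) (n₁ := 1) rfl
    (by rw [← h]; exact hF.comp_extClass)
  obtain ⟨g₀, rfl⟩ := (Ext.mk₀_bijective _ _).2 g₀
  have hg : g₀ ≫ p' = p := by
    rw [Ext.mk₀_comp_mk₀] at hg₀
    exact (Ext.mk₀_bijective _ _).1 hg₀
  have := hF'.mono_f
  let t : K ⟶ K := hF'.exact.lift (a ≫ g₀) (by simp [hg, z])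
  have ht : t ≫ a' = a ≫ g₀ := hF'.exact.lift_f _ _
  have hnat := ShortComplex.ShortExact.extClass_naturality hF hF'
    { τ₁ := t, τ₂ := g₀, τ₃ := 𝟙 C, comm₁₂ := ht, comm₂₃ := by simpa using hg }
  have h0 : hF.extClass.comp (Ext.mk₀ (t - 𝟙 K)) (add_zero 1) = 0 := by
    rw [sub_eq_add_neg, Ext.mk₀_add, Ext.mk₀_neg, Ext.comp_add, Ext.comp_neg, hnat]
    simp [h]
  obtain ⟨s, hs⟩ := Ext.contravariant_sequence_exact₁ hF K _ _ h0
  obtain ⟨s, rfl⟩ := (Ext.mk₀_bijective _ _).2 s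
  have hs' : a ≫ s = t - 𝟙 K := by
    rw [Ext.mk₀_comp_mk₀] at hs
    exact (Ext.mk₀_bijective _ _).1 hs
  refine ⟨g₀ - s ≫ a', ?_, ?_⟩
  · rw [Preadditive.comp_sub, ← Category.assoc, hs', ← ht]
    simp
  · rw [Preadditive.sub_comp, Category.assoc, z', comp_zero, sub_zero, hg]

lemma extClass_eq_of_map {C K F F' : 𝒞} {a : K ⟶ F} {p : F ⟶ C} {z : a ≫ p = 0}
    {a' : K ⟶ F'} {p' : F' ⟶ C} {z' : a' ≫ p' = 0}
    (hF : (ShortComplex.mk a p z).ShortExact) (hF' : (ShortComplex.mk a' p' z').ShortExact)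
    (g : F ⟶ F') (h1 : a ≫ g = a') (h2 : g ≫ p' = p) : hF.extClass = hF'.extClass := by
  have := ShortComplex.ShortExact.extClass_naturality hF hF'
    { τ₁ := 𝟙 K, τ₂ := g, τ₃ := 𝟙 C, comm₁₂ := by simpa using h1.symm, comm₂₃ := by simpa using h2 }
  simpa using this

end

/-- An extension `0 → B → E → C → 0` together with a trivialization of its image under a given map
`B → Q`, for a short complex `K → B → Q`. The trivialization is given as a map `r : E → Q` that
extends `B → Q`. -/
structure RelExt (S : ShortComplex 𝒞) (C : 𝒞) where
  E : 𝒞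
  η : S.X₂ ⟶ E
  σ : E ⟶ C
  zero : η ≫ σ = 0
  shortExact : (ShortComplex.mk η σ zero).ShortExact
  r : E ⟶ S.X₃
  η_r : η ≫ r = S.g

namespace RelExt

variable {S S' : ShortComplex 𝒞} {C : 𝒞}

/-- The inclusion of `K` in the kernel of the trivialization. -/
def incl (T : RelExt S C) : S.X₁ ⟶ kernel T.r :=
  kernel.lift T.r (S.f ≫ T.η) (by rw [Category.assoc, T.η_r, S.zero])

lemma incl_ι (T : RelExt S C) : T.incl ≫ kernel.ι T.r = S.f ≫ T.η := kernel.lift_ι _ _ _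

/-- The projection of the kernel of the trivialization onto `C`. -/
def proj (T : RelExt S C) : kernel T.r ⟶ C := kernel.ι T.r ≫ T.σ

lemma incl_proj (T : RelExt S C) : T.incl ≫ T.proj = 0 := by
  rw [proj, reassoc_of% T.incl_ι, T.zero, comp_zero]

/-- The kernel of the trivialization is an extension of `C` by `K`. -/
lemma ker_shortExact (T : RelExt S C) (hS : S.ShortExact) :
    (ShortComplex.mk T.incl T.proj T.incl_proj).ShortExact where
  mono_f := by
    have := hS.mono_f
    have := T.shortExact.mono_f
    dsimp only at this
    have h : Mono (T.incl ≫ kernel.ι T.r) := by rw [incl_ι]; infer_instance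
    exact mono_of_mono T.incl (kernel.ι T.r)
  epi_g := by
    rw [epi_iff_surjective_up_to_refinements]
    intro A y
    have := T.shortExact.epi_g
    have := hS.epi_g
    obtain ⟨A', π, _, x, hx⟩ := surjective_up_to_refinements_of_epi T.σ y
    obtain ⟨A'', π', _, b, hb⟩ := surjective_up_to_refinements_of_epi S.g (x ≫ T.r)
    refine ⟨A'', π' ≫ π, inferInstance, kernel.lift T.r (π' ≫ x - b ≫ T.η) ?_, ?_⟩
    · simp [T.η_r, hb]
    · simp [proj, T.zero, hx]
  exact := by
    rw [ShortComplex.exact_iff_exact_up_to_refinements]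
    intro A x hx
    have := T.shortExact.mono_f
    have := hS.mono_f
    let b : A ⟶ S.X₂ := T.shortExact.exact.lift (x ≫ kernel.ι T.r) (by simpa [proj] using hx)
    have hb : b ≫ T.η = x ≫ kernel.ι T.r := T.shortExact.exact.lift_f _ _
    have hb' : b ≫ S.g = 0 := by rw [← T.η_r, reassoc_of% hb, kernel.condition, comp_zero]
    refine ⟨A, 𝟙 A, inferInstance, hS.exact.lift b hb', ?_⟩
    rw [← cancel_mono (kernel.ι T.r), Category.id_comp, ← hb, Category.assoc]
    show _ = _ ≫ T.incl ≫ kernel.ι T.r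
    rw [incl_ι, hS.exact.lift_f_assoc]

/-- A map between two such extensions, over a map `φ` of the short complexes. -/
structure IsMap (T : RelExt S C) (T' : RelExt S' C) (φ : S ⟶ S') (g : T.E ⟶ T'.E) : Prop where
  η : T.η ≫ g = φ.τ₂ ≫ T'.η
  σ : g ≫ T'.σ = T.σ
  r : g ≫ T'.r = T.r ≫ φ.τ₃

/-- The extension `0 → B → B ⊔_K F → C → 0` obtained from an extension `0 → K → F → C → 0`, with the
trivialization that is zero on `F`. -/
def ofExtension (S : ShortComplex 𝒞) {F : 𝒞} {a : S.X₁ ⟶ F} {p : F ⟶ C} {z : a ≫ p = 0}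
    (hF : (ShortComplex.mk a p z).ShortExact) : RelExt S C where
  E := pushout a S.f
  η := pushout.inr a S.f
  σ := pushout.desc p 0 (by simp [z])
  zero := pushout.inr_desc _ _ _
  shortExact :=
    { mono_f := by
        have : Mono a := hF.mono_f
        exact inferInstanceAs (Mono (pushout.inr a S.f))
      epi_g := by
        have : Epi p := hF.epi_g
        have h : Epi (pushout.inl a S.f ≫ pushout.desc p 0 (by simp [z])) := by
          rw [pushout.inl_desc]
          exact this
        exact epi_of_epi (pushout.inl a S.f) _
      exact := by
        have hp : Epi p := hF.epi_g
        have h : Epi (pushout.inl a S.f ≫ pushout.desc p 0 (by simp [z])) := by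
          rw [pushout.inl_desc]
          exact hp
        have h' : Epi (pushout.desc p 0 (by simp [z] : a ≫ p = S.f ≫ (0 : S.X₂ ⟶ C))) :=
          epi_of_epi (pushout.inl a S.f) _
        refine ShortComplex.exact_of_g_is_cokernel _ (CokernelCofork.IsColimit.ofπ' (hp := h') _ _
          (fun {A} k hk => ?_))
        have h1 : a ≫ pushout.inl a S.f ≫ k = 0 := by
          rw [pushout.condition_assoc, hk, comp_zero]
        refine ⟨hF.exact.desc (pushout.inl a S.f ≫ k) h1, ?_⟩
        apply pushout.hom_ext
        · rw [pushout.inl_desc_assoc]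
          exact hF.exact.g_desc _ _
        · rw [pushout.inr_desc_assoc, hk, zero_comp] }
  r := pushout.desc 0 S.g (by simp)
  η_r := pushout.inr_desc _ _ _

/-- A map `u : F → E` from an extension `F` of `C` by `K` to `E` which is zero after `r` and
compatible with the other maps induces an isomorphism `B ⊔_K F ≅ E`. -/
lemma exists_iso_of_map (T : RelExt S C) {F : 𝒞} {a : S.X₁ ⟶ F} {p : F ⟶ C} {z : a ≫ p = 0}
    (hF : (ShortComplex.mk a p z).ShortExact) (u : F ⟶ T.E) (h1 : a ≫ u = S.f ≫ T.η)
    (h2 : u ≫ T.σ = p) (h3 : u ≫ T.r = 0) :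
    ∃ g : (ofExtension S hF).E ≅ T.E, IsMap (ofExtension S hF) T (𝟙 S) g.hom := by
  let g : pushout a S.f ⟶ T.E := pushout.desc u T.η h1
  have hη : pushout.inr a S.f ≫ g = T.η := pushout.inr_desc _ _ _
  have hσ : g ≫ T.σ = (ofExtension S hF).σ := by
    apply pushout.hom_ext
    · rw [pushout.inl_desc_assoc, h2]
      exact (pushout.inl_desc _ _ _).symm
    · rw [pushout.inr_desc_assoc, T.zero]
      exact (pushout.inr_desc _ _ _).symm
  let φ : ShortComplex.mk _ _ (ofExtension S hF).zero ⟶ ShortComplex.mk _ _ T.zero :=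
    { τ₁ := 𝟙 S.X₂, τ₂ := g, τ₃ := 𝟙 C
      comm₁₂ := (Category.id_comp _).trans hη.symm
      comm₂₃ := hσ.trans (Category.comp_id _).symm }
  have : IsIso g := ShortComplex.isIso₂_of_shortExact_of_isIso₁₃' φ
    (ofExtension S hF).shortExact T.shortExact
    (inferInstanceAs (IsIso (𝟙 S.X₂))) (inferInstanceAs (IsIso (𝟙 C)))
  refine ⟨@asIso _ _ _ _ g this, ?_, hσ, ?_⟩
  · exact hη.trans (Category.id_comp _).symm
  · apply pushout.hom_ext
    · refine (pushout.inl_desc_assoc _ _ _ _).trans (h3.trans ?_)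
      rw [ShortComplex.id_τ₃, Category.comp_id]
      exact (pushout.inl_desc _ _ _).symm
    · refine (pushout.inr_desc_assoc _ _ _ _).trans (T.η_r.trans ?_)
      rw [ShortComplex.id_τ₃, Category.comp_id]
      exact (pushout.inr_desc _ _ _).symm

/-- An extension with a trivialization is recovered from the kernel of the trivialization. -/
lemma exists_iso_ofExtension_ker (T : RelExt S C) (hS : S.ShortExact) :
    ∃ g : (ofExtension S (T.ker_shortExact hS)).E ≅ T.E,
      IsMap (ofExtension S (T.ker_shortExact hS)) T (𝟙 S) g.hom :=
  T.exists_iso_of_map _ (kernel.ι T.r) T.incl_ι rfl (kernel.condition _)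

variable [HasExt.{w} 𝒞]

/-- The class in `Ext¹(C, K)` of the kernel of the trivialization. -/
def cls (T : RelExt S C) (hS : S.ShortExact) : Ext.{w} C S.X₁ 1 := (T.ker_shortExact hS).extClass

/-- Classes are natural: a map of extensions with trivialization restricts to the kernels of the
trivializations. -/
lemma cls_comp_of_map {T : RelExt S C} {T' : RelExt S' C} {φ : S ⟶ S'} {g : T.E ⟶ T'.E}
    (h : IsMap T T' φ g) (hS : S.ShortExact) (hS' : S'.ShortExact) :
    (T.cls hS).comp (Ext.mk₀ φ.τ₁) (add_zero 1) = T'.cls hS' := by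
  have hnat := ShortComplex.ShortExact.extClass_naturality (T.ker_shortExact hS)
    (T'.ker_shortExact hS')
    { τ₁ := φ.τ₁, τ₂ := kernel.map T.r T'.r g φ.τ₃ h.r.symm, τ₃ := 𝟙 C
      comm₁₂ := by
        rw [← cancel_mono (kernel.ι T'.r)]
        simp [incl_ι, reassoc_of% T.incl_ι, h.η, φ.comm₁₂_assoc]
      comm₂₃ := by simp [proj, h.σ] }
  rw [cls, cls, hnat, Ext.mk₀_id_comp]

/-- The class of the kernel of the trivialization is the class of a given extension `F` if and only
if there is a map `F → E` that is compatible with all the structure. -/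
lemma extClass_eq_cls_iff (T : RelExt S C) (hS : S.ShortExact) {F : 𝒞} {a : S.X₁ ⟶ F} {p : F ⟶ C}
    {z : a ≫ p = 0} (hF : (ShortComplex.mk a p z).ShortExact) :
    hF.extClass = T.cls hS ↔
      ∃ u : F ⟶ T.E, a ≫ u = S.f ≫ T.η ∧ u ≫ T.σ = p ∧ u ≫ T.r = 0 := by
  constructor
  · intro h
    obtain ⟨g, h1, h2⟩ := exists_map_of_extClass_eq hF (T.ker_shortExact hS) h
    refine ⟨g ≫ kernel.ι T.r, ?_, ?_, ?_⟩
    · rw [reassoc_of% h1, incl_ι]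
    · rw [Category.assoc]; exact h2
    · rw [Category.assoc, kernel.condition, comp_zero]
  · rintro ⟨u, h1, h2, h3⟩
    refine extClass_eq_of_map hF (T.ker_shortExact hS) (kernel.lift T.r u h3) ?_ ?_
    · rw [← cancel_mono (kernel.ι T.r), incl_ι, Category.assoc, kernel.lift_ι, h1]
    · rw [proj, kernel.lift_ι_assoc, h2]

lemma exists_iso_of_cls_eq {T T' : RelExt S C} (hS : S.ShortExact) (h : T.cls hS = T'.cls hS) :
    ∃ g : T.E ≅ T'.E, IsMap T T' (𝟙 S) g.hom := by
  obtain ⟨u, h1, h2, h3⟩ := (T'.extClass_eq_cls_iff hS (T.ker_shortExact hS)).1 h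
  obtain ⟨g, hg⟩ := T.exists_iso_ofExtension_ker hS
  obtain ⟨g', hg'⟩ := T'.exists_iso_of_map _ u h1 h2 h3
  refine ⟨g.symm ≪≫ g', ?_, ?_, ?_⟩
  · have h4 := hg.η
    have h5 := hg'.η
    simp only [ShortComplex.id_τ₂, Category.id_comp] at h4 h5 ⊢
    simp [← h4, ← h5]
  · simp [hg'.σ, ← hg.σ]
  · have h4 := hg.r
    have h5 := hg'.r
    simp only [ShortComplex.id_τ₃, Category.comp_id] at h4 h5 ⊢
    simp [h5, ← h4]

lemma exists_cls_eq (hS : S.ShortExact) (x : Ext.{w} C S.X₁ 1) :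
    ∃ T : RelExt S C, T.cls hS = x := by
  obtain ⟨F, a, p, z, hF, rfl⟩ := exists_extClass_eq x
  refine ⟨ofExtension S hF, ?_⟩
  symm
  rw [extClass_eq_cls_iff]
  exact ⟨pushout.inl a S.f, pushout.condition, pushout.inl_desc _ _ _, pushout.inl_desc _ _ _⟩

end RelExt

end AbelianExtensions

/-! ### Sections of modules over a ringed space -/

variable {X Y Z : CSpace}

lemma mem_univ_inf {T ι : Type*} [TopologicalSpace T] [Fintype ι] {V : ι → Opens T} {p : T}
    (h : ∀ k, p ∈ V k) : p ∈ Finset.univ.inf V :=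
  Finset.inf_induction (p := fun U : Opens T => p ∈ U) trivial (fun _ h₁ _ h₂ => ⟨h₁, h₂⟩)
    fun k _ => h k

/-- Sections that agree locally are equal. -/
lemma sec_ext (M : OMod X) {U : Opens X.carrier} {x y : Sec M U}
    (h : ∀ p ∈ U, ∃ (V : Opens X.carrier) (hV : V ≤ U), p ∈ V ∧ rest M hV x = rest M hV y) :
    x = y := by
  choose! V hV hpV hxy using h
  let F : TopCat.Sheaf AddCommGrpCat.{0} X.carrier := ⟨M.val.presheaf, M.isSheaf⟩
  refine F.eq_of_locally_eq' (fun p : U => V p.1) U (fun p => homOfLE (hV p.1 p.2))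
    (fun p hp => ?_) x y (fun p => hxy p.1 p.2)
  exact (Opens.mem_iSup).2 ⟨⟨p, hp⟩, hpV p hp⟩

lemma exists_glue (M : OMod X) {U : Opens X.carrier} (V : U → Opens X.carrier)
    (hV : ∀ p, V p ≤ U) (hpV : ∀ p : U, p.1 ∈ V p) (s : ∀ p, Sec M (V p))
    (hs : ∀ p q, rest M (inf_le_left : V p ⊓ V q ≤ V p) (s p) =
      rest M (inf_le_right : V p ⊓ V q ≤ V q) (s q)) :
    ∃ x : Sec M U, ∀ p, rest M (hV p) x = s p := by
  let F : TopCat.Sheaf AddCommGrpCat.{0} X.carrier := ⟨M.val.presheaf, M.isSheaf⟩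
  obtain ⟨x, hx, -⟩ := F.existsUnique_gluing' V U (fun p => homOfLE (hV p))
    (fun p hp => (Opens.mem_iSup).2 ⟨⟨p, hp⟩, hpV ⟨p, hp⟩⟩) s (fun p q => hs p q)
  exact ⟨x, hx⟩

/-- A morphism of `O_X`-modules is locally surjective: sections lift locally. -/
def LocSurj {M N : OMod X} (f : M ⟶ N) : Prop :=
  ∀ (U : Opens X.carrier) (y : Sec N U), ∀ p ∈ U,
    ∃ (V : Opens X.carrier) (hV : V ≤ U), p ∈ V ∧ ∃ x : Sec M V, onSec f V x = rest N hV y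

lemma exists_of_locally_exists {M N : OMod X} (f : M ⟶ N) {U : Opens X.carrier}
    (hinj : ∀ V ≤ U, Function.Injective (onSec f V)) (y : Sec N U)
    (h : ∀ p ∈ U, ∃ (V : Opens X.carrier) (hV : V ≤ U), p ∈ V ∧
      ∃ x : Sec M V, onSec f V x = rest N hV y) : ∃ x : Sec M U, onSec f U x = y := by
  choose! V hV hpV s hs using h
  obtain ⟨x, hx⟩ := exists_glue M (fun p : U => V p.1) (fun p => hV p.1 p.2)
    (fun p => hpV p.1 p.2) (fun p => s p.1) (fun p q => by
      apply hinj _ (inf_le_left.trans (hV p.1 p.2))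
      rw [onSec_rest, onSec_rest, hs p.1 p.2, hs q.1 q.2, rest_rest, rest_rest])
  refine ⟨x, sec_ext N fun p hp => ⟨V p, hV p hp, hpV p hp, ?_⟩⟩
  rw [← onSec_rest, hx ⟨p, hp⟩, hs p hp]

lemma isIso_of_bijective {M N : OMod X} (f : M ⟶ N)
    (h : ∀ U, Function.Bijective (onSec f U)) : IsIso f := by
  let e : ∀ U, Sec M U ≃ₗ[Fun X U] Sec N U := fun U => LinearEquiv.ofBijective (onSec f U) (h U)
  let g : N ⟶ M := mkHom (fun U => (e U).symm.toLinearMap) (fun {U V} hV x => by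
    apply (h V).1
    rw [onSec_rest]
    exact ((e V).apply_symm_apply _).trans (congrArg _ ((e U).apply_symm_apply _).symm))
  refine ⟨g, hom_ext' fun U x => ?_, hom_ext' fun U x => ?_⟩
  · exact (e U).symm_apply_apply x
  · exact (e U).apply_symm_apply x

/-- A morphism that is bijective on the sections over all small open subsets is an isomorphism. -/
lemma isIso_of_locally_bijective {M N : OMod X} (f : M ⟶ N)
    (h : ∀ p : X.carrier, ∃ U : Opens X.carrier, p ∈ U ∧
      ∀ V ≤ U, Function.Bijective (onSec f V)) : IsIso f := by
  choose U hU hf using h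
  have hinj : ∀ V, Function.Injective (onSec f V) := by
    intro V x y hxy
    refine sec_ext M fun p hp => ⟨V ⊓ U p, inf_le_left, ⟨hp, hU p⟩, ?_⟩
    apply (hf p _ inf_le_right).1
    rw [onSec_rest, onSec_rest, hxy]
  refine isIso_of_bijective f fun V => ⟨hinj V, fun y => ?_⟩
  refine exists_of_locally_exists f (fun V' _ => hinj V') y fun p hp =>
    ⟨V ⊓ U p, inf_le_left, ⟨hp, hU p⟩, ?_⟩
  exact (hf p _ inf_le_right).2 _

lemma onSec_zero {M N : OMod X} (U : Opens X.carrier) (x : Sec M U) :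
    onSec (0 : M ⟶ N) U x = 0 := rfl

lemma onSec_id {M : OMod X} (U : Opens X.carrier) (x : Sec M U) : onSec (𝟙 M) U x = x := rfl

lemma onSec_sum {M N : OMod X} {ι : Type*} (s : Finset ι) (f : ι → (M ⟶ N)) (U : Opens X.carrier)
    (x : Sec M U) : onSec (∑ k ∈ s, f k) U x = ∑ k ∈ s, onSec (f k) U x := by
  classical
  induction s using Finset.induction_on with
  | empty => rfl
  | insert a s ha ih => rw [Finset.sum_insert ha, Finset.sum_insert ha, onSec_add, ih]

lemma onSec_injective_of_mono {M N : OMod X} (f : M ⟶ N) [Mono f] (U : Opens X.carrier) :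
    Function.Injective (onSec f U) := by
  have h : Mono ((SheafOfModules.evaluation (ringSheaf X) (op U)).map f) := inferInstance
  rw [ModuleCat.mono_iff_injective] at h
  exact h

lemma exists_onSec_of_exact {S : ShortComplex (OMod X)} (hS : S.Exact) [Mono S.f]
    {U : Opens X.carrier} (x : Sec S.X₂ U) (hx : onSec S.g U x = 0) :
    ∃ y : Sec S.X₁ U, onSec S.f U y = x := by
  let F := SheafOfModules.evaluation (ringSheaf X) (op U)
  have : F.PreservesZeroMorphisms := ⟨fun _ _ => rfl⟩
  have : Mono (F.map S.f) := inferInstance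
  have h := hS.map_of_mono_of_preservesKernel F inferInstance inferInstance
  rw [ShortComplex.moduleCat_exact_iff] at h
  exact h x hx

lemma epi_of_locSurj {M N : OMod X} (f : M ⟶ N) (hf : LocSurj f) : Epi f := by
  refine ⟨fun {K} g h hgh => hom_ext' fun U y => ?_⟩
  refine sec_ext K fun p hp => ?_
  obtain ⟨V, hV, hpV, x, hx⟩ := hf U y p hp
  refine ⟨V, hV, hpV, ?_⟩
  rw [← onSec_rest, ← onSec_rest, ← hx, ← onSec_comp, ← onSec_comp, hgh]

/-- A sequence of `O_X`-modules is short exact if it is left exact on the sections over every open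
subset and its second map is locally surjective. -/
lemma shortExact_of_sections {M N K : OMod X} (f : M ⟶ N) (g : N ⟶ K)
    (hf : ∀ U, Function.Injective (onSec f U)) (w : f ≫ g = 0)
    (hfg : ∀ U (x : Sec N U), onSec g U x = 0 → ∃ y, onSec f U y = x) (hg : LocSurj g) :
    (ShortComplex.mk f g w).ShortExact := by
  have hmono : Mono f := ⟨fun a b hab => hom_ext' fun U x => hf U (by
    rw [← onSec_comp, ← onSec_comp, hab])⟩
  have hepi : Epi g := epi_of_locSurj g hg
  have hexact : (ShortComplex.mk f g w).Exact := by
    refine ShortComplex.exact_of_f_is_kernel _ (KernelFork.IsLimit.ofι' (i := f) (w := w)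
      fun {T} k hk => ?_)
    have hk' : ∀ U (x : Sec T U), ∃ y, onSec f U y = onSec k U x := fun U x =>
      hfg U _ (by rw [← onSec_comp, hk, onSec_zero])
    choose l hl using hk'
    refine ⟨mkHom (fun U => { toFun := l U, map_add' := fun x y => hf U ?_,
                              map_smul' := fun r x => hf U ?_ }) fun {U V} h x => hf V ?_,
      hom_ext' hl⟩
    · rw [hl, map_add, map_add, hl, hl]
    · rw [hl, map_smul, RingHom.id_apply, map_smul, hl]
    · rw [onSec_rest]
      exact (hl _ _).trans ((onSec_rest _ _ _).trans (congrArg _ (hl _ _).symm))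
  exact { exact := hexact, mono_f := hmono, epi_g := hepi }

/-! ### The exact sequence of a vector bundle and its restriction to a closed subspace -/

/-- This applies to morphisms that are kernel maps only after unfolding a definition. -/
lemma mono_kernel_ι {C : Type*} [Category* C] [HasZeroMorphisms C] {A B : C} (g : A ⟶ B)
    [HasKernel g] : Mono (kernel.ι g) := inferInstance

section Sheafification

/-- The map on sections of the canonical morphism from a presheaf of modules to its sheaf. -/
def sheafifySec (P : PreMod X) (U : Opens X.carrier) :
    P.obj (op U) →+ Sec ((PresheafOfModules.sheafification (𝟙 (ringSheaf X).obj)).obj P) U where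
  toFun x :=
    ((PresheafOfModules.sheafificationAdjunction (𝟙 (ringSheaf X).obj)).unit.app P).app (op U) x
  map_zero' := map_zero
    (((PresheafOfModules.sheafificationAdjunction (𝟙 (ringSheaf X).obj)).unit.app P).app (op U)).hom
  map_add' := map_add
    (((PresheafOfModules.sheafificationAdjunction (𝟙 (ringSheaf X).obj)).unit.app P).app (op U)).hom

lemma sheafifySec_locally_injective (P : PreMod X) {U : Opens X.carrier} (x : P.obj (op U))
    (hx : sheafifySec P U x = 0) :
    ∀ p ∈ U, ∃ (V : Opens X.carrier) (hV : V ≤ U), p ∈ V ∧ P.map (homOfLE hV).op x = 0 := by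
  intro p hp
  have h := Presheaf.equalizerSieve_mem (Opens.grothendieckTopology X.carrier)
    (toSheafify (Opens.grothendieckTopology X.carrier) P.presheaf) x 0
    (hx.trans (map_zero (sheafifySec P U)).symm)
  obtain ⟨V, f, hf, hpV⟩ := h p hp
  refine ⟨V, f.le, hpV, ?_⟩
  exact hf.trans (map_zero (P.presheaf.map f.op).hom)

lemma sheafifySec_locally_surjective (P : PreMod X) {U : Opens X.carrier}
    (y : Sec ((PresheafOfModules.sheafification (𝟙 (ringSheaf X).obj)).obj P) U) :
    ∀ p ∈ U, ∃ (V : Opens X.carrier) (hV : V ≤ U), p ∈ V ∧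
      ∃ x, sheafifySec P V x = rest _ hV y := by
  intro p hp
  have h := Presheaf.imageSieve_mem (Opens.grothendieckTopology X.carrier)
    (toSheafify (Opens.grothendieckTopology X.carrier) P.presheaf) y
  obtain ⟨V, f, ⟨x, hx⟩, hpV⟩ := h p hp
  exact ⟨V, f.le, hpV, x, hx⟩

lemma onSec_sheafification_homEquiv_symm (P : PreMod X) (M : OMod X) (g : P ⟶ M.val)
    (U : Opens X.carrier) (x : P.obj (op U)) :
    onSec (((PresheafOfModules.sheafificationAdjunction
      (𝟙 (ringSheaf X).obj)).homEquiv P M).symm g) U (sheafifySec P U x) = g.app (op U) x := by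
  have h := ((PresheafOfModules.sheafificationAdjunction
      (𝟙 (ringSheaf X).obj)).homEquiv P M).apply_symm_apply g
  exact congrArg (fun f : P ⟶ M.val => f.app (op U) x) h

/-- Epimorphisms of `O_X`-modules are locally surjective: a section of the target is zero in the
sheafification of the presheaf cokernel, hence locally zero in the presheaf cokernel. -/
lemma locSurj_of_epi {M N : OMod X} (f : M ⟶ N) [Epi f] : LocSurj f := by
  intro U y p hp
  let c : N.val ⟶ cokernel f.val := cokernel.π f.val
  let adj := PresheafOfModules.sheafificationAdjunction (𝟙 (ringSheaf X).obj)
  let γ : N ⟶ (PresheafOfModules.sheafification (𝟙 (ringSheaf X).obj)).obj (cokernel f.val) :=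
    ⟨c ≫ adj.unit.app (cokernel f.val)⟩
  have hγ : γ = 0 := by
    rw [← cancel_epi f, comp_zero]
    apply SheafOfModules.hom_ext
    show f.val ≫ c ≫ adj.unit.app (cokernel f.val) = 0
    rw [cokernel.condition_assoc, zero_comp]
  have hy : sheafifySec (cokernel f.val) U (c.app (op U) y) = 0 :=
    congrArg (fun g => onSec g U y) hγ
  obtain ⟨V, hV, hpV, h0⟩ := sheafifySec_locally_injective _ _ hy p hp
  refine ⟨V, hV, hpV, ?_⟩
  have h1 : c.app (op V) (rest N hV y) = 0 :=
    (PresheafOfModules.naturality_apply c (homOfLE hV).op y).trans h0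
  let S : ShortComplex (PresheafOfModules (ringSheaf X).obj) :=
    ShortComplex.mk f.val c (cokernel.condition f.val)
  have hS : S.Exact := ShortComplex.exact_of_g_is_cokernel _ (cokernelIsCokernel f.val)
  let F := PresheafOfModules.evaluation (ringSheaf X).obj (op V)
  have h2 := hS.map F
  rw [ShortComplex.moduleCat_exact_iff] at h2
  exact h2 (rest N hV y) h1

end Sheafification

section Tensor

/-- Sections of the presheaf tensor product, read as elements of a tensor product of modules. -/
def preTensorSec (M N : OMod X) (U : Opens X.carrier) :
    Sec M U ⊗[Fun X U] Sec N U →+ (preTensor M N).obj (op U) where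
  toFun x := x
  map_zero' := rfl
  map_add' _ _ := rfl

lemma preTensorSec_surjective (M N : OMod X) (U : Opens X.carrier) :
    Function.Surjective (preTensorSec M N U) := fun x => ⟨x, rfl⟩

/-- The canonical map from the tensor product of sections to the sections of the tensor product. -/
def tensorSec (M N : OMod X) (U : Opens X.carrier) :
    Sec M U ⊗[Fun X U] Sec N U →+ Sec (tensor M N) U :=
  (sheafifySec (preTensor M N) U).comp (preTensorSec M N U)

lemma tensorSec_locally_surjective (M N : OMod X) {U : Opens X.carrier}
    (y : Sec (tensor M N) U) : ∀ p ∈ U, ∃ (V : Opens X.carrier) (hV : V ≤ U), p ∈ V ∧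
      ∃ x, tensorSec M N V x = rest _ hV y := by
  intro p hp
  obtain ⟨V, hV, hpV, t, ht⟩ := sheafifySec_locally_surjective (preTensor M N) y p hp
  obtain ⟨t, rfl⟩ := preTensorSec_surjective M N V t
  exact ⟨V, hV, hpV, t, ht⟩

lemma onSec_tensorIdealHom (i : Y ⟶ X) (M : OMod X) (U : Opens X.carrier) (m : Sec M U)
    (r : Sec (idealSheaf i) U) :
    onSec (tensorIdealHom i M) U (tensorSec M (idealSheaf i) U (m ⊗ₜ r)) =
      structSec (onSec (idealSheafIncl i) U r) • m :=
  onSec_sheafification_homEquiv_symm _ _ _ _ _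

lemma onSec_idealSheafIncl_injective (i : Y ⟶ X) (U : Opens X.carrier) :
    Function.Injective (onSec (idealSheafIncl i) U) := by
  have : Mono (idealSheafIncl i) :=
    mono_kernel_ι (SheafOfModules.unitToPushforwardObjUnit (ringHom i))
  exact onSec_injective_of_mono _ U

lemma funPull_idealSheafIncl (i : Y ⟶ X) (U : Opens X.carrier) (r : Sec (idealSheaf i) U) :
    funPull i (le_refl ((Opens.map i.hom.base).obj U)) (structSec (onSec (idealSheafIncl i) U r)) =
      0 := by
  have h := kernel.condition (SheafOfModules.unitToPushforwardObjUnit (ringHom i))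
  have h1 : (i.hom.c.app (op U)).hom (structSec (onSec (idealSheafIncl i) U r)) = 0 :=
    congrArg (fun g => onSec g U r) h
  rw [funPull_eq, h1, map_zero]

/-- The functions that vanish on `Y` are the sections of the ideal sheaf. -/
lemma exists_idealSheafIncl (i : Y ⟶ X) (U : Opens X.carrier) (r : Fun X U)
    (hr : funPull i (le_refl ((Opens.map i.hom.base).obj U)) r = 0) :
    ∃ z : Sec (idealSheaf i) U, structSec (onSec (idealSheafIncl i) U z) = r := by
  let g := SheafOfModules.unitToPushforwardObjUnit (ringHom i)
  let S : ShortComplex (OMod X) := ShortComplex.mk (kernel.ι g) g (kernel.condition g)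
  have hS : S.Exact := ShortComplex.exact_of_f_is_kernel _ (kernelIsKernel g)
  have : Mono S.f := mono_kernel_ι g
  obtain ⟨z, hz⟩ := exists_onSec_of_exact hS (U := U) (show Sec (structMod X) U from r) (by
    have h1 : (i.hom.c.app (op U)).hom r = 0 := by rwa [funPull_eq, funRest_self] at hr
    exact h1)
  exact ⟨z, hz⟩

section LocallyFree

variable {i : Y ⟶ X} {M : OMod X}

/-- Elements of `M ⊗ N` have the form `∑ k, e k ⊗ r k` if the `e k` are a basis of `M`. -/
lemma IsBasisOn.exists_tensor_eq_sum {U V : Opens X.carrier} (h : V ≤ U) {n : ℕ}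
    {e : Fin n → Sec M U} (he : IsBasisOn e) (N : OMod X) (t : Sec M V ⊗[Fun X V] Sec N V) :
    ∃ r : Fin n → Sec N V, t = ∑ k, rest M h (e k) ⊗ₜ r k := by
  induction t using TensorProduct.induction_on with
  | zero => exact ⟨0, by simp⟩
  | add x y hx hy =>
    obtain ⟨r, hr⟩ := hx
    obtain ⟨s, hs⟩ := hy
    refine ⟨r + s, ?_⟩
    simp only [hr, hs, Pi.add_apply, TensorProduct.tmul_add, Finset.sum_add_distrib]
  | tmul m x =>
    refine ⟨fun k => he.coord h m k • x, ?_⟩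
    conv_lhs => rw [← he.sum_coord h m]
    rw [TensorProduct.sum_tmul]
    simp_rw [TensorProduct.smul_tmul]

lemma IsBasisOn.eq_zero {U V : Opens X.carrier} (h : V ≤ U) {n : ℕ} {e : Fin n → Sec M U}
    (he : IsBasisOn e) {c : Fin n → Fun X V} (hc : ∑ k, c k • rest M h (e k) = 0) (k : Fin n) :
    c k = 0 := by
  have := (he V h).1 (a₁ := c) (a₂ := 0) (by simpa using hc)
  rw [this]; rfl

/-- For a vector bundle `M`, the map `M ⊗ J → M` is injective on sections. -/
lemma onSec_tensorIdealHom_injective (hM : IsVectorBundle M) (V : Opens X.carrier) :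
    Function.Injective (onSec (tensorIdealHom i M) V) := by
  rw [injective_iff_map_eq_zero]
  intro z hz
  refine sec_ext _ fun p hp => ?_
  obtain ⟨U, hpU, n, e, he⟩ := hM p
  obtain ⟨V', hV', hpV', t, ht⟩ := tensorSec_locally_surjective M (idealSheaf i)
    (rest _ (inf_le_left : V ⊓ U ≤ V) z) p ⟨hp, hpU⟩
  refine ⟨V', hV'.trans inf_le_left, hpV', ?_⟩
  have hVU : V' ≤ U := hV'.trans inf_le_right
  obtain ⟨r, rfl⟩ := he.exists_tensor_eq_sum hVU _ t
  have h0 : onSec (tensorIdealHom i M) V'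
      (rest (tensor M (idealSheaf i)) (hV'.trans inf_le_left) z) = 0 := by
    rw [onSec_rest, hz, map_zero]
  have hr : ∀ k, r k = 0 := by
    intro k
    apply onSec_idealSheafIncl_injective i V'
    rw [map_zero]
    refine he.eq_zero hVU (c := fun k => structSec (onSec (idealSheafIncl i) V' (r k))) ?_ k
    rw [← h0, ← rest_rest (tensor M (idealSheaf i)) (inf_le_left : V ⊓ U ≤ V) hV']
    refine Eq.trans ?_ (congrArg (onSec (tensorIdealHom i M) V') ht)
    rw [map_sum, map_sum]
    exact Finset.sum_congr rfl fun k _ => (onSec_tensorIdealHom i M V' _ _).symm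
  rw [map_zero, ← rest_rest (tensor M (idealSheaf i)) (inf_le_left : V ⊓ U ≤ V) hV']
  rw [← ht]
  simp [hr]

lemma onSec_toHom {f : X ⟶ Y} {M : OMod Y} {N : OMod X} (a : SemiHom f M N) (U : Opens Y.carrier)
    (x : Sec M U) : onSec a.toHom U x = a.toFun U ((Opens.map f.hom.base).obj U) le_rfl x := rfl

/-- For a vector bundle `M` on `X` with restriction `N` to the closed subspace `Y`, the sequence
`0 → M ⊗ J → M → i_* N → 0` is exact. -/
lemma tensorIdeal_shortExact (hi : IsClosedSubspace i) (hM : IsVectorBundle M) {N : OMod Y}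
    {a : SemiHom i M N} (ha : a.IsPull) :
    ∃ w : tensorIdealHom i M ≫ a.toHom = 0,
      (ShortComplex.mk (tensorIdealHom i M) a.toHom w).ShortExact := by
  have w : tensorIdealHom i M ≫ a.toHom = 0 := by
    refine hom_ext' fun U z => sec_ext _ fun p hp => ?_
    obtain ⟨V, hV, hpV, t, ht⟩ := tensorSec_locally_surjective M (idealSheaf i) z p hp
    refine ⟨V, hV, hpV, ?_⟩
    rw [onSec_zero, map_zero, ← onSec_rest, ← ht, onSec_comp]
    clear ht
    induction t using TensorProduct.induction_on with
    | zero => simp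
    | add x y hx hy => rw [map_add, map_add, map_add, hx, hy, add_zero]
    | tmul m r =>
      rw [onSec_tensorIdealHom, onSec_toHom, a.map_smul', funPull_idealSheafIncl, zero_smul]
      rfl
  refine ⟨w, shortExact_of_sections _ _ (onSec_tensorIdealHom_injective hM) w ?_ ?_⟩
  -- a section with restriction zero has coordinates in the ideal sheaf
  · intro V x hx
    refine exists_of_locally_exists _ (fun V' _ => onSec_tensorIdealHom_injective hM V') x
      fun p hp => ?_
    obtain ⟨U, hpU, n, e, he⟩ := hM p
    refine ⟨V ⊓ U, inf_le_left, ⟨hp, hpU⟩, ?_⟩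
    have hb := ha.isBasisOn he (le_refl ((Opens.map i.hom.base).obj U))
    let c := he.coord (inf_le_right : V ⊓ U ≤ U) (rest M inf_le_left x)
    have hc : ∀ k, funPull i (le_refl ((Opens.map i.hom.base).obj (V ⊓ U))) (c k) = 0 := by
      refine hb.eq_zero (V := (Opens.map i.hom.base).obj (V ⊓ U)) (fun y hy => hy.2)
        (c := fun k => funPull i le_rfl (c k)) ?_
      have h1 : a.toFun (V ⊓ U) ((Opens.map i.hom.base).obj (V ⊓ U)) le_rfl
          (rest M inf_le_left x) = 0 := by
        rw [a.map_rest' V ((Opens.map i.hom.base).obj V) le_rfl (V ⊓ U)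
          ((Opens.map i.hom.base).obj (V ⊓ U)) inf_le_left (fun y hy => hy.1)]
        have h2 : a.toFun V ((Opens.map i.hom.base).obj V) le_rfl x = 0 := hx
        rw [h2, map_zero]
      rw [← he.sum_coord (inf_le_right : V ⊓ U ≤ U) (rest M inf_le_left x), map_sum] at h1
      rw [← h1]
      refine Finset.sum_congr rfl fun k _ => ?_
      rw [a.map_smul', a.map_rest' U ((Opens.map i.hom.base).obj U) le_rfl (V ⊓ U)
        ((Opens.map i.hom.base).obj (V ⊓ U)) inf_le_right (fun y hy => hy.2)]
    choose z hz using fun k => exists_idealSheafIncl i (V ⊓ U) (c k) (hc k)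
    refine ⟨∑ k, tensorSec M (idealSheaf i) (V ⊓ U) (rest M inf_le_right (e k) ⊗ₜ z k), ?_⟩
    rw [map_sum, ← he.sum_coord (inf_le_right : V ⊓ U ≤ U) (rest M inf_le_left x)]
    refine Finset.sum_congr rfl fun k _ => ?_
    rw [onSec_tensorIdealHom, hz]
  -- the coordinates of a section on `Y` extend locally to functions on `X`; off `Y` there is
  -- nothing to lift
  · intro V y p hp
    obtain ⟨U, hpU, n, e, he⟩ := hM p
    have hb := ha.isBasisOn he (le_refl ((Opens.map i.hom.base).obj U))
    let y' : Sec N ((Opens.map i.hom.base).obj V) := y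
    by_cases hpY : p ∈ Set.range i.hom.base
    · obtain ⟨q, rfl⟩ := hpY
      let T : Opens Y.carrier := (Opens.map i.hom.base).obj (V ⊓ U)
      have hTU : T ≤ (Opens.map i.hom.base).obj U := fun y hy => hy.2
      have hTV : T ≤ (Opens.map i.hom.base).obj V := fun y hy => hy.1
      let c := hb.coord hTU (rest N hTV y')
      have key : ∀ k, ∃ (O : Opens X.carrier) (r : Fun X O), i.hom.base q ∈ O ∧ O ≤ V ⊓ U ∧
          ∃ h : (Opens.map i.hom.base).obj O ≤ T, funPull i le_rfl r = funRest h (c k) := by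
        intro k
        obtain ⟨O, T', h, hT', r, hq, hr⟩ := hi.surjective T (c k) q ⟨hp, hpU⟩
        obtain ⟨O', hO', hO''⟩ := hi.isClosedEmbedding.isInducing.isOpen_iff.1 T'.isOpen
        refine ⟨O ⊓ ⟨O', hO'⟩ ⊓ (V ⊓ U), funRest (inf_le_left.trans inf_le_left) r,
          ⟨⟨h hq, ?_⟩, hp, hpU⟩, inf_le_right, fun y hy => hy.2, ?_⟩
        · show q ∈ i.hom.base ⁻¹' O'
          rw [hO'']; exact hq
        · have h3 : (Opens.map i.hom.base).obj (O ⊓ ⟨O', hO'⟩ ⊓ (V ⊓ U)) ≤ T' := by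
            intro y hy
            have : y ∈ i.hom.base ⁻¹' O' := hy.1.2
            rw [hO''] at this
            exact this
          rw [funPull_rest h (inf_le_left.trans inf_le_left) h3, hr, funRest_funRest]
      choose O r hqO hOVU hOT hr using key
      let O' : Opens X.carrier := V ⊓ U ⊓ Finset.univ.inf O
      have hO'O : ∀ k, O' ≤ O k := fun k => inf_le_right.trans (Finset.inf_le (Finset.mem_univ k))
      have hO'U : O' ≤ U := inf_le_left.trans inf_le_right
      have hO'V : O' ≤ V := inf_le_left.trans inf_le_left
      have hO'T : (Opens.map i.hom.base).obj O' ≤ T := fun y hy => hy.1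
      refine ⟨O', hO'V, ⟨⟨hp, hpU⟩, mem_univ_inf hqO⟩,
        ∑ k, funRest (hO'O k) (r k) • rest M hO'U (e k), ?_⟩
      · rw [onSec_toHom, map_sum]
        have h1 := congrArg (rest N hO'T) (hb.sum_coord hTU (rest N hTV y'))
        rw [rest_rest, map_sum] at h1
        refine Eq.trans ?_ h1
        refine Finset.sum_congr rfl fun k _ => ?_
        rw [a.map_smul', rest_smul, rest_rest, ← funRest_funRest (hOT k) (fun y hy => hO'O k hy),
          ← hr, ← funPull_rest le_rfl (hO'O k) (fun y hy => hO'O k hy) le_rfl,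
          a.map_rest' U ((Opens.map i.hom.base).obj U) le_rfl _ _ hO'U (fun y hy => hO'U hy)]
    · let O : Opens X.carrier := V ⊓ ⟨(Set.range i.hom.base)ᶜ,
        hi.isClosedEmbedding.isClosed_range.isOpen_compl⟩
      refine ⟨O, inf_le_left, ⟨hp, hpY⟩, 0, ?_⟩
      have hO : ∀ y : Y.carrier, y ∉ (Opens.map i.hom.base).obj O := fun y hy => hy.2 ⟨y, rfl⟩
      exact sec_ext N (U := (Opens.map i.hom.base).obj O) fun y hy => (hO y hy).elim

end LocallyFree

end Tensor

/-! ### Algebras with square-zero maximal ideal and modules on `Spec A × X` -/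

section Algebra

variable (A : Type) [CommRing A] [Algebra ℂ A] [Module.Finite ℂ A] [IsLocalRing A]

/-- A basis of the maximal ideal of a local `ℂ`-algebra `A`, whose square is zero: elements `eps k`
with `eps k * eps l = 0` such that every `a` is `aug a + ∑ k, coeff k a • eps k`. -/
structure SqZeroBasis (ι : Type) [Fintype ι] [DecidableEq ι] where
  eps : ι → A
  coeff : ι → A →ₗ[ℂ] ℂ
  eps_mul_eps (k l : ι) : eps k * eps l = 0
  coeff_eps (k l : ι) : coeff k (eps l) = if k = l then 1 else 0
  decomp (a : A) : a = algebraMap ℂ A (aug A a) + ∑ k, coeff k a • eps k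

namespace SqZeroBasis

variable {A} {ι : Type} [Fintype ι] [DecidableEq ι] (b : SqZeroBasis A ι)

include b in
lemma aug_eps (k : ι) : aug A (b.eps k) = 0 := by
  have := congrArg (aug A) (b.eps_mul_eps k k)
  rw [map_mul, map_zero] at this
  exact mul_self_eq_zero.1 this

lemma sum_coeff_eps (c : ι → ℂ) (k : ι) : b.coeff k (∑ l, c l • b.eps l) = c k := by
  simp [b.coeff_eps]

lemma coeff_algebraMap (k : ι) (z : ℂ) : b.coeff k (algebraMap ℂ A z) = 0 := by
  have h := b.decomp (algebraMap ℂ A z)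
  rw [AlgHom.commutes] at h
  have h1 : ∑ l, b.coeff l (algebraMap ℂ A z) • b.eps l = 0 := by
    simpa using h.symm
  rw [← b.sum_coeff_eps (fun l => b.coeff l (algebraMap ℂ A z)), h1, map_zero]

lemma mul_eps (a : A) (k : ι) : a * b.eps k = aug A a • b.eps k := by
  conv_lhs => rw [b.decomp a]
  rw [add_mul, Finset.sum_mul]
  simp [b.eps_mul_eps, Algebra.smul_def, mul_assoc]

lemma coeff_mul (k : ι) (a a' : A) :
    b.coeff k (a * a') = aug A a * b.coeff k a' + aug A a' * b.coeff k a := by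
  conv_lhs => rw [b.decomp a']
  rw [mul_add, Finset.mul_sum]
  simp_rw [mul_smul_comm, b.mul_eps]
  rw [mul_comm a, ← Algebra.smul_def]
  simp [b.coeff_eps]
  ring

variable (R : Type) [CommRing R] [Algebra ℂ R]

/-- The coefficient of `eps k` of an element of `A ⊗ R`. -/
def tcoeff (k : ι) : A ⊗[ℂ] R →ₗ[ℂ] R :=
  (TensorProduct.lid ℂ R).toLinearMap ∘ₗ TensorProduct.map (b.coeff k) LinearMap.id

variable {R}

lemma tcoeff_tmul (k : ι) (a : A) (r : R) : b.tcoeff R k (a ⊗ₜ r) = b.coeff k a • r := by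
  simp [tcoeff]

lemma tdecomp (t : A ⊗[ℂ] R) :
    t = 1 ⊗ₜ tensorEval (aug A) R t + ∑ k, b.eps k ⊗ₜ b.tcoeff R k t := by
  induction t using TensorProduct.induction_on with
  | zero => simp
  | add x y hx hy =>
    simp only [map_add, TensorProduct.tmul_add, Finset.sum_add_distrib]
    conv_lhs => rw [hx, hy]
    abel
  | tmul a r =>
    simp_rw [tensorEval_tmul, tcoeff_tmul, ← TensorProduct.smul_tmul]
    rw [← TensorProduct.sum_tmul, ← TensorProduct.add_tmul, ← Algebra.algebraMap_eq_smul_one,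
      ← b.decomp]

lemma eps_tmul_mul (k : ι) (t : A ⊗[ℂ] R) :
    (b.eps k ⊗ₜ[ℂ] (1 : R)) * t = b.eps k ⊗ₜ tensorEval (aug A) R t := by
  induction t using TensorProduct.induction_on with
  | zero => simp
  | add x y hx hy => rw [mul_add, hx, hy, map_add, TensorProduct.tmul_add]
  | tmul a r =>
    rw [Algebra.TensorProduct.tmul_mul_tmul, one_mul, mul_comm, b.mul_eps, tensorEval_tmul,
      TensorProduct.smul_tmul]

lemma tcoeff_sum_eps (r : ι → R) (k : ι) : b.tcoeff R k (∑ l, b.eps l ⊗ₜ r l) = r k := by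
  simp [tcoeff_tmul, b.coeff_eps]

lemma tcoeff_map {S : Type} [CommRing S] [Algebra ℂ S] (k : ι) (g : R →ₐ[ℂ] S) (t : A ⊗[ℂ] R) :
    b.tcoeff S k (Algebra.TensorProduct.map (AlgHom.id ℂ A) g t) = g (b.tcoeff R k t) := by
  induction t using TensorProduct.induction_on with
  | zero => simp
  | add x y hx hy => rw [map_add, map_add, hx, hy, map_add, map_add]
  | tmul a r => simp [tcoeff_tmul]

/-- The coefficients are derivations over the augmentation. -/
lemma tcoeff_mul (k : ι) (t t' : A ⊗[ℂ] R) :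
    b.tcoeff R k (t * t') = tensorEval (aug A) R t * b.tcoeff R k t' +
      tensorEval (aug A) R t' * b.tcoeff R k t := by
  induction t using TensorProduct.induction_on with
  | zero => simp
  | add x y hx hy =>
    rw [add_mul, map_add, hx, hy, map_add, map_add]
    ring
  | tmul a r =>
    induction t' using TensorProduct.induction_on with
    | zero => simp
    | add x y hx hy =>
      rw [mul_add, map_add, hx, hy, map_add, map_add]
      ring
    | tmul a' r' =>
      rw [Algebra.TensorProduct.tmul_mul_tmul, tcoeff_tmul, b.coeff_mul]
      simp only [tensorEval_tmul, tcoeff_tmul, Algebra.smul_def, map_mul, map_add]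
      ring

lemma tcoeff_one_tmul (k : ι) (r : R) : b.tcoeff R k (1 ⊗ₜ r) = 0 := by
  rw [tcoeff_tmul, ← map_one (algebraMap ℂ A), coeff_algebraMap, zero_smul]

end SqZeroBasis

end Algebra

section ThickFun

variable (A : Type) [CommRing A] [Algebra ℂ A] [Module.Finite ℂ A]

/-- An open subset of `X`, as an open subset of `Spec A × X`. Both have the same underlying
space. -/
def up (U : Opens X.carrier) : Opens (thick A X).carrier := U

variable {A} in
lemma up_le {U V : Opens X.carrier} (h : V ≤ U) : up A V ≤ up A U := h

/-- Functions on `Spec A × X` as elements of `A ⊗ Γ(U, O_X)`. -/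
def thickFun (U : Opens X.carrier) : A ⊗[ℂ] Fun X U ≃ₐ[ℂ] Fun (thick A X) (up A U) :=
  (AlgEquiv.refl : A ⊗[ℂ] Fun X U ≃ₐ[ℂ] A ⊗[ℂ] Fun X U)

variable {A}

lemma thickFun_surjective (U : Opens X.carrier) : Function.Surjective (thickFun A U) :=
  (thickFun A U).surjective

lemma funRest_thickFun {U V : Opens X.carrier} (h : V ≤ U) (t : A ⊗[ℂ] Fun X U) :
    funRest (up_le h) (thickFun A U t) =
      thickFun A V (Algebra.TensorProduct.map (AlgHom.id ℂ A) (funRest h) t) := rfl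

lemma funPull_thickPoint (φ : A →ₐ[ℂ] ℂ) {U V : Opens X.carrier}
    (h : V ≤ (Opens.map (thickPoint φ X).hom.base).obj (up A U)) (h' : V ≤ U)
    (t : A ⊗[ℂ] Fun X U) :
    funPull (thickPoint φ X) h (thickFun A U t) = funRest h' (tensorEval φ (Fun X U) t) := rfl

lemma funPull_thickMap {B : Type} [CommRing B] [Algebra ℂ B] [Module.Finite ℂ B] (φ : A →ₐ[ℂ] B)
    {U V : Opens X.carrier} (h : up B V ≤ (Opens.map (thickMap φ X).hom.base).obj (up A U))
    (h' : V ≤ U) (t : A ⊗[ℂ] Fun X U) :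
    funPull (thickMap φ X) h (thickFun A U t) =
      thickFun B V (Algebra.TensorProduct.map φ (funRest h') t) := by
  rw [funPull_eq]
  refine (funRest_thickFun h' (Algebra.TensorProduct.map φ (AlgHom.id ℂ _) t)).trans ?_
  congr 1
  exact DFunLike.congr_fun (show (Algebra.TensorProduct.map (AlgHom.id ℂ B) (funRest h')).comp
    (Algebra.TensorProduct.map φ (AlgHom.id ℂ _)) = Algebra.TensorProduct.map φ (funRest h') by
      ext <;> simp) t

lemma funPull_thickHom (f : X ⟶ Y) {U : Opens Y.carrier} {V : Opens X.carrier}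
    (h : up A V ≤ (Opens.map (thickHom A f).hom.base).obj (up A U))
    (h' : V ≤ (Opens.map f.hom.base).obj U) (t : A ⊗[ℂ] Fun Y U) :
    funPull (thickHom A f) h (thickFun A U t) =
      thickFun A V (Algebra.TensorProduct.map (AlgHom.id ℂ A) (funPull f h') t) := by
  rw [funPull_eq]
  refine (funRest_thickFun h' (Algebra.TensorProduct.map (AlgHom.id ℂ A)
    (f.hom.c.app (op U)).hom t)).trans ?_
  congr 1
  exact DFunLike.congr_fun (show (Algebra.TensorProduct.map (AlgHom.id ℂ A) (funRest h')).comp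
    (Algebra.TensorProduct.map (AlgHom.id ℂ A) (f.hom.c.app (op U)).hom) =
      Algebra.TensorProduct.map (AlgHom.id ℂ A) (funPull f h') by
      ext
      · simp
      · simp [funPull_eq]) t

/-- A module on `Spec A × X`, as an `O_X`-module. -/
def flat (N : OMod (thick A X)) : OMod X := (pushforward (thickProj A X)).obj N

/-- Sections of a module on `Spec A × X`, read as sections of the underlying `O_X`-module. -/
def toFlat (N : OMod (thick A X)) (U : Opens X.carrier) : Sec N (up A U) ≃+ Sec (flat N) U where
  toFun x := x
  invFun x := x
  left_inv _ := rfl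
  right_inv _ := rfl
  map_add' _ _ := rfl

lemma smul_toFlat (N : OMod (thick A X)) (U : Opens X.carrier) (r : Fun X U)
    (x : Sec N (up A U)) :
    r • toFlat N U x = toFlat N U (thickFun A U (1 ⊗ₜ r) • x) := rfl

lemma rest_toFlat (N : OMod (thick A X)) {U V : Opens X.carrier} (h : V ≤ U)
    (x : Sec N (up A U)) :
    rest (flat N) h (toFlat N U x) = toFlat N V (rest N (up_le h) x) := rfl

lemma toFlat_surjective (N : OMod (thick A X)) (U : Opens X.carrier) :
    Function.Surjective (toFlat N U) := (toFlat N U).surjective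

/-- Multiplication by `a ∈ A` on the sections of a module on `Spec A × X`. -/
def actSec (a : A) (N : OMod (thick A X)) (U : Opens X.carrier) :
    Sec (flat N) U →ₗ[Fun X U] Sec (flat N) U where
  toFun x := toFlat N U (thickFun A U (a ⊗ₜ 1) • (toFlat N U).symm x)
  map_add' x y := by rw [map_add, smul_add, map_add]
  map_smul' r x := by
    obtain ⟨x, rfl⟩ := toFlat_surjective N U x
    rw [smul_toFlat, RingHom.id_apply, (toFlat N U).symm_apply_apply,
      (toFlat N U).symm_apply_apply, smul_toFlat]
    congr 1
    exact smul_comm _ _ _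

lemma actSec_toFlat (a : A) (N : OMod (thick A X)) (U : Opens X.carrier) (x : Sec N (up A U)) :
    actSec a N U (toFlat N U x) = toFlat N U (thickFun A U (a ⊗ₜ 1) • x) := rfl

/-- Multiplication by `a ∈ A` on a module on `Spec A × X`. -/
def act (a : A) (N : OMod (thick A X)) : flat N ⟶ flat N :=
  mkHom (actSec a N) (fun {U V} h x => by
    obtain ⟨x, rfl⟩ := toFlat_surjective N U x
    rw [rest_toFlat, actSec_toFlat, actSec_toFlat, rest_toFlat, rest_smul, funRest_thickFun h,
      Algebra.TensorProduct.map_tmul, map_one]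
    rfl)

lemma onSec_act (a : A) (N : OMod (thick A X)) (U : Opens X.carrier) (x : Sec N (up A U)) :
    onSec (act a N) U (toFlat N U x) = toFlat N U (thickFun A U (a ⊗ₜ 1) • x) := rfl

lemma act_zero (N : OMod (thick A X)) : act (0 : A) N = 0 := by
  refine hom_ext' fun U x => ?_
  obtain ⟨x, rfl⟩ := toFlat_surjective N U x
  rw [onSec_act, TensorProduct.zero_tmul, map_zero, zero_smul, map_zero, onSec_zero]

/-- A module on `Spec A × X` is determined by the underlying `O_X`-module and the actions of the
basis elements of the maximal ideal of `A`. -/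
lemma toFlat_smul [IsLocalRing A] {ι : Type} [Fintype ι] [DecidableEq ι] (b : SqZeroBasis A ι)
    (N : OMod (thick A X)) (U : Opens X.carrier) (t : A ⊗[ℂ] Fun X U) (x : Sec N (up A U)) :
    toFlat N U (thickFun A U t • x) = tensorEval (aug A) (Fun X U) t • toFlat N U x +
      ∑ k, b.tcoeff (Fun X U) k t • onSec (act (b.eps k) N) U (toFlat N U x) := by
  conv_lhs => rw [b.tdecomp t]
  rw [map_add, add_smul, map_add, ← smul_toFlat, map_sum, Finset.sum_smul, map_sum]
  congr 1
  refine Finset.sum_congr rfl fun k _ => ?_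
  rw [onSec_act, smul_toFlat, smul_smul, ← map_mul, Algebra.TensorProduct.tmul_mul_tmul, one_mul,
    mul_one]

end ThickFun

/-! ### The extension underlying a bundle on `Spec A × X` -/

section Biproduct

instance : HasFiniteBiproducts (OMod X) := Abelian.hasFiniteBiproducts

variable {ι : Type} [Fintype ι] (M : ι → OMod X)

lemma sum_biproduct_sec {U : Opens X.carrier} (x : Sec (⨁ M) U) :
    ∑ k, onSec (biproduct.ι M k) U (onSec (biproduct.π M k) U x) = x := by
  have h := congrArg (fun f => onSec f U x) (biproduct.total (f := M))
  rwa [onSec_sum] at h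

lemma biproduct_sec_ext {U : Opens X.carrier} {x y : Sec (⨁ M) U}
    (h : ∀ k, onSec (biproduct.π M k) U x = onSec (biproduct.π M k) U y) : x = y := by
  rw [← sum_biproduct_sec M x, ← sum_biproduct_sec M y]
  simp_rw [h]

variable {M}

lemma onSec_biproduct_desc {N : OMod X} (f : ∀ k, M k ⟶ N) {U : Opens X.carrier}
    (x : Sec (⨁ M) U) :
    onSec (biproduct.desc f) U x = ∑ k, onSec (f k) U (onSec (biproduct.π M k) U x) := by
  conv_lhs => rw [← sum_biproduct_sec M x]
  rw [map_sum]
  refine Finset.sum_congr rfl fun k _ => ?_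
  rw [← onSec_comp, biproduct.ι_desc]

end Biproduct

section ClosedFibre

variable {A : Type} [CommRing A] [Algebra ℂ A] [Module.Finite ℂ A] [IsLocalRing A]
variable {ι : Type} [Fintype ι] [DecidableEq ι] (b : SqZeroBasis A ι)
variable {N : OMod (thick A X)} {N₀ : OMod X} (s : SemiHom (thickPoint (aug A) X) N N₀)

/-- A map over the inclusion of the closed fibre, on the sections over an open subset. -/
def specSec (U : Opens X.carrier) : Sec N (up A U) →+ Sec N₀ U := s.toFun (up A U) U le_rfl

lemma specSec_smul (U : Opens X.carrier) (t : A ⊗[ℂ] Fun X U) (x : Sec N (up A U)) :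
    specSec s U (thickFun A U t • x) = tensorEval (aug A) (Fun X U) t • specSec s U x := by
  refine (s.map_smul' (up A U) U le_rfl (thickFun A U t) x).trans ?_
  have h := (funPull_thickPoint (X := X) (aug A) (U := U) (V := U) le_rfl le_rfl t).trans
    (funRest_self le_rfl _)
  exact congrArg (fun r : Fun X U => r • specSec s U x) h

lemma specSec_rest {U V : Opens X.carrier} (h : V ≤ U) (x : Sec N (up A U)) :
    specSec s V (rest N (up_le h) x) = rest N₀ h (specSec s U x) :=
  s.map_rest' (up A U) U le_rfl (up A V) V (up_le h) h le_rfl x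

/-- A map over the inclusion of the closed fibre, as a map of `O_X`-modules. -/
def spec : flat N ⟶ N₀ :=
  mkHom (fun U =>
    { toFun := fun x => specSec s U ((toFlat N U).symm x)
      map_add' := fun x y => by rw [map_add, map_add]
      map_smul' := fun r x => by
        obtain ⟨x, rfl⟩ := toFlat_surjective N U x
        rw [smul_toFlat, (toFlat N U).symm_apply_apply, (toFlat N U).symm_apply_apply,
          specSec_smul, tensorEval_tmul, map_one, one_smul, RingHom.id_apply] })
    (fun {U V} h x => by
      obtain ⟨x, rfl⟩ := toFlat_surjective N U x
      exact specSec_rest s h x)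

lemma onSec_spec (U : Opens X.carrier) (x : Sec N (up A U)) :
    onSec (spec s) U (toFlat N U x) = specSec s U x := rfl

variable {s}

/-- Local bases of a bundle on `Spec A × X` restrict to local bases on the closed fibre. -/
lemma IsBasisOn.specSec (hs : s.IsPull) {U : Opens X.carrier} {n : ℕ}
    {e : Fin n → Sec N (up A U)} (he : IsBasisOn e) :
    IsBasisOn (fun j => FramedDeformations.specSec s U (e j)) :=
  hs.isBasisOn he le_rfl

lemma exists_basis_up (hN : IsVectorBundle N) (p : X.carrier) :
    ∃ U : Opens X.carrier, p ∈ U ∧ ∃ (n : ℕ) (e : Fin n → Sec N (up A U)), IsBasisOn e :=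
  hN p

lemma IsBasisOn.exists_coord {U V : Opens X.carrier} (h : V ≤ U) {n : ℕ}
    {e : Fin n → Sec N (up A U)} (he : IsBasisOn e) (x : Sec N (up A V)) :
    ∃ c : Fin n → A ⊗[ℂ] Fun X V, x = ∑ j, thickFun A V (c j) • rest N (up_le h) (e j) := by
  have hx := he.sum_coord (up_le h) x
  choose c hc using fun j => thickFun_surjective V (he.coord (up_le h) x j)
  refine ⟨c, ?_⟩
  simp_rw [hc]
  exact hx.symm

lemma IsBasisOn.specSec_eq_zero (hs : s.IsPull) {U V : Opens X.carrier} (h : V ≤ U) {n : ℕ}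
    {e : Fin n → Sec N (up A U)} (he : IsBasisOn e) (c : Fin n → A ⊗[ℂ] Fun X V)
    (hx : FramedDeformations.specSec s V (∑ j, thickFun A V (c j) • rest N (up_le h) (e j)) = 0)
    (j : Fin n) : tensorEval (aug A) (Fun X V) (c j) = 0 := by
  refine (he.specSec hs).eq_zero h (c := fun j => tensorEval (aug A) (Fun X V) (c j)) ?_ j
  rw [← hx, map_sum]
  refine Finset.sum_congr rfl fun j _ => ?_
  rw [specSec_smul, specSec_rest]

lemma locSurj_spec (hs : s.IsPull) (hN : IsVectorBundle N) : LocSurj (spec s) := by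
  intro V y p hp
  obtain ⟨U, hpU, n, e, he⟩ := exists_basis_up hN p
  let c := (he.specSec hs).coord (inf_le_right : V ⊓ U ≤ U) (rest N₀ inf_le_left y)
  refine ⟨V ⊓ U, inf_le_left, ⟨hp, hpU⟩, toFlat N _
    (∑ j, thickFun A _ (1 ⊗ₜ c j) • rest N (up_le (inf_le_right : V ⊓ U ≤ U)) (e j)), ?_⟩
  rw [onSec_spec, map_sum]
  refine Eq.trans ?_ ((he.specSec hs).sum_coord (inf_le_right : V ⊓ U ≤ U) (rest N₀ inf_le_left y))
  refine Finset.sum_congr rfl fun j _ => ?_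
  rw [specSec_smul, tensorEval_tmul, map_one, one_smul, specSec_rest]

include b in
/-- The basis elements of the maximal ideal annihilate the sections that vanish on the closed
fibre. -/
lemma act_eps_eq_zero (hs : s.IsPull) (hN : IsVectorBundle N) (k : ι) {V : Opens X.carrier}
    (x : Sec (flat N) V) (hx : onSec (spec s) V x = 0) : onSec (act (b.eps k) N) V x = 0 := by
  refine sec_ext _ fun p hp => ?_
  obtain ⟨U, hpU, n, e, he⟩ := exists_basis_up hN p
  refine ⟨V ⊓ U, inf_le_left, ⟨hp, hpU⟩, ?_⟩
  have hx' : onSec (spec s) (V ⊓ U) (rest _ inf_le_left x) = 0 := by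
    rw [onSec_rest, hx, map_zero]
  rw [map_zero, ← onSec_rest]
  obtain ⟨y, hy⟩ := toFlat_surjective N (V ⊓ U) (rest (flat N) inf_le_left x)
  rw [← hy] at hx' ⊢
  obtain ⟨c, rfl⟩ := he.exists_coord (inf_le_right : V ⊓ U ≤ U) y
  have hc := he.specSec_eq_zero hs (inf_le_right : V ⊓ U ≤ U) c hx'
  rw [onSec_act, Finset.smul_sum, map_sum]
  refine Finset.sum_eq_zero fun j _ => ?_
  rw [smul_smul, ← map_mul, b.eps_tmul_mul, hc, TensorProduct.tmul_zero, map_zero, zero_smul,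
    map_zero]

/-- Flatness over `A`: if `∑ k, ε_k x_k = 0`, then every `x_k` vanishes on the closed fibre. -/
lemma sum_act_eps_eq_zero (hN : IsVectorBundle N) {V : Opens X.carrier}
    (x : ι → Sec (flat N) V) (hx : ∑ k, onSec (act (b.eps k) N) V (x k) = 0) (k : ι) :
    onSec (spec s) V (x k) = 0 := by
  refine sec_ext _ fun p hp => ?_
  obtain ⟨U, hpU, n, e, he⟩ := exists_basis_up hN p
  refine ⟨V ⊓ U, inf_le_left, ⟨hp, hpU⟩, ?_⟩
  have hx' : ∑ k, onSec (act (b.eps k) N) (V ⊓ U) (rest _ inf_le_left (x k)) = 0 := by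
    simp_rw [onSec_rest]
    rw [← map_sum, hx, map_zero]
  rw [map_zero, ← onSec_rest]
  choose y hy using fun k => toFlat_surjective N (V ⊓ U) (rest (flat N) inf_le_left (x k))
  choose c hc using fun k => he.exists_coord (inf_le_right : V ⊓ U ≤ U) (y k)
  simp_rw [← hy, onSec_act] at hx'
  rw [← map_sum, map_eq_zero_iff _ (toFlat N _).injective] at hx'
  have h1 : ∑ j, thickFun A (V ⊓ U) (∑ k, b.eps k ⊗ₜ tensorEval (aug A) _ (c k j)) •
      rest N (up_le (inf_le_right : V ⊓ U ≤ U)) (e j) = 0 := by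
    rw [← hx']
    simp_rw [map_sum, Finset.sum_smul]
    rw [Finset.sum_comm]
    refine Finset.sum_congr rfl fun k _ => ?_
    conv_rhs => rw [hc k]
    rw [Finset.smul_sum]
    refine Finset.sum_congr rfl fun j _ => ?_
    rw [smul_smul, ← map_mul, b.eps_tmul_mul]
  have h2 : ∀ j, tensorEval (aug A) _ (c k j) = 0 := by
    intro j
    have h3 := he.eq_zero (up_le (inf_le_right : V ⊓ U ≤ U)) (c := fun j =>
      thickFun A (V ⊓ U) (∑ k, b.eps k ⊗ₜ tensorEval (aug A) _ (c k j))) h1 j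
    rw [map_eq_zero_iff _ (thickFun A _).injective] at h3
    rw [← b.tcoeff_sum_eps (fun k => tensorEval (aug A) (Fun X (V ⊓ U)) (c k j)) k, h3, map_zero]
  rw [← hy, onSec_spec, hc k, map_sum]
  refine Finset.sum_eq_zero fun j _ => ?_
  rw [specSec_smul, h2, zero_smul]

/-- Sections that vanish on the closed fibre are of the form `∑ k, ε_k y_k`, over open subsets where
there is a basis. -/
lemma exists_sum_act_eps (hs : s.IsPull) {U V : Opens X.carrier} (h : V ≤ U) {n : ℕ}
    {e : Fin n → Sec N (up A U)} (he : IsBasisOn e) (x : Sec (flat N) V)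
    (hx : onSec (spec s) V x = 0) :
    ∃ y : ι → Sec (flat N) V, ∑ k, onSec (act (b.eps k) N) V (y k) = x := by
  obtain ⟨x, rfl⟩ := toFlat_surjective N V x
  obtain ⟨c, rfl⟩ := he.exists_coord h x
  have hc := he.specSec_eq_zero hs h c hx
  refine ⟨fun k => toFlat N V (∑ j, thickFun A V (1 ⊗ₜ b.tcoeff _ k (c j)) •
    rest N (up_le h) (e j)), ?_⟩
  simp_rw [onSec_act]
  rw [← map_sum]
  congr 1
  simp_rw [Finset.smul_sum]
  rw [Finset.sum_comm]
  refine Finset.sum_congr rfl fun j _ => ?_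
  simp_rw [smul_smul, ← map_mul, Algebra.TensorProduct.tmul_mul_tmul, mul_one, one_mul]
  rw [← Finset.sum_smul, ← map_sum]
  conv_rhs => rw [b.tdecomp (c j), hc, TensorProduct.tmul_zero, zero_add]

variable (hs : s.IsPull) (hN : IsVectorBundle N)

include hs hN in
lemma epi_spec : Epi (spec s) := epi_of_locSurj _ (locSurj_spec hs hN)

/-- The map `N₀ → N`, `s x ↦ ε_k x`. -/
def epsMap (k : ι) : N₀ ⟶ flat N :=
  have := epi_spec hs hN
  Abelian.epiDesc (spec s) (act (b.eps k) N) (hom_ext' fun U x => by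
    rw [onSec_comp, onSec_zero]
    refine act_eps_eq_zero b hs hN k _ ?_
    rw [← onSec_comp, kernel.condition, onSec_zero])

lemma spec_epsMap (k : ι) : spec s ≫ epsMap b hs hN k = act (b.eps k) N :=
  have := epi_spec hs hN
  Abelian.comp_epiDesc _ _ _

lemma onSec_epsMap (k : ι) (U : Opens X.carrier) (x : Sec (flat N) U) :
    onSec (epsMap b hs hN k) U (onSec (spec s) U x) = onSec (act (b.eps k) N) U x := by
  rw [← onSec_comp, spec_epsMap]

include b in
lemma act_eps_spec (k : ι) : act (b.eps k) N ≫ spec s = 0 := by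
  refine hom_ext' fun U x => ?_
  obtain ⟨x, rfl⟩ := toFlat_surjective N U x
  rw [onSec_comp, onSec_act, onSec_spec, specSec_smul, tensorEval_tmul, b.aug_eps, zero_smul,
    zero_smul]
  rfl

lemma epsMap_spec (k : ι) : epsMap b hs hN k ≫ spec s = 0 := by
  have := epi_spec hs hN
  rw [← cancel_epi (spec s), reassoc_of% spec_epsMap b hs hN k, act_eps_spec, comp_zero]

/-- The maps `s x ↦ ε_k x` for all `k`, taken together. -/
def epsMaps : (⨁ fun _ : ι => N₀) ⟶ flat N := biproduct.desc (epsMap b hs hN)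

lemma epsMaps_spec : epsMaps b hs hN ≫ spec s = 0 := by
  refine biproduct.hom_ext' _ _ fun k => ?_
  rw [epsMaps, biproduct.ι_desc_assoc, epsMap_spec, comp_zero]

lemma onSec_epsMaps_injective (V : Opens X.carrier) :
    Function.Injective (onSec (epsMaps b hs hN) V) := by
  rw [injective_iff_map_eq_zero]
  intro z hz
  refine biproduct_sec_ext _ fun k => ?_
  rw [map_zero]
  refine sec_ext _ fun p hp => ?_
  have hlift : ∀ k, ∃ (V' : Opens X.carrier) (h : V' ≤ V), p ∈ V' ∧ ∃ x : Sec (flat N) V',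
      onSec (spec s) V' x = rest N₀ h (onSec (biproduct.π _ k) V z) :=
    fun k => locSurj_spec hs hN V _ p hp
  choose V' hV' hpV' x hx using hlift
  let T : Opens X.carrier := V ⊓ Finset.univ.inf V'
  have hT : ∀ k, T ≤ V' k := fun k => inf_le_right.trans (Finset.inf_le (Finset.mem_univ k))
  have hTV : T ≤ V := inf_le_left
  have hpT : p ∈ T := ⟨hp, mem_univ_inf hpV'⟩
  have hx' : ∀ k, onSec (spec s) T (rest _ (hT k) (x k)) =
      rest N₀ hTV (onSec (biproduct.π _ k) V z) := fun k => by
    rw [onSec_rest, hx, rest_rest]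
  refine ⟨T, hTV, hpT, ?_⟩
  rw [← hx', map_zero]
  refine sum_act_eps_eq_zero b hN (fun k => rest _ (hT k) (x k)) ?_ k
  have h0 := congrArg (rest _ hTV) hz
  rw [epsMaps, onSec_biproduct_desc, map_sum, map_zero] at h0
  rw [← h0]
  refine Finset.sum_congr rfl fun k _ => ?_
  rw [← onSec_rest, ← hx', onSec_epsMap]

/-- A bundle `N` on `Spec A × X` with closed fibre `N₀` is an extension of `N₀` by a sum of copies
of `N₀`, one for each basis element of the maximal ideal of `A`. -/
lemma thick_shortExact : (ShortComplex.mk _ _ (epsMaps_spec b hs hN)).ShortExact := by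
  refine shortExact_of_sections _ _ (onSec_epsMaps_injective b hs hN) _ ?_ (locSurj_spec hs hN)
  intro V x hx
  refine exists_of_locally_exists _ (fun V' _ => onSec_epsMaps_injective b hs hN V') x
    fun p hp => ?_
  obtain ⟨U, hpU, n, e, he⟩ := exists_basis_up hN p
  refine ⟨V ⊓ U, inf_le_left, ⟨hp, hpU⟩, ?_⟩
  obtain ⟨y, hy⟩ := exists_sum_act_eps b hs (inf_le_right : V ⊓ U ≤ U) he (rest _ inf_le_left x)
    (by rw [onSec_rest, hx, map_zero])
  refine ⟨∑ k, onSec (biproduct.ι _ k) _ (onSec (spec s) _ (y k)), ?_⟩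
  rw [map_sum, ← hy]
  refine Finset.sum_congr rfl fun k _ => ?_
  rw [← onSec_comp, epsMaps, biproduct.ι_desc, onSec_epsMap]

end ClosedFibre

/-! ### Matrices of scalars and the maps underlying base change and restriction -/

section Pushforward

instance (f : X ⟶ Y) : (pushforward f).Additive where
  map_add := rfl

lemma onSec_smul {M N : OMod X} (z : ℂ) (f : M ⟶ N) (U : Opens X.carrier) (x : Sec M U) :
    onSec (z • f) U x = algebraMap ℂ (Fun X U) z • onSec f U x := rfl

instance (f : X ⟶ Y) : (pushforward f).Linear ℂ where
  map_smul {M N} g z := hom_ext' fun U x => by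
    have h : algebraMap ℂ (Fun X ((Opens.map f.hom.base).obj U)) z =
        (f.hom.c.app (op U)).hom (algebraMap ℂ (Fun Y U) z) :=
      ((f.hom.c.app (op U)).hom.commutes z).symm
    exact congrArg (fun r : Fun X ((Opens.map f.hom.base).obj U) =>
      r • onSec g ((Opens.map f.hom.base).obj U) x) h

end Pushforward

section Matrix

variable {𝒞 : Type*} [Category* 𝒞] [Preadditive 𝒞] [HasFiniteBiproducts 𝒞] [Linear ℂ 𝒞]
variable {ι κ : Type} [Fintype ι] [Fintype κ]

/-- The map `⨁ M → ⨁ M` given by a matrix of complex numbers. -/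
def scalarMatrix (z : ι → κ → ℂ) (M : 𝒞) : (⨁ fun _ : ι => M) ⟶ (⨁ fun _ : κ => M) :=
  biproduct.desc fun k => biproduct.lift fun l => z k l • 𝟙 M

lemma ι_scalarMatrix_π (z : ι → κ → ℂ) (M : 𝒞) (k : ι) (l : κ) :
    biproduct.ι (fun _ => M) k ≫ scalarMatrix z M ≫ biproduct.π (fun _ => M) l = z k l • 𝟙 M := by
  rw [scalarMatrix, biproduct.ι_desc_assoc, biproduct.lift_π]

lemma scalarMatrix_π [DecidableEq ι] (z : ι → κ → ℂ) (M : 𝒞) (l : κ) :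
    scalarMatrix z M ≫ biproduct.π (fun _ => M) l =
      ∑ k, z k l • biproduct.π (fun _ => M) k := by
  refine biproduct.hom_ext' _ _ fun k => ?_
  rw [ι_scalarMatrix_π, Preadditive.comp_sum, Finset.sum_eq_single k]
  · rw [Linear.comp_smul, biproduct.ι_π_self]
  · intro l _ hl
    rw [Linear.comp_smul, biproduct.ι_π_ne _ hl.symm, smul_zero]
  · simp

lemma ι_scalarMatrix [DecidableEq κ] (z : ι → κ → ℂ) (M : 𝒞) (k : ι) :
    biproduct.ι (fun _ => M) k ≫ scalarMatrix z M =
      ∑ l, z k l • biproduct.ι (fun _ => M) l := by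
  refine biproduct.hom_ext _ _ fun l => ?_
  rw [Category.assoc, ι_scalarMatrix_π, Preadditive.sum_comp, Finset.sum_eq_single l]
  · rw [Linear.smul_comp, biproduct.ι_π_self]
  · intro k _ hk
    rw [Linear.smul_comp, biproduct.ι_π_ne _ hk, smul_zero]
  · simp

lemma map_scalarMatrix (z : ι → κ → ℂ) {M N : 𝒞} (f : M ⟶ N) :
    scalarMatrix z M ≫ biproduct.map (fun _ => f) =
      biproduct.map (fun _ => f) ≫ scalarMatrix z N := by
  refine biproduct.hom_ext' _ _ fun k => biproduct.hom_ext _ _ fun l => ?_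
  simp only [Category.assoc]
  rw [biproduct.ι_map_assoc, biproduct.map_π, ι_scalarMatrix_π, Linear.comp_smul,
    Category.comp_id, reassoc_of% ι_scalarMatrix_π z M k l, Linear.smul_comp, Category.id_comp]

/-- The sum of copies of a short complex. -/
@[simps]
def sumComplex (ι : Type) [Fintype ι] (S : ShortComplex 𝒞) : ShortComplex 𝒞 :=
  ShortComplex.mk (biproduct.map fun _ : ι => S.f) (biproduct.map fun _ : ι => S.g) (by
    refine biproduct.hom_ext _ _ fun k => ?_
    simp)

/-- The map between sums of copies of a short complex given by a matrix of complex numbers. -/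
@[simps]
def sumComplexMap (z : ι → κ → ℂ) (S : ShortComplex 𝒞) : sumComplex ι S ⟶ sumComplex κ S where
  τ₁ := scalarMatrix z S.X₁
  τ₂ := scalarMatrix z S.X₂
  τ₃ := scalarMatrix z S.X₃
  comm₁₂ := map_scalarMatrix z S.f
  comm₂₃ := map_scalarMatrix z S.g

end Matrix

lemma sumComplex_shortExact {𝒞 : Type*} [Category* 𝒞] [Abelian 𝒞] [HasFiniteBiproducts 𝒞]
    {ι : Type} [Fintype ι] {S : ShortComplex 𝒞} (hS : S.ShortExact) :
    (sumComplex ι S).ShortExact where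
  mono_f := by
    have := hS.mono_f
    exact inferInstanceAs (Mono (biproduct.map fun _ : ι => S.f))
  epi_g := by
    have := hS.epi_g
    exact inferInstanceAs (Epi (biproduct.map fun _ : ι => S.g))
  exact := by
    have := hS.mono_f
    rw [ShortComplex.exact_iff_exact_up_to_refinements]
    intro T (x : T ⟶ ⨁ fun _ : ι => S.X₂) hx
    have hx' : x ≫ (biproduct.map fun _ : ι => S.g) = 0 := hx
    have hk : ∀ k, (x ≫ biproduct.π (fun _ : ι => S.X₂) k) ≫ S.g = 0 := fun k => by
      have h := congrArg (fun t => t ≫ biproduct.π (fun _ : ι => S.X₃) k) hx'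
      simpa using h
    refine ⟨T, 𝟙 T, inferInstance, biproduct.lift fun k => hS.exact.lift _ (hk k), ?_⟩
    show 𝟙 T ≫ x = biproduct.lift _ ≫ biproduct.map fun _ : ι => S.f
    refine biproduct.hom_ext _ _ fun k => ?_
    rw [Category.id_comp, Category.assoc, biproduct.map_π, biproduct.lift_π_assoc,
      hS.exact.lift_f]

section Flat

variable {A : Type} [CommRing A] [Algebra ℂ A] [Module.Finite ℂ A]
variable {B : Type} [CommRing B] [Algebra ℂ B] [Module.Finite ℂ B]

lemma act_add (a a' : A) (N : OMod (thick A X)) : act (a + a') N = act a N + act a' N := by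
  refine hom_ext' fun U x => ?_
  obtain ⟨x, rfl⟩ := toFlat_surjective N U x
  rw [onSec_add, onSec_act, onSec_act, onSec_act, TensorProduct.add_tmul, map_add, add_smul,
    map_add]

lemma act_smul (z : ℂ) (a : A) (N : OMod (thick A X)) : act (z • a) N = z • act a N := by
  refine hom_ext' fun U x => ?_
  obtain ⟨x, rfl⟩ := toFlat_surjective N U x
  rw [onSec_smul, onSec_act, onSec_act, smul_toFlat, smul_smul, ← map_mul,
    Algebra.TensorProduct.tmul_mul_tmul, one_mul, mul_one, TensorProduct.smul_tmul,
    Algebra.algebraMap_eq_smul_one]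

lemma act_sum {ι : Type*} (s : Finset ι) (a : ι → A) (N : OMod (thick A X)) :
    act (∑ k ∈ s, a k) N = ∑ k ∈ s, act (a k) N := by
  classical
  induction s using Finset.induction_on with
  | empty => rw [Finset.sum_empty, Finset.sum_empty, act_zero]
  | insert k s hk ih => rw [Finset.sum_insert hk, Finset.sum_insert hk, act_add, ih]

/-- A map over `Spec A × Y → Spec A × X`, on the underlying `O_X`-modules. -/
def flatHom {i : Y ⟶ X} {N : OMod (thick A X)} {M : OMod (thick A Y)}
    (c : SemiHom (thickHom A i) N M) : flat N ⟶ (pushforward i).obj (flat M) :=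
  mkHom (fun U =>
    { toFun := fun x => toFlat M ((Opens.map i.hom.base).obj U) (c.toFun (up A U)
        (up A ((Opens.map i.hom.base).obj U)) le_rfl ((toFlat N U).symm x))
      map_add' := fun x y => by rw [map_add, map_add, map_add]; rfl
      map_smul' := fun r x => by
        obtain ⟨x, rfl⟩ := toFlat_surjective N U x
        have h := (c.map_smul' (up A U) (up A ((Opens.map i.hom.base).obj U)) le_rfl
          (thickFun A U (1 ⊗ₜ r)) x)
        have h2 := funPull_thickHom (A := A) i (U := U) (V := (Opens.map i.hom.base).obj U)
          le_rfl le_rfl (1 ⊗ₜ r)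
        rw [Algebra.TensorProduct.map_tmul, map_one, funPull_eq i, funRest_self] at h2
        rw [h2] at h
        exact congrArg (toFlat M ((Opens.map i.hom.base).obj U)) h })
    (fun {U V} h x => c.map_rest' (up A U) (up A ((Opens.map i.hom.base).obj U)) le_rfl (up A V)
      (up A ((Opens.map i.hom.base).obj V)) (up_le h)
      (up_le (fun _ hy => h hy : (Opens.map i.hom.base).obj V ≤ (Opens.map i.hom.base).obj U))
      le_rfl ((toFlat N U).symm x))

lemma act_flatHom {i : Y ⟶ X} {N : OMod (thick A X)} {M : OMod (thick A Y)}
    (c : SemiHom (thickHom A i) N M) (a : A) :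
    act a N ≫ flatHom c = flatHom c ≫ (pushforward i).map (act a M) := by
  refine hom_ext' fun U x => ?_
  obtain ⟨x, rfl⟩ := toFlat_surjective N U x
  have h := (c.map_smul' (up A U) (up A ((Opens.map i.hom.base).obj U)) le_rfl
    (thickFun A U (a ⊗ₜ 1)) x)
  have h2 := funPull_thickHom (A := A) i (U := U) (V := (Opens.map i.hom.base).obj U)
    le_rfl le_rfl (a ⊗ₜ 1)
  rw [Algebra.TensorProduct.map_tmul, map_one] at h2
  rw [h2] at h
  exact congrArg (toFlat M ((Opens.map i.hom.base).obj U)) h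

/-- A map over `Spec B × X → Spec A × X`, on the underlying `O_X`-modules. -/
def flatBaseChange {φ : A →ₐ[ℂ] B} {N : OMod (thick A X)} {M : OMod (thick B X)}
    (c : SemiHom (thickMap φ X) N M) : flat N ⟶ flat M :=
  mkHom (fun U =>
    { toFun := fun x => toFlat M U (c.toFun (up A U) (up B U) le_rfl ((toFlat N U).symm x))
      map_add' := fun x y => by rw [map_add, map_add, map_add]
      map_smul' := fun r x => by
        obtain ⟨x, rfl⟩ := toFlat_surjective N U x
        have h := c.map_smul' (up A U) (up B U) le_rfl (thickFun A U (1 ⊗ₜ r)) x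
        have h2 := funPull_thickMap φ (U := U) (V := U) le_rfl le_rfl (1 ⊗ₜ r)
        rw [Algebra.TensorProduct.map_tmul, map_one, funRest_self] at h2
        rw [h2] at h
        exact congrArg (toFlat M U) h })
    (fun {U V} h x => c.map_rest' (up A U) (up B U) le_rfl (up A V) (up B V) (up_le h) (up_le h)
      le_rfl ((toFlat N U).symm x))

lemma act_flatBaseChange {φ : A →ₐ[ℂ] B} {N : OMod (thick A X)} {M : OMod (thick B X)}
    (c : SemiHom (thickMap φ X) N M) (a : A) :
    act a N ≫ flatBaseChange c = flatBaseChange c ≫ act (φ a) M := by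
  refine hom_ext' fun U x => ?_
  obtain ⟨x, rfl⟩ := toFlat_surjective N U x
  have h := c.map_smul' (up A U) (up B U) le_rfl (thickFun A U (a ⊗ₜ 1)) x
  have h2 := funPull_thickMap φ (U := U) (V := U) le_rfl le_rfl (a ⊗ₜ 1)
  rw [Algebra.TensorProduct.map_tmul, map_one] at h2
  rw [h2] at h
  exact congrArg (toFlat M U) h

lemma flatBaseChange_flatHom {φ : A →ₐ[ℂ] B} {i : Y ⟶ X} {N : OMod (thick A X)}
    {N' : OMod (thick B X)} {M : OMod (thick A Y)} {M' : OMod (thick B Y)}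
    (c : SemiHom (thickMap φ X) N N') (r' : SemiHom (thickHom B i) N' M')
    (r : SemiHom (thickHom A i) N M) (c' : SemiHom (thickMap φ Y) M M')
    (h : c.comp (thickHom_comp_map φ i) r' = r.comp rfl c') :
    flatBaseChange c ≫ flatHom r' = flatHom r ≫ (pushforward i).map (flatBaseChange c') := by
  refine hom_ext' fun U x => ?_
  obtain ⟨x, rfl⟩ := toFlat_surjective N U x
  have h1 := congrArg (fun s => s.toFun (up A U) (up B ((Opens.map i.hom.base).obj U)) le_rfl x) h
  exact h1

variable [IsLocalRing A] [IsLocalRing B]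

lemma flatBaseChange_spec {φ : A →ₐ[ℂ] B} {N : OMod (thick A X)} {M : OMod (thick B X)}
    {N₀ : OMod X} (c : SemiHom (thickMap φ X) N M) (s : SemiHom (thickPoint (aug A) X) N N₀)
    (s' : SemiHom (thickPoint (aug B) X) M N₀) (h : c.comp (point_comp_map φ X) s' = s) :
    flatBaseChange c ≫ spec s' = spec s := by
  refine hom_ext' fun U x => ?_
  obtain ⟨x, rfl⟩ := toFlat_surjective N U x
  exact congrArg (fun s => s.toFun (up A U) U le_rfl x) h

lemma flatHom_spec {i : Y ⟶ X} {N : OMod (thick A X)} {M : OMod (thick A Y)} {N₀ : OMod X}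
    {M₀ : OMod Y} (c : SemiHom (thickHom A i) N M) (s : SemiHom (thickPoint (aug A) X) N N₀)
    (s' : SemiHom (thickPoint (aug A) Y) M M₀) (c₀ : SemiHom i N₀ M₀)
    (h : s.comp rfl c₀ = c.comp (thickPoint_comp_hom (aug A) i) s') :
    flatHom c ≫ (pushforward i).map (spec s') = spec s ≫ c₀.toHom := by
  refine hom_ext' fun U x => ?_
  obtain ⟨x, rfl⟩ := toFlat_surjective N U x
  exact (congrArg (fun s => s.toFun (up A U) ((Opens.map i.hom.base).obj U) le_rfl x) h).symm

end Flat

/-! ### The extension with trivialization of a deformation -/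

section Coefficients

variable {A : Type} [CommRing A] [Algebra ℂ A] [Module.Finite ℂ A] [IsLocalRing A]
variable {B : Type} [CommRing B] [Algebra ℂ B] [Module.Finite ℂ B] [IsLocalRing B]
variable {ι : Type} [Fintype ι] [DecidableEq ι] (b : SqZeroBasis A ι)
variable {κ : Type} [Fintype κ] [DecidableEq κ] (b' : SqZeroBasis B κ)

lemma act_eq_sum (a : A) (ha : aug A a = 0) (N : OMod (thick A X)) :
    act a N = ∑ k, b.coeff k a • act (b.eps k) N := by
  conv_lhs => rw [b.decomp a, ha, map_zero, zero_add]
  rw [act_sum]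
  simp_rw [act_smul]

/-- The effect of a base change `A → B` on the maximal ideals, as a matrix. -/
def baseChangeMatrix (φ : A →ₐ[ℂ] B) (k : ι) (l : κ) : ℂ := b'.coeff l (φ (b.eps k))

lemma aug_map_eps (φ : A →ₐ[ℂ] B) (k : ι) : aug B (φ (b.eps k)) = 0 := by
  have h := DFunLike.congr_fun (aug_comp φ) (b.eps k)
  exact h.trans (b.aug_eps k)

/-- Base change along `A → B` acts on the sub-objects of multiples of the basis elements by the
matrix of `A → B` on the maximal ideals. -/
lemma epsMaps_flatBaseChange {φ : A →ₐ[ℂ] B} {N : OMod (thick A X)} {M : OMod (thick B X)}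
    {N₀ : OMod X} (c : SemiHom (thickMap φ X) N M) {s : SemiHom (thickPoint (aug A) X) N N₀}
    {s' : SemiHom (thickPoint (aug B) X) M N₀} (h : c.comp (point_comp_map φ X) s' = s)
    (hs : s.IsPull) (hN : IsVectorBundle N) (hs' : s'.IsPull) (hM : IsVectorBundle M) :
    epsMaps b hs hN ≫ flatBaseChange c =
      scalarMatrix (baseChangeMatrix b b' φ) N₀ ≫ epsMaps b' hs' hM := by
  refine biproduct.hom_ext' _ _ fun k => ?_
  have := epi_spec hs hN
  rw [← cancel_epi (spec s), epsMaps, biproduct.ι_desc_assoc,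
    reassoc_of% spec_epsMap b hs hN k, act_flatBaseChange, act_eq_sum b' _ (aug_map_eps b φ k),
    ← Category.assoc (biproduct.ι _ k),
    ι_scalarMatrix, Preadditive.sum_comp, Preadditive.comp_sum, Preadditive.comp_sum]
  refine Finset.sum_congr rfl fun l _ => ?_
  rw [Linear.smul_comp, Linear.comp_smul, Linear.comp_smul, epsMaps, biproduct.ι_desc,
    ← flatBaseChange_spec c s s' h, Category.assoc, spec_epsMap]
  rfl

variable {W : OMod Y}

lemma constFamilyAt_isPull : (constFamilyAt A W).IsPull := by
  rw [← SemiHom.isPull_comp_iff (thickPoint_comp_proj (aug A) Y) (constFamilyUnit_isPull A W),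
    constFamilyUnit_comp_at]
  exact idSemi_isPull W

variable (A W) in
/-- The inclusion of `W` in `p^* W` as the constant sections. -/
def constSec : W ⟶ flat (constFamily A W) := (constFamilyUnit A W).toHom

lemma constSec_spec : constSec A W ≫ spec (constFamilyAt A W) = 𝟙 W := by
  refine hom_ext' fun U x => ?_
  have h := congrArg (fun s => s.toFun U U le_rfl x) (constFamilyUnit_comp_at A W)
  exact h.trans (rest_self W _ x)

lemma constSec_flatBaseChange (φ : A →ₐ[ℂ] B) :
    constSec A W ≫ flatBaseChange (constFamilyMap φ W) = constSec B W := by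
  refine hom_ext' fun U x => ?_
  exact congrArg (fun s => s.toFun U (up B U) le_rfl x) (constFamilyUnit_comp_map φ W)

variable (hW : IsVectorBundle W)

include hW in
lemma constFamily_isVectorBundle : IsVectorBundle (constFamily A W) :=
  (constFamilyUnit_isPull A W).isVectorBundle hW

/-- The inclusion of the multiples of the basis elements of the maximal ideal of `A` in `p^* W`. -/
abbrev constEps : (⨁ fun _ : ι => W) ⟶ flat (constFamily A W) :=
  epsMaps b constFamilyAt_isPull (constFamily_isVectorBundle hW)

lemma constEps_shortExact :
    (ShortComplex.mk (constEps b hW) (spec (constFamilyAt A W)) (epsMaps_spec b _ _)).ShortExact :=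
  thick_shortExact b _ _

/-- The coefficients of the sections of `p^* W` with respect to the basis elements of the maximal
ideal of `A`: a section minus the constant section with the same restriction to the closed fibre is
a unique combination of these elements. -/
def constCoeff : flat (constFamily A W) ⟶ (⨁ fun _ : ι => W) :=
  have := (constEps_shortExact b hW).mono_f
  (constEps_shortExact b hW).exact.lift (𝟙 _ - spec (constFamilyAt A W) ≫ constSec A W) (by
    rw [Preadditive.sub_comp, Category.assoc, constSec_spec, Category.comp_id, Category.id_comp,
      sub_self])

lemma constCoeff_eps : constCoeff b hW ≫ constEps b hW =
    𝟙 _ - spec (constFamilyAt A W) ≫ constSec A W :=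
  have := (constEps_shortExact b hW).mono_f
  (constEps_shortExact b hW).exact.lift_f _ _

lemma mono_constEps : Mono (constEps b hW) := (constEps_shortExact b hW).mono_f

lemma constEps_coeff : constEps b hW ≫ constCoeff b hW = 𝟙 _ := by
  have := mono_constEps b hW
  rw [← cancel_mono (constEps b hW), Category.assoc, constCoeff_eps, Preadditive.comp_sub,
    ← Category.assoc, epsMaps_spec, zero_comp, sub_zero, Category.comp_id, Category.id_comp]

lemma constSec_coeff : constSec A W ≫ constCoeff b hW = 0 := by
  have := mono_constEps b hW
  rw [← cancel_mono (constEps b hW), Category.assoc, constCoeff_eps, Preadditive.comp_sub,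
    reassoc_of% constSec_spec (A := A) (W := W), Category.comp_id, sub_self, zero_comp]

lemma constCoeff_flatBaseChange (φ : A →ₐ[ℂ] B) :
    flatBaseChange (constFamilyMap φ W) ≫ constCoeff b' hW =
      constCoeff b hW ≫ scalarMatrix (baseChangeMatrix b b' φ) W := by
  have := mono_constEps b' hW
  rw [← cancel_mono (constEps b' hW), Category.assoc, Category.assoc, constCoeff_eps,
    ← epsMaps_flatBaseChange b b' (constFamilyMap φ W) (constFamilyMap_comp_at φ W)
      constFamilyAt_isPull (constFamily_isVectorBundle hW), reassoc_of% constCoeff_eps b hW,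
    Preadditive.comp_sub, Preadditive.sub_comp,
    reassoc_of% flatBaseChange_spec _ _ _ (constFamilyMap_comp_at φ W), Category.assoc,
    constSec_flatBaseChange, Category.comp_id, Category.id_comp]

variable {i : Y ⟶ X} {F₀ : FramedBundle i W}

/-- The exact sequence `0 → E₀ ⊗ J → E₀ → i_* W → 0` of a framed bundle. -/
def FramedBundle.complex (F₀ : FramedBundle i W) (hi : IsClosedSubspace i) :
    ShortComplex (OMod X) :=
  ShortComplex.mk (tensorIdealHom i F₀.E) F₀.restr.toHom
    (tensorIdeal_shortExact hi F₀.isVectorBundle (isPull_adjEquiv F₀.framing.hom)).choose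

lemma FramedBundle.complex_shortExact (hi : IsClosedSubspace i) : (F₀.complex hi).ShortExact :=
  (tensorIdeal_shortExact hi F₀.isVectorBundle (isPull_adjEquiv F₀.framing.hom)).choose_spec

lemma Deformation.spec_isPull (D : Deformation A F₀) : D.spec.IsPull := isPull_adjEquiv D.fibre.hom

/-- The coefficients of the restriction to `Y` of the sections of a deformation. -/
def Deformation.restrCoeff (D : Deformation A F₀) (k : ι) :
    flat D.family.E ⟶ (pushforward i).obj W :=
  flatHom D.family.restr ≫ (pushforward i).map (constCoeff b hW ≫ biproduct.π _ k)

lemma Deformation.epsMap_restrCoeff (D : Deformation A F₀) (k l : ι) :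
    epsMap b D.spec_isPull D.family.isVectorBundle k ≫ D.restrCoeff b hW l =
      if k = l then F₀.restr.toHom else 0 := by
  have := epi_spec D.spec_isPull D.family.isVectorBundle
  have h1 : act (b.eps k) (constFamily A W) =
      FramedDeformations.spec (constFamilyAt A W) ≫ biproduct.ι (fun _ : ι => W) k ≫
        constEps b hW := by
    rw [constEps, epsMaps, biproduct.ι_desc, spec_epsMap]
  have h2 := flatHom_spec _ _ _ _ D.compat
  rw [← cancel_epi (FramedDeformations.spec D.spec),
    reassoc_of% spec_epsMap b D.spec_isPull D.family.isVectorBundle k, restrCoeff,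
    ← Category.assoc, act_flatHom, Category.assoc, ← Functor.map_comp, h1, Category.assoc,
    Category.assoc, reassoc_of% constEps_coeff b hW, Functor.map_comp]
  refine ((reassoc_of% h2) _).trans ?_
  split_ifs with h
  · subst h
    rw [biproduct.ι_π_self, CategoryTheory.Functor.map_id, Category.comp_id]
    rfl
  · rw [biproduct.ι_π_ne _ h, Functor.map_zero, comp_zero, comp_zero, comp_zero]

lemma Deformation.epsMaps_restrCoeff (D : Deformation A F₀) :
    epsMaps b D.spec_isPull D.family.isVectorBundle ≫ biproduct.lift (D.restrCoeff b hW) =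
      biproduct.map fun _ => F₀.restr.toHom := by
  refine biproduct.hom_ext' _ _ fun k => biproduct.hom_ext _ _ fun l => ?_
  rw [epsMaps, biproduct.ι_desc_assoc, Category.assoc, Category.assoc, biproduct.lift_π,
    D.epsMap_restrCoeff b hW, biproduct.map_π]
  split_ifs with h
  · subst h
    rw [biproduct.ι_π_self_assoc]
  · rw [biproduct.ι_π_ne_assoc _ h, zero_comp]

/-- The extension of `E₀` by a sum of copies of `E₀` given by a deformation, with the trivialization
along `Y` given by the framing. -/
def Deformation.relExt (hi : IsClosedSubspace i) (D : Deformation A F₀) :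
    RelExt (sumComplex ι (F₀.complex hi)) F₀.E where
  E := flat D.family.E
  η := epsMaps b D.spec_isPull D.family.isVectorBundle
  σ := FramedDeformations.spec D.spec
  zero := epsMaps_spec b _ _
  shortExact := thick_shortExact b _ _
  r := biproduct.lift (D.restrCoeff b hW)
  η_r := D.epsMaps_restrCoeff b hW

lemma Deformation.flatBaseChange_restrCoeff (φ : A →ₐ[ℂ] B) (D : Deformation A F₀) :
    (show flat D.family.E ⟶ flat (D.baseChange φ).family.E from
      flatBaseChange (D.family.baseChangeUnit φ)) ≫
        biproduct.lift ((D.baseChange φ).restrCoeff b' hW) =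
      biproduct.lift (D.restrCoeff b hW) ≫
        scalarMatrix (baseChangeMatrix b b' φ) ((pushforward i).obj W) := by
  refine biproduct.hom_ext _ _ fun l => ?_
  rw [Category.assoc, Category.assoc, scalarMatrix_π, biproduct.lift_π, Preadditive.comp_sum]
  simp_rw [Linear.comp_smul, biproduct.lift_π]
  have h4 := flatBaseChange_flatHom _ _ _ _ (FramedBundle.baseChange_restr φ D.family)
  refine ((reassoc_of% h4) _).trans ?_
  rw [← Functor.map_comp, ← Category.assoc (flatBaseChange _), constCoeff_flatBaseChange b b',
    Category.assoc, scalarMatrix_π, Preadditive.comp_sum, Functor.map_sum, Preadditive.comp_sum]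
  refine Finset.sum_congr rfl fun k _ => ?_
  rw [Linear.comp_smul, Functor.map_smul, Linear.comp_smul]
  rfl

/-- The extension with trivialization of a deformation is natural in the base `A`. -/
lemma Deformation.relExt_isMap (hi : IsClosedSubspace i) (φ : A →ₐ[ℂ] B) (D : Deformation A F₀) :
    RelExt.IsMap (D.relExt b hW hi) ((D.baseChange φ).relExt b' hW hi)
      (sumComplexMap (baseChangeMatrix b b' φ) (F₀.complex hi))
      (flatBaseChange (D.family.baseChangeUnit φ)) where
  η := epsMaps_flatBaseChange b b' _ (D.baseChangeFibre_spec φ) _ _ _ _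
  σ := flatBaseChange_spec _ _ _ (D.baseChangeFibre_spec φ)
  r := D.flatBaseChange_restrCoeff b b' hW φ

end Coefficients

/-! ### Maps of modules on `Spec A × X` from maps of the underlying modules -/

section PushSec

/-- Sections of a direct image `f_* M`, read as sections of `M`. -/
def pushSec (f : X ⟶ Y) (M : OMod X) (U : Opens Y.carrier) :
    Sec ((pushforward f).obj M) U ≃+ Sec M ((Opens.map f.hom.base).obj U) where
  toFun x := x
  invFun x := x
  left_inv _ := rfl
  right_inv _ := rfl
  map_add' _ _ := rfl

lemma pushSec_smul (f : X ⟶ Y) (M : OMod X) (U : Opens Y.carrier) (r : Fun Y U)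
    (x : Sec ((pushforward f).obj M) U) :
    pushSec f M U (r • x) = funPull f le_rfl r • pushSec f M U x := by
  rw [funPull_eq, funRest_self]
  rfl

end PushSec

section Linear

variable {A : Type} [CommRing A] [Algebra ℂ A] [Module.Finite ℂ A] [IsLocalRing A]
variable {ι : Type} [Fintype ι] [DecidableEq ι] (b : SqZeroBasis A ι)

/-- The map `unflat` on sections. -/
def unflatSec {N N' : OMod (thick A X)} (g : flat N ⟶ flat N')
    (hg : ∀ k, act (b.eps k) N ≫ g = g ≫ act (b.eps k) N') (U : Opens X.carrier) :
    Sec N (up A U) →ₗ[Fun (thick A X) (up A U)] Sec N' (up A U) where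
  toFun x := (toFlat N' U).symm (onSec g U (toFlat N U x))
  map_add' x y := by rw [map_add, map_add, map_add]
  map_smul' t x := by
    obtain ⟨t, rfl⟩ := thickFun_surjective U t
    rw [RingHom.id_apply, AddEquiv.symm_apply_eq, toFlat_smul b, toFlat_smul b,
      AddEquiv.apply_symm_apply, map_add, map_smul, map_sum]
    congr 1
    refine Finset.sum_congr rfl fun k _ => ?_
    rw [map_smul, ← onSec_comp, hg, onSec_comp]

/-- A map between the underlying `O_X`-modules that commutes with the basis elements of the maximal
ideal of `A` is linear over the functions on `Spec A × X`. -/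
def unflat {N N' : OMod (thick A X)} (g : flat N ⟶ flat N')
    (hg : ∀ k, act (b.eps k) N ≫ g = g ≫ act (b.eps k) N') : N ⟶ N' :=
  mkHom (fun U => unflatSec b g hg U)
    (fun {U V} h x => onSec_rest g (U := U) (V := V) h (toFlat N U x))

lemma onSec_unflat {N N' : OMod (thick A X)} (g : flat N ⟶ flat N')
    (hg : ∀ k, act (b.eps k) N ≫ g = g ≫ act (b.eps k) N') (U : Opens X.carrier)
    (x : Sec N (up A U)) :
    onSec (unflat b g hg) (up A U) x = (toFlat N' U).symm (onSec g U (toFlat N U x)) := rfl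

lemma semiHom_ext_flatHom {i : Y ⟶ X} {N : OMod (thick A X)} {M : OMod (thick A Y)}
    {c c' : SemiHom (thickHom A i) N M} (h : flatHom c = flatHom c') : c = c' := by
  refine SemiHom.ext' fun U x => ?_
  exact congrArg (fun f => onSec f (show Opens X.carrier from U) (toFlat N _ x)) h

lemma semiHom_ext_spec {N : OMod (thick A X)} {N₀ : OMod X}
    {s s' : SemiHom (thickPoint (aug A) X) N N₀} (h : spec s = spec s') : s = s' := by
  refine SemiHom.ext' fun U x => ?_
  exact congrArg (fun f => onSec f (show Opens X.carrier from U) (toFlat N _ x)) h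

/-- The map `semiOfFlat` on sections. -/
def semiOfFlatSec {i : Y ⟶ X} {N : OMod (thick A X)} {M : OMod (thick A Y)}
    (g : flat N ⟶ (pushforward i).obj (flat M)) (U : Opens X.carrier) :
    Sec N (up A U) →+ Sec M (up A ((Opens.map i.hom.base).obj U)) where
  toFun x := (toFlat M _).symm (pushSec i (flat M) U (onSec g U (toFlat N U x)))
  map_zero' := by rw [map_zero, map_zero, map_zero, map_zero]
  map_add' x y := by rw [map_add, map_add, map_add, map_add]

lemma semiOfFlatSec_smul {i : Y ⟶ X} {N : OMod (thick A X)} {M : OMod (thick A Y)}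
    (g : flat N ⟶ (pushforward i).obj (flat M))
    (hg : ∀ k, act (b.eps k) N ≫ g = g ≫ (pushforward i).map (act (b.eps k) M))
    (U : Opens X.carrier) (t : Fun (thick A X) (up A U)) (x : Sec N (up A U)) :
    semiOfFlatSec g U (t • x) = funPull (thickHom A i) (U := up A U)
      (V := up A ((Opens.map i.hom.base).obj U)) le_rfl t • semiOfFlatSec g U x := by
  obtain ⟨t, rfl⟩ := thickFun_surjective U t
  have h1 := funPull_thickHom (A := A) i (U := U) (V := (Opens.map i.hom.base).obj U)
    le_rfl le_rfl t
  refine Eq.trans ?_ (congrArg (fun r : Fun (thick A Y) (up A ((Opens.map i.hom.base).obj U)) =>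
    r • semiOfFlatSec g U x) h1.symm)
  show (toFlat M _).symm _ = _ • (toFlat M _).symm _
  rw [AddEquiv.symm_apply_eq, toFlat_smul b, toFlat_smul b, AddEquiv.apply_symm_apply, map_add,
    map_smul, map_sum, map_add, map_sum, pushSec_smul]
  congr 1
  · exact congrArg (fun r : Fun Y ((Opens.map i.hom.base).obj U) => r • _)
      (DFunLike.congr_fun (tensorEval_comm (aug A) (funPull i le_rfl)) t).symm
  · refine Finset.sum_congr rfl fun k _ => ?_
    rw [map_smul, ← onSec_comp, hg, onSec_comp, pushSec_smul, b.tcoeff_map]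
    rfl

/-- A map from `N` to the direct image of `M` that commutes with the basis elements of the maximal
ideal of `A`, as a map over `Spec A × Y → Spec A × X`. -/
def semiOfFlat {i : Y ⟶ X} {N : OMod (thick A X)} {M : OMod (thick A Y)}
    (g : flat N ⟶ (pushforward i).obj (flat M))
    (hg : ∀ k, act (b.eps k) N ≫ g = g ≫ (pushforward i).map (act (b.eps k) M)) :
    SemiHom (thickHom A i) N M where
  toFun U V h := (rest M h).comp (semiOfFlatSec g U)
  map_smul' U V h t x := by
    have h1 := funPull_rest (f := thickHom A i)
      (le_refl ((Opens.map (thickHom A i).hom.base).obj U)) (le_refl U) h h t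
    rw [funRest_self] at h1
    rw [h1]
    exact (congrArg (rest M h) (semiOfFlatSec_smul b g hg U t x)).trans (rest_smul M h _ _)
  map_rest' U V h U' V' hU hV h' x := by
    have h1 : semiOfFlatSec g U' (rest N hU x) = rest M
        (show (Opens.map (thickHom A i).hom.base).obj U' ≤ (Opens.map (thickHom A i).hom.base).obj U
          from fun y hy => hU hy) (semiOfFlatSec g U x) :=
      onSec_rest g (U := U) (V := U') hU (toFlat N U x)
    refine (congrArg (rest M h') h1).trans ?_
    exact (rest_rest M _ _ _).trans (rest_rest M _ _ _).symm

lemma flatHom_semiOfFlat {i : Y ⟶ X} {N : OMod (thick A X)} {M : OMod (thick A Y)}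
    (g : flat N ⟶ (pushforward i).obj (flat M))
    (hg : ∀ k, act (b.eps k) N ≫ g = g ≫ (pushforward i).map (act (b.eps k) M)) :
    flatHom (semiOfFlat b g hg) = g := by
  refine hom_ext' fun U x => ?_
  exact rest_self M (U := up A ((Opens.map i.hom.base).obj U)) le_rfl _

end Linear

/-! ### Deformations with isomorphic extensions -/

section Injectivity

variable {A : Type} [CommRing A] [Algebra ℂ A] [Module.Finite ℂ A] [IsLocalRing A]
variable {ι : Type} [Fintype ι] [DecidableEq ι] (b : SqZeroBasis A ι)
variable {W : OMod Y} (hW : IsVectorBundle W) {i : Y ⟶ X} {F₀ : FramedBundle i W}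

lemma spec_const_add_coeff_eps : FramedDeformations.spec (constFamilyAt A W) ≫ constSec A W +
    ∑ k, (constCoeff b hW ≫ biproduct.π _ k) ≫ epsMap b constFamilyAt_isPull
      (constFamily_isVectorBundle hW) k = 𝟙 _ := by
  have h : ∑ k, (constCoeff b hW ≫ biproduct.π _ k) ≫ epsMap b constFamilyAt_isPull
      (constFamily_isVectorBundle hW) k = constCoeff b hW ≫ constEps b hW := by
    conv_rhs => rw [← Category.id_comp (constEps b hW), ← biproduct.total, Preadditive.sum_comp,
      Preadditive.comp_sum]
    refine Finset.sum_congr rfl fun k _ => ?_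
    rw [constEps, epsMaps, Category.assoc, Category.assoc, biproduct.ι_desc]
  rw [h, constCoeff_eps, add_sub_cancel]

/-- A map to the direct image of `p^* W` is determined by its part on the closed fibre and its
coefficients. -/
lemma hom_ext_constFamily {T : OMod X} {g g' : T ⟶ (pushforward i).obj (flat (constFamily A W))}
    (h : g ≫ (pushforward i).map (FramedDeformations.spec (constFamilyAt A W)) =
      g' ≫ (pushforward i).map (FramedDeformations.spec (constFamilyAt A W)))
    (h' : ∀ k, g ≫ (pushforward i).map (constCoeff b hW ≫ biproduct.π _ k) =
      g' ≫ (pushforward i).map (constCoeff b hW ≫ biproduct.π _ k)) : g = g' := by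
  rw [← Category.comp_id g, ← Category.comp_id g', ← CategoryTheory.Functor.map_id,
    ← spec_const_add_coeff_eps b hW, Functor.map_add, Functor.map_comp, Functor.map_sum]
  simp_rw [Functor.map_comp _ (constCoeff b hW ≫ _)]
  rw [Preadditive.comp_add, Preadditive.comp_add, Preadditive.comp_sum, Preadditive.comp_sum,
    ← Category.assoc, h, Category.assoc]
  congr 1
  refine Finset.sum_congr rfl fun k _ => ?_
  rw [← Category.assoc, h', Category.assoc]

lemma flatHom_pre {N N' : OMod (thick A X)} {M : OMod (thick A Y)} (f : N ⟶ N')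
    (g : flat N ⟶ flat N') (hg : g = (pushforward (thickProj A X)).map f)
    (c : SemiHom (thickHom A i) N' M) : flatHom (c.pre f) = g ≫ flatHom c := by
  subst hg
  rfl

lemma spec_pre {N N' : OMod (thick A X)} {N₀ : OMod X} (f : N ⟶ N')
    (g : flat N ⟶ flat N') (hg : g = (pushforward (thickProj A X)).map f)
    (s : SemiHom (thickPoint (aug A) X) N' N₀) :
    FramedDeformations.spec (s.pre f) = g ≫ FramedDeformations.spec s := by
  subst hg
  rfl

lemma pushforward_map_unflat {N N' : OMod (thick A X)} (g : flat N ⟶ flat N')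
    (hg : ∀ k, act (b.eps k) N ≫ g = g ≫ act (b.eps k) N') :
    g = (pushforward (thickProj A X)).map (unflat b g hg) := rfl

/-- Every open subset of `Spec A × X` is of the form `up A U`. -/
lemma hom_ext_up {N N' : OMod (thick A X)} {f f' : N ⟶ N'}
    (h : ∀ (U : Opens X.carrier) (x : Sec N (up A U)), onSec f (up A U) x = onSec f' (up A U) x) :
    f = f' := hom_ext' h

/-- An isomorphism between the underlying `O_X`-modules that commutes with the basis elements of the
maximal ideal of `A`, as an isomorphism of modules on `Spec A × X`. -/
def unflatIso {N N' : OMod (thick A X)} (g : flat N ≅ flat N')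
    (hg : ∀ k, act (b.eps k) N ≫ g.hom = g.hom ≫ act (b.eps k) N') : N ≅ N' where
  hom := unflat b g.hom hg
  inv := unflat b g.inv fun k => by
    rw [Iso.eq_inv_comp, ← Category.assoc, ← hg, Category.assoc, Iso.hom_inv_id, Category.comp_id]
  hom_inv_id := hom_ext_up fun U x => by
    rw [onSec_comp, onSec_unflat, onSec_unflat, AddEquiv.apply_symm_apply, ← onSec_comp,
      g.hom_inv_id, onSec_id, onSec_id, AddEquiv.symm_apply_apply]
  inv_hom_id := hom_ext_up fun U x => by
    rw [onSec_comp, onSec_unflat, onSec_unflat, AddEquiv.apply_symm_apply, ← onSec_comp,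
      g.inv_hom_id, onSec_id, onSec_id, AddEquiv.symm_apply_apply]

lemma Deformation.act_eps (D : Deformation A F₀) (k : ι) :
    act (b.eps k) D.family.E = FramedDeformations.spec D.spec ≫
      biproduct.ι (fun _ : ι => F₀.E) k ≫ epsMaps b D.spec_isPull D.family.isVectorBundle := by
  rw [epsMaps, biproduct.ι_desc, spec_epsMap]

/-- Two deformations with isomorphic extensions are isomorphic: since the basis elements of the
maximal ideal act through `E → E₀ → ⨁ E₀ → E`, an isomorphism of extensions is linear
over `Spec A × X`. -/
lemma Deformation.iso_of_relExt (hi : IsClosedSubspace i) {D D' : Deformation A F₀}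
    (g : flat D.family.E ≅ flat D'.family.E)
    (hg : RelExt.IsMap (D.relExt b hW hi) (D'.relExt b hW hi) (𝟙 _) g.hom) : D.Iso D' := by
  have hη : epsMaps b D.spec_isPull D.family.isVectorBundle ≫ g.hom =
      epsMaps b D'.spec_isPull D'.family.isVectorBundle :=
    hg.η.trans (Category.id_comp _)
  have hσ : g.hom ≫ FramedDeformations.spec D'.spec = FramedDeformations.spec D.spec := hg.σ
  have hr : g.hom ≫ biproduct.lift (D'.restrCoeff b hW) = biproduct.lift (D.restrCoeff b hW) :=
    hg.r.trans (Category.comp_id _)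
  have hact : ∀ k, act (b.eps k) D.family.E ≫ g.hom = g.hom ≫ act (b.eps k) D'.family.E := by
    intro k
    rw [D.act_eps b, D'.act_eps b, Category.assoc, Category.assoc, hη, ← hσ, Category.assoc]
  rw [Deformation.iso_iff]
  refine ⟨unflatIso b g hact, ?_, ?_⟩
  · refine semiHom_ext_flatHom ?_
    rw [show (unflatIso b g hact).hom = unflat b g.hom hact from rfl,
      flatHom_pre _ g.hom (pushforward_map_unflat b g.hom hact)]
    refine hom_ext_constFamily b hW ?_ fun k => ?_
    · have h1 := flatHom_spec _ _ _ _ D.compat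
      have h2 := flatHom_spec _ _ _ _ D'.compat
      rw [Category.assoc, h1, h2]
      exact (reassoc_of% hσ) _
    · have h3 := congrArg (fun f => f ≫ biproduct.π _ k) hr
      simp only [Category.assoc, biproduct.lift_π] at h3
      rw [Category.assoc]
      exact h3
  · refine semiHom_ext_spec ?_
    rw [show (unflatIso b g hact).hom = unflat b g.hom hact from rfl,
      spec_pre _ g.hom (pushforward_map_unflat b g.hom hact)]
    exact hσ

end Injectivity

section BasisCriteria

lemma IsBasisOn.restrict {M : OMod X} {U V : Opens X.carrier} {n : ℕ} {e : Fin n → Sec M U}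
    (he : IsBasisOn e) (h : V ≤ U) : IsBasisOn fun j => rest M h (e j) := by
  intro T hT
  simp_rw [rest_rest]
  exact he T (hT.trans h)

/-- A morphism that maps local bases to local bases is an isomorphism. -/
lemma isIso_of_isBasisOn {M N : OMod X} (g : M ⟶ N)
    (h : ∀ p : X.carrier, ∃ U : Opens X.carrier, p ∈ U ∧ ∃ (n : ℕ) (e : Fin n → Sec M U),
      IsBasisOn e ∧ IsBasisOn fun j => onSec g U (e j)) : IsIso g := by
  refine isIso_of_locally_bijective g fun p => ?_
  obtain ⟨U, hpU, n, e, he, he'⟩ := h p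
  refine ⟨U, hpU, fun V hV => ?_⟩
  rw [← Function.Bijective.of_comp_iff _ (he V hV)]
  convert he' V hV using 2 with c
  simp only [Function.comp_apply, map_sum, map_smul, onSec_rest]

lemma SemiHom.isPull_of_isBasisOn {f : X ⟶ Y} {M : OMod Y} {N : OMod X} (a : SemiHom f M N)
    (h : ∀ p : X.carrier, ∃ (U : Opens Y.carrier) (V : Opens X.carrier)
      (hV : V ≤ (Opens.map f.hom.base).obj U), p ∈ V ∧ ∃ (n : ℕ) (e : Fin n → Sec M U),
        IsBasisOn e ∧ IsBasisOn fun j => a.toFun U V hV (e j)) : a.IsPull := by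
  refine isIso_of_isBasisOn _ fun p => ?_
  obtain ⟨U, V, hV, hpV, n, e, he, he'⟩ := h p
  refine ⟨V, hpV, n, _, (unitSemi_isPull f M).isBasisOn he hV, ?_⟩
  have h1 : (unitSemi f M).post ((adjEquiv f M N).symm a) = a := by
    rw [unitSemi, ← adjEquiv_post, Category.id_comp, Equiv.apply_symm_apply]
  convert he' using 2 with j
  exact congrArg (fun s => s.toFun U V hV (e j)) h1

variable {A : Type} [CommRing A] [Algebra ℂ A] [Module.Finite ℂ A] [IsLocalRing A]
variable {ι : Type} [Fintype ι] [DecidableEq ι] (b : SqZeroBasis A ι)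

/-- Sections of a module on `Spec A × X` that is an extension of `N₀` by copies of `N₀`, embedded as
the multiples of the basis elements of the maximal ideal of `A`, form a basis if their images in
`N₀` do. -/
lemma isBasisOn_of_shortExact {N : OMod (thick A X)} {N₀ : OMod X}
    {η : (⨁ fun _ : ι => N₀) ⟶ flat N} {σ : flat N ⟶ N₀} {w : η ≫ σ = 0}
    (hS : (ShortComplex.mk η σ w).ShortExact)
    (hact : ∀ k, act (b.eps k) N = σ ≫ biproduct.ι (fun _ : ι => N₀) k ≫ η) {U : Opens X.carrier}
    {n : ℕ} (x : Fin n → Sec N (up A U))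
    (hx : IsBasisOn fun j => onSec σ U (toFlat N U (x j))) : IsBasisOn x := by
  suffices h : ∀ (V : Opens X.carrier) (hV : V ≤ U), Function.Bijective
      (fun c : Fin n → Fun (thick A X) (up A V) => ∑ j, c j • rest N (up_le hV) (x j)) from
    fun V hV => h V hV
  intro V hV
  have := hS.mono_f
  have hη : Function.Injective (onSec η V) := onSec_injective_of_mono (ShortComplex.mk η σ w).f V
  let y : Fin n → Sec (flat N) V := fun j => rest (flat N) hV (toFlat N U (x j))
  have hy : ∀ j, onSec σ V (y j) = rest N₀ hV (onSec σ U (toFlat N U (x j))) := fun j =>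
    onSec_rest σ hV _
  -- a linear combination splits into its part on the closed fibre and its coefficients
  have key : ∀ t : Fin n → A ⊗[ℂ] Fun X V,
      toFlat N V (∑ j, thickFun A V (t j) • rest N (up_le hV) (x j)) =
        ∑ j, tensorEval (aug A) _ (t j) • y j + onSec η V (∑ k, onSec (biproduct.ι _ k) V
          (∑ j, b.tcoeff _ k (t j) • onSec σ V (y j))) := by
    intro t
    rw [map_sum]
    simp_rw [toFlat_smul b, Finset.sum_add_distrib]
    congr 1
    rw [Finset.sum_comm, map_sum]
    refine Finset.sum_congr rfl fun k _ => ?_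
    rw [map_sum, map_sum]
    refine Finset.sum_congr rfl fun j _ => ?_
    rw [map_smul, map_smul, hact, onSec_comp, onSec_comp]
    rfl
  have hση : ∀ z, onSec σ V (onSec η V z) = 0 := fun z => by
    rw [← onSec_comp, w, onSec_zero]
  constructor
  · refine (injective_iff_map_eq_zero (AddMonoidHom.mk' (fun c : Fin n → Fun (thick A X) (up A V) =>
      ∑ j, c j • rest N (up_le hV) (x j))
        (fun c c' => by simp [add_smul, Finset.sum_add_distrib]))).2 fun c hc => ?_
    choose t ht using fun j => thickFun_surjective V (c j)
    obtain rfl : c = fun j => thickFun A V (t j) := funext fun j => (ht j).symm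
    have hc' := key t
    have hc0 : ∑ j, thickFun A V (t j) • rest N (up_le hV) (x j) = 0 := hc
    rw [hc0, map_zero] at hc'
    have h1 : ∀ j, tensorEval (aug A) _ (t j) = 0 := by
      refine hx.eq_zero hV ?_
      have h2 := congrArg (onSec σ V) hc'
      rw [map_zero, map_add, hση, add_zero, map_sum] at h2
      rw [h2]
      refine Finset.sum_congr rfl fun j _ => ?_
      rw [map_smul, hy]
    simp_rw [h1, zero_smul, Finset.sum_const_zero, zero_add] at hc'
    have h3 := hη (hc'.symm.trans (map_zero _).symm)
    have h4 : ∀ k j, b.tcoeff _ k (t j) = 0 := by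
      intro k
      refine hx.eq_zero hV ?_
      have h5 := congrArg (onSec (biproduct.π _ k) V) h3
      rw [map_sum, Finset.sum_eq_single k, ← onSec_comp, biproduct.ι_π_self, onSec_id, map_zero]
        at h5
      · rw [← h5]
        refine Finset.sum_congr rfl fun j _ => ?_
        rw [hy]
      · intro l _ hl
        rw [← onSec_comp, biproduct.ι_π_ne _ hl, onSec_zero]
      · simp
    funext j
    rw [b.tdecomp (t j), h1]
    simp [h4]
  · intro z
    let z' := toFlat N V z
    let a := hx.coord hV (onSec σ V z')
    have ha : ∑ j, a j • onSec σ V (y j) = onSec σ V z' := by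
      simp_rw [hy]
      exact hx.sum_coord hV _
    obtain ⟨v, hv⟩ := exists_onSec_of_exact hS.exact (z' - ∑ j, a j • y j) (by
      show onSec σ V _ = 0
      rw [map_sub, map_sum, ← ha]
      simp_rw [map_smul]
      exact sub_self _)
    replace hv : onSec η V v = z' - ∑ j, a j • y j := hv
    let c : ι → Fin n → Fun X V := fun k => hx.coord hV (onSec (biproduct.π _ k) V v)
    have hc : ∀ k, ∑ j, c k j • onSec σ V (y j) = onSec (biproduct.π _ k) V v := fun k => by
      simp_rw [hy]
      exact hx.sum_coord hV _
    let t : Fin n → A ⊗[ℂ] Fun X V := fun j => 1 ⊗ₜ a j + ∑ k, b.eps k ⊗ₜ c k j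
    refine ⟨fun j => thickFun A V (t j), (toFlat N V).injective ?_⟩
    refine (key t).trans ?_
    have h1 : ∀ j, tensorEval (aug A) _ (t j) = a j := fun j => by
      simp [t, tensorEval_tmul, b.aug_eps]
    have h2 : ∀ k j, b.tcoeff _ k (t j) = c k j := fun k j => by
      rw [map_add, b.tcoeff_one_tmul, zero_add, b.tcoeff_sum_eps]
    simp_rw [h1, h2, hc]
    rw [sum_biproduct_sec, hv, add_sub_cancel]

end BasisCriteria

/-! ### Modules on `Spec A × X` from endomorphisms -/

section ThickModule

variable {A : Type} [CommRing A] [Algebra ℂ A] [Module.Finite ℂ A] [IsLocalRing A]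
variable {ι : Type} [Fintype ι] [DecidableEq ι] (b : SqZeroBasis A ι)
variable {E : OMod X} (e : ι → (E ⟶ E)) (he : ∀ k l, e k ≫ e l = 0)

/-- The action of `A ⊗ Γ(U, O_X)` on the sections of an `O_X`-module `E` for which the basis
elements of the maximal ideal of `A` act by endomorphisms `e k`. It is associative if the products
of the `e k` vanish. -/
def thickSMul (U : Opens X.carrier) (t : A ⊗[ℂ] Fun X U) (x : Sec E U) : Sec E U :=
  tensorEval (aug A) (Fun X U) t • x + ∑ k, b.tcoeff (Fun X U) k t • onSec (e k) U x

lemma thickSMul_rest {U V : Opens X.carrier} (h : V ≤ U) (t : A ⊗[ℂ] Fun X U) (x : Sec E U) :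
    rest E h (thickSMul b e U t x) = thickSMul b e V
      (Algebra.TensorProduct.map (AlgHom.id ℂ A) (funRest h) t) (rest E h x) := by
  rw [thickSMul, thickSMul, map_add, rest_smul, map_sum]
  congr 1
  · exact congrArg (fun r : Fun X V => r • rest E h x)
      (DFunLike.congr_fun (tensorEval_comm (aug A) (funRest h)) t).symm
  · refine Finset.sum_congr rfl fun k _ => ?_
    rw [rest_smul, onSec_rest, b.tcoeff_map]

/-- The module structure given by `thickSMul`. -/
@[reducible]
def thickModule (U : Opens X.carrier) : Module (A ⊗[ℂ] Fun X U) (Sec E U) where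
  smul := thickSMul b e U
  one_smul x := by
    show thickSMul b e U 1 x = x
    rw [thickSMul, map_one, one_smul, Algebra.TensorProduct.one_def]
    simp [b.tcoeff_one_tmul]
  mul_smul t t' x := by
    show thickSMul b e U (t * t') x = thickSMul b e U t (thickSMul b e U t' x)
    have h : ∀ k, onSec (e k) U (thickSMul b e U t' x) =
        tensorEval (aug A) _ t' • onSec (e k) U x := by
      intro k
      rw [thickSMul, map_add, map_smul, map_sum, Finset.sum_eq_zero, add_zero]
      intro l _
      rw [map_smul, ← onSec_comp, he, onSec_zero, smul_zero]
    rw [thickSMul, thickSMul]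
    simp_rw [h, map_mul, b.tcoeff_mul, add_smul, Finset.sum_add_distrib]
    rw [thickSMul, smul_add, mul_smul, Finset.smul_sum]
    simp_rw [mul_smul, smul_smul]
    rw [add_assoc]
    congr 2
    refine Finset.sum_congr rfl fun k _ => ?_
    rw [mul_comm]
  smul_zero t := by
    show thickSMul b e U t 0 = 0
    simp [thickSMul]
  smul_add t x y := by
    show thickSMul b e U t (x + y) = thickSMul b e U t x + thickSMul b e U t y
    simp only [thickSMul, map_add, smul_add, Finset.sum_add_distrib]
    abel
  add_smul t t' x := by
    show thickSMul b e U (t + t') x = thickSMul b e U t x + thickSMul b e U t' x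
    simp only [thickSMul, map_add, add_smul, Finset.sum_add_distrib]
    abel
  zero_smul x := by
    show thickSMul b e U 0 x = 0
    simp [thickSMul]

/-- The module on `Spec A × X` given by an `O_X`-module `E` and endomorphisms `e k` by which the
basis elements of the maximal ideal of `A` act. -/
def thickMod : OMod (thick A X) where
  val :=
    letI (U : (Opens (thick A X).carrier)ᵒᵖ) :
        Module ((ringSheaf (thick A X)).obj.obj U) (E.val.presheaf.obj U) :=
      thickModule b e he U.unop
    PresheafOfModules.ofPresheaf (R := (ringSheaf (thick A X)).obj) E.val.presheaf
      (fun {U V} f t x => thickSMul_rest b e (U := U.unop) (V := V.unop) f.unop.le t x)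
  isSheaf := E.isSheaf

/-- Sections of `E` as sections of `thickMod`. -/
def toThick (U : Opens X.carrier) : Sec E U ≃+ Sec (thickMod b e he) (up A U) where
  toFun x := x
  invFun x := x
  left_inv _ := rfl
  right_inv _ := rfl
  map_add' _ _ := rfl

lemma smul_toThick (U : Opens X.carrier) (t : A ⊗[ℂ] Fun X U) (x : Sec E U) :
    thickFun A U t • toThick b e he U x = toThick b e he U (thickSMul b e U t x) := rfl

/-- The `O_X`-module underlying `thickMod` is `E`. -/
def flatThickMod : E ≅ flat (thickMod b e he) :=
  have h (U : Opens X.carrier) (r : Fun X U) (x : Sec E U) :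
      toFlat _ U (toThick b e he U (r • x)) = r • toFlat _ U (toThick b e he U x) := by
    rw [smul_toFlat, smul_toThick, thickSMul]
    simp [tensorEval_tmul, b.tcoeff_one_tmul]
  { hom := mkHom (fun U =>
      { toFun := fun x => toFlat _ U (toThick b e he U x)
        map_add' := fun x y => by rw [map_add, map_add]
        map_smul' := h U }) (fun _ _ => rfl)
    inv := mkHom (fun U =>
      { toFun := fun x => (toThick b e he U).symm ((toFlat _ U).symm x)
        map_add' := fun x y => by rw [map_add, map_add]
        map_smul' := fun r x => by
          obtain ⟨x, rfl⟩ := toFlat_surjective _ U x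
          obtain ⟨x, rfl⟩ := (toThick b e he U).surjective x
          rw [← h, AddEquiv.symm_apply_apply, AddEquiv.symm_apply_apply,
            AddEquiv.symm_apply_apply, AddEquiv.symm_apply_apply]
          rfl }) (fun _ _ => rfl)
    hom_inv_id := rfl
    inv_hom_id := rfl }

lemma act_thickMod (k : ι) : act (b.eps k) (thickMod b e he) =
    (flatThickMod b e he).inv ≫ e k ≫ (flatThickMod b e he).hom := by
  rw [Iso.eq_inv_comp]
  refine hom_ext' fun U x => ?_
  have h1 : onSec (act (b.eps k) (thickMod b e he)) U (toFlat _ U (toThick b e he U x)) =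
      toFlat _ U (toThick b e he U (onSec (e k) U x)) := by
    rw [onSec_act, smul_toThick, thickSMul]
    simp [tensorEval_tmul, b.aug_eps, b.tcoeff_tmul, b.coeff_eps]
  exact h1

end ThickModule

/-! ### Local bases of extensions -/

section Construction

variable {A : Type} [CommRing A] [Algebra ℂ A] [Module.Finite ℂ A] [IsLocalRing A]
variable {ι : Type} [Fintype ι] [DecidableEq ι] (b : SqZeroBasis A ι)

/-- A map of `O_X`-modules that vanishes on the multiples of the basis elements of the maximal
ideal, as a map over the inclusion of the closed fibre. -/
def specOfFlat {N : OMod (thick A X)} {N₀ : OMod X} (σ : flat N ⟶ N₀)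
    (hσ : ∀ k, act (b.eps k) N ≫ σ = 0) : SemiHom (thickPoint (aug A) X) N N₀ where
  toFun U V h := (rest N₀ h).comp
    ((onSec σ (show Opens X.carrier from U)).toAddMonoidHom.comp
      (toFlat N (show Opens X.carrier from U)).toAddMonoidHom)
  map_smul' U V h t x := by
    have key : ∀ (U : Opens X.carrier) (V : Opens X.carrier) (h : V ≤ U) (t : A ⊗[ℂ] Fun X U)
        (x : Sec N (up A U)), rest N₀ h (onSec σ U (toFlat N U (thickFun A U t • x))) =
          funRest h (tensorEval (aug A) (Fun X U) t) • rest N₀ h (onSec σ U (toFlat N U x)) := by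
      intro U V h t x
      rw [toFlat_smul b, map_add, map_sum, Finset.sum_eq_zero, add_zero, map_smul, rest_smul]
      intro k _
      rw [map_smul, ← onSec_comp, hσ, onSec_zero, smul_zero]
    exact key U V h t x
  map_rest' U V h U' V' hU hV h' x := by
    have key : ∀ (U V U' V' : Opens X.carrier) (h : V ≤ U) (hU : U' ≤ U) (hV : V' ≤ V)
        (h' : V' ≤ U') (x : Sec (flat N) U), rest N₀ h' (onSec σ U' (rest (flat N) hU x)) =
          rest N₀ hV (rest N₀ h (onSec σ U x)) := by
      intro U V U' V' h hU hV h' x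
      rw [onSec_rest, rest_rest, rest_rest]
    exact key U V U' V' h hU hV h' (toFlat N U x)

lemma spec_specOfFlat {N : OMod (thick A X)} {N₀ : OMod X} (σ : flat N ⟶ N₀)
    (hσ : ∀ k, act (b.eps k) N ≫ σ = 0) : spec (specOfFlat b σ hσ) = σ := by
  refine hom_ext' fun U x => ?_
  exact rest_self N₀ (le_refl U) _

/-- Local bases of `N₀` lift to local bases of an extension of `N₀` by copies of `N₀`. -/
lemma exists_basis_lift {N : OMod (thick A X)} {N₀ : OMod X} {η : (⨁ fun _ : ι => N₀) ⟶ flat N}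
    {σ : flat N ⟶ N₀} {w : η ≫ σ = 0} (hS : (ShortComplex.mk η σ w).ShortExact)
    (hact : ∀ k, act (b.eps k) N = σ ≫ biproduct.ι (fun _ : ι => N₀) k ≫ η)
    (hN₀ : IsVectorBundle N₀) (p : X.carrier) :
    ∃ U : Opens X.carrier, p ∈ U ∧ ∃ (n : ℕ) (x : Fin n → Sec N (up A U)),
      IsBasisOn x ∧ IsBasisOn fun j => onSec σ U (toFlat N U (x j)) := by
  have := hS.epi_g
  obtain ⟨U, hpU, n, e, he⟩ := hN₀ p
  choose V hV hpV x hx using fun j =>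
    locSurj_of_epi (ShortComplex.mk η σ w).g U (e j) p hpU
  let O : Opens X.carrier := U ⊓ Finset.univ.inf V
  have hO : ∀ j, O ≤ V j := fun j => inf_le_right.trans (Finset.inf_le (Finset.mem_univ j))
  have hpO : p ∈ O := ⟨hpU, mem_univ_inf hpV⟩
  have hy : ∀ j, onSec σ O (rest (flat N) (hO j) (x j)) = rest N₀ inf_le_left (e j) := fun j => by
    rw [onSec_rest]
    refine (congrArg _ (hx j)).trans ?_
    exact rest_rest N₀ _ _ _
  have hb : IsBasisOn fun j => onSec σ O (toFlat N O ((toFlat N O).symm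
      (rest (flat N) (hO j) (x j)))) := by
    simp_rw [AddEquiv.apply_symm_apply, hy]
    exact he.restrict inf_le_left
  exact ⟨O, hpO, n, _, isBasisOn_of_shortExact b hS hact _ hb, hb⟩

end Construction

/-! ### Deformations from extensions -/

section Construction

variable {A : Type} [CommRing A] [Algebra ℂ A] [Module.Finite ℂ A] [IsLocalRing A]
variable {ι : Type} [Fintype ι] [DecidableEq ι] (b : SqZeroBasis A ι)
variable {W : OMod Y} (hW : IsVectorBundle W) {i : Y ⟶ X}

lemma comp_restr_eq_of_flatHom {N : OMod (thick A X)} {M : OMod (thick A Y)} {N₀ : OMod X}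
    {M₀ : OMod Y} (c : SemiHom (thickHom A i) N M) (s : SemiHom (thickPoint (aug A) X) N N₀)
    (s' : SemiHom (thickPoint (aug A) Y) M M₀) (c₀ : SemiHom i N₀ M₀)
    (h : flatHom c ≫ (pushforward i).map (spec s') = spec s ≫ c₀.toHom) :
    s.comp rfl c₀ = c.comp (thickPoint_comp_hom (aug A) i) s' := by
  refine SemiHom.ext' fun U x => ?_
  exact (congrArg (fun f => onSec f (show Opens X.carrier from U) (toFlat N _ x)) h).symm

variable {N : OMod (thick A X)} {F₀ : FramedBundle i W}
    {η : (⨁ fun _ : ι => F₀.E) ⟶ flat N}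
    {σ : flat N ⟶ F₀.E} {w : η ≫ σ = 0} (r : ι → (flat N ⟶ (pushforward i).obj W))

variable (σ) in
/-- The map to the direct image of `p^* W` with given part on the closed fibre and given
coefficients. -/
def framingOfCoeff : flat N ⟶ (pushforward i).obj (flat (constFamily A W)) :=
  σ ≫ F₀.restr.toHom ≫ (pushforward i).map (constSec A W) +
    ∑ k, r k ≫ (pushforward i).map
      (epsMap b constFamilyAt_isPull (constFamily_isVectorBundle hW) k)

lemma framingOfCoeff_spec : framingOfCoeff b hW σ r ≫
    (pushforward i).map (spec (constFamilyAt A W)) = σ ≫ F₀.restr.toHom := by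
  rw [framingOfCoeff, Preadditive.add_comp, Preadditive.sum_comp, Finset.sum_eq_zero, add_zero,
    Category.assoc, Category.assoc, ← Functor.map_comp, constSec_spec,
    CategoryTheory.Functor.map_id, Category.comp_id]
  intro k _
  rw [Category.assoc, ← Functor.map_comp, epsMap_spec, Functor.map_zero, comp_zero]

lemma epsMap_constCoeff (k l : ι) :
    epsMap b constFamilyAt_isPull (constFamily_isVectorBundle hW) k ≫ constCoeff b hW ≫
      biproduct.π _ l = if k = l then 𝟙 W else 0 := by
  have h : epsMap b constFamilyAt_isPull (constFamily_isVectorBundle hW) k =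
      biproduct.ι _ k ≫ constEps b hW := by
    rw [constEps, epsMaps, biproduct.ι_desc]
  rw [h, Category.assoc, reassoc_of% constEps_coeff b hW]
  split_ifs with hkl
  · subst hkl
    exact biproduct.ι_π_self _ _
  · exact biproduct.ι_π_ne _ hkl

lemma framingOfCoeff_coeff (l : ι) : framingOfCoeff b hW σ r ≫
    (pushforward i).map (constCoeff b hW ≫ biproduct.π _ l) = r l := by
  rw [framingOfCoeff, Preadditive.add_comp, Preadditive.sum_comp, Finset.sum_eq_single l,
    Category.assoc, Category.assoc, ← Functor.map_comp, ← Category.assoc (constSec A W),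
    constSec_coeff, zero_comp, Functor.map_zero, comp_zero, comp_zero, zero_add, Category.assoc,
    ← Functor.map_comp, epsMap_constCoeff, if_pos rfl, CategoryTheory.Functor.map_id,
    Category.comp_id]
  · intro k _ hk
    rw [Category.assoc, ← Functor.map_comp, epsMap_constCoeff, if_neg hk, Functor.map_zero,
      comp_zero]
  · simp

include w in
lemma act_framingOfCoeff
    (hact : ∀ k, act (b.eps k) N = σ ≫ biproduct.ι (fun _ : ι => F₀.E) k ≫ η)
    (hr : ∀ k l, (biproduct.ι (fun _ : ι => F₀.E) k ≫ η) ≫ r l =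
      if k = l then F₀.restr.toHom else 0) (k : ι) :
    act (b.eps k) N ≫ framingOfCoeff b hW σ r =
      framingOfCoeff b hW σ r ≫ (pushforward i).map (act (b.eps k) (constFamily A W)) := by
  have h1 : (biproduct.ι (fun _ : ι => F₀.E) k ≫ η) ≫ framingOfCoeff b hW σ r =
      F₀.restr.toHom ≫ (pushforward i).map
        (epsMap b constFamilyAt_isPull (constFamily_isVectorBundle hW) k) := by
    rw [framingOfCoeff, Preadditive.comp_add, Preadditive.comp_sum, Category.assoc,
      ← Category.assoc η, w, zero_comp, comp_zero, zero_add, Finset.sum_eq_single k]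
    · rw [← Category.assoc, hr, if_pos rfl]
    · intro l _ hl
      rw [← Category.assoc, hr, if_neg hl.symm, zero_comp]
    · simp
  rw [hact, Category.assoc, h1, ← spec_epsMap b constFamilyAt_isPull
    (constFamily_isVectorBundle hW) k, Functor.map_comp, ← Category.assoc (framingOfCoeff b hW σ r),
    framingOfCoeff_spec, Category.assoc]

/-- A module `N` on `Spec A × X` that is an extension of `E₀` by copies of `E₀`, and coefficients
for a framing, define a deformation. -/
lemma exists_deformation_of_coeff (hS : (ShortComplex.mk η σ w).ShortExact)
    (hact : ∀ k, act (b.eps k) N = σ ≫ biproduct.ι (fun _ : ι => F₀.E) k ≫ η)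
    (hr : ∀ k l, (biproduct.ι (fun _ : ι => F₀.E) k ≫ η) ≫ r l =
      if k = l then F₀.restr.toHom else 0) :
    ∃ (D : Deformation A F₀) (g : flat N ⟶ flat D.family.E),
      η ≫ g = epsMaps b D.spec_isPull D.family.isVectorBundle ∧
      g ≫ spec D.spec = σ ∧ ∀ k, g ≫ D.restrCoeff b hW k = r k := by
  have hσ (k : ι) : act (b.eps k) N ≫ σ = 0 := by
    rw [hact, Category.assoc, Category.assoc, w, comp_zero, comp_zero]
  let s : SemiHom (thickPoint (aug A) X) N F₀.E := specOfFlat b σ hσ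
  let c : SemiHom (thickHom A i) N (constFamily A W) :=
    semiOfFlat b (framingOfCoeff b hW σ r) (act_framingOfCoeff b hW r (w := w) hact hr)
  have hlift := exists_basis_lift b hS hact F₀.isVectorBundle
  have hsσ (U : Opens X.carrier) (x : Sec N (up A U)) :
      s.toFun (up A U) U le_rfl x = onSec σ U (toFlat N U x) := rest_self F₀.E (le_refl U) _
  have hs : s.IsPull := s.isPull_of_isBasisOn fun p => by
    obtain ⟨U, hpU, n, x, hx, hx'⟩ := hlift p
    refine ⟨up A U, U, le_rfl, hpU, n, x, hx, ?_⟩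
    simp_rw [hsσ]
    exact hx'
  have hcs : s.comp rfl F₀.restr = c.comp (thickPoint_comp_hom (aug A) i) (constFamilyAt A W) := by
    refine comp_restr_eq_of_flatHom _ _ _ _ ?_
    rw [flatHom_semiOfFlat, spec_specOfFlat, framingOfCoeff_spec]
  -- the framing maps local bases to local bases, since it does so on the closed fibre
  have hc : c.IsPull := c.isPull_of_isBasisOn fun p => by
    obtain ⟨U, hpU, n, x, hx, hx'⟩ := hlift (i.hom.base p)
    refine ⟨up A U, up A ((Opens.map i.hom.base).obj U), le_rfl, hpU, n, x, hx, ?_⟩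
    refine isBasisOn_of_shortExact b (constEps_shortExact b hW) (fun k => ?_) _ ?_
    · rw [constEps, epsMaps, biproduct.ι_desc, spec_epsMap]
    · have h0 : SemiHom.IsPull F₀.restr := isPull_adjEquiv F₀.framing.hom
      have h1 := h0.isBasisOn hx' (le_refl ((Opens.map i.hom.base).obj U))
      convert h1 using 2 with j
      have h2 := congrArg (fun t => t.toFun (up A U) ((Opens.map i.hom.base).obj U) le_rfl (x j))
        hcs.symm
      refine h2.trans ?_
      exact congrArg (F₀.restr.toFun U ((Opens.map i.hom.base).obj U) le_rfl) (hsσ U (x j))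
  have hN : IsVectorBundle N := fun (p : X.carrier) => by
    obtain ⟨U, hpU, n, x, hx, -⟩ := hlift p
    exact ⟨up A U, hpU, n, x, hx⟩
  have h1 : adjEquiv _ _ _ hs.iso.hom = s := hs.adjEquiv_iso
  have h2 : adjEquiv _ _ _ hc.iso.hom = c := hc.adjEquiv_iso
  let D : Deformation A F₀ :=
    { family := { E := N, isVectorBundle := hN, framing := hc.iso }
      fibre := hs.iso
      compat := (congrArg (fun t : SemiHom (thickPoint (aug A) X) N F₀.E =>
        t.comp rfl F₀.restr) h1).trans (hcs.trans (congrArg (fun t : SemiHom (thickHom A i) N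
          (constFamily A W) =>
            t.comp (thickPoint_comp_hom (aug A) i) (constFamilyAt A W)) h2.symm)) }
  have hDs : spec D.spec = σ :=
    (congrArg (fun t : SemiHom (thickPoint (aug A) X) N F₀.E => spec t) h1).trans
      (spec_specOfFlat b σ hσ)
  have hDc : flatHom D.family.restr = framingOfCoeff b hW σ r :=
    (congrArg (fun t : SemiHom (thickHom A i) N (constFamily A W) => flatHom t) h2).trans
      (flatHom_semiOfFlat b _ _)
  refine ⟨D, 𝟙 (flat N), ?_, ?_, fun k => ?_⟩
  · refine (Category.comp_id η).trans (biproduct.hom_ext' _ _ fun k => ?_)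
    have := epi_spec D.spec_isPull D.family.isVectorBundle
    rw [← cancel_epi (spec D.spec), ← D.act_eps b, hDs]
    exact (hact k).symm
  · exact (Category.id_comp _).trans hDs
  · refine (Category.id_comp _).trans ?_
    rw [Deformation.restrCoeff, hDc]
    exact framingOfCoeff_coeff b hW r k

lemma ι_map_π {𝒞 : Type*} [Category* 𝒞] [Preadditive 𝒞] [HasFiniteBiproducts 𝒞] {M N : 𝒞}
    (f : M ⟶ N) (k l : ι) : biproduct.ι (fun _ : ι => M) k ≫ (biproduct.map fun _ : ι => f) ≫
      biproduct.π (fun _ : ι => N) l = if k = l then f else 0 := by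
  rw [biproduct.map_π]
  split_ifs with h
  · subst h
    rw [biproduct.ι_π_self_assoc]
  · rw [biproduct.ι_π_ne_assoc _ h, zero_comp]

/-- Every extension of `E₀` by copies of `E₀` with a trivialization along `Y` comes from a
deformation. -/
lemma exists_relExt_isMap (hi : IsClosedSubspace i)
    (T : RelExt (sumComplex ι (F₀.complex hi)) F₀.E) :
    ∃ (D : Deformation A F₀) (g : T.E ⟶ flat D.family.E),
      RelExt.IsMap T (D.relExt b hW hi) (𝟙 _) g := by
  let η : (⨁ fun _ : ι => F₀.E) ⟶ T.E := T.η
  let r : T.E ⟶ ⨁ fun _ : ι => (pushforward i).obj W := T.r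
  have hη : η ≫ T.σ = 0 := T.zero
  have hηr : η ≫ r = biproduct.map fun _ => F₀.restr.toHom := T.η_r
  -- the basis elements of the maximal ideal act on `T.E` through `T.E → E₀ → ⨁ E₀ → T.E`
  let e : ι → (T.E ⟶ T.E) := fun k => T.σ ≫ biproduct.ι (fun _ => F₀.E) k ≫ η
  have he : ∀ k l, e k ≫ e l = 0 := fun k l => by
    simp only [e, Category.assoc]
    rw [← Category.assoc η, hη, zero_comp, comp_zero, comp_zero]
  let f := flatThickMod b e he
  have w : (η ≫ f.hom) ≫ f.inv ≫ T.σ = 0 := by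
    rw [Category.assoc, Iso.hom_inv_id_assoc, hη]
  have hS : (ShortComplex.mk (η ≫ f.hom) (f.inv ≫ T.σ) w).ShortExact :=
    ShortComplex.shortExact_of_iso (ShortComplex.isoMk
      (S₁ := ShortComplex.mk T.η T.σ T.zero) (Iso.refl _) f (Iso.refl _)
      (Category.id_comp _) (by
        show f.hom ≫ f.inv ≫ T.σ = T.σ ≫ 𝟙 _
        rw [Iso.hom_inv_id_assoc, Category.comp_id])) T.shortExact
  obtain ⟨D, g, h1, h2, h3⟩ := exists_deformation_of_coeff b hW
    (fun k => f.inv ≫ r ≫ biproduct.π _ k) hS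
    (fun k => by rw [act_thickMod]; simp only [e, Category.assoc]; rfl)
    (fun k l => by
      rw [Category.assoc, Category.assoc, Iso.hom_inv_id_assoc, ← Category.assoc η, hηr, ι_map_π])
  refine ⟨D, f.hom ≫ g, ?_, ?_, ?_⟩
  · exact (Category.assoc _ _ _).symm.trans (h1.trans (Category.id_comp _).symm)
  · show (f.hom ≫ g) ≫ spec D.spec = T.σ
    rw [Category.assoc, h2, Iso.hom_inv_id_assoc]
  · refine Eq.trans ?_ (Category.comp_id r).symm
    show (f.hom ≫ g) ≫ biproduct.lift (D.restrCoeff b hW) = r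
    refine biproduct.hom_ext _ _ fun k => ?_
    rw [Category.assoc, Category.assoc, biproduct.lift_π, h3, Iso.hom_inv_id_assoc]

end Construction

/-! ### Classes of deformations -/

section Classes

open Abelian

variable {A : Type} [CommRing A] [Algebra ℂ A] [Module.Finite ℂ A] [IsLocalRing A]
variable {B : Type} [CommRing B] [Algebra ℂ B] [Module.Finite ℂ B] [IsLocalRing B]
variable {ι : Type} [Fintype ι] [DecidableEq ι] (b : SqZeroBasis A ι)
variable {κ : Type} [Fintype κ] [DecidableEq κ] (b' : SqZeroBasis B κ)
variable {W : OMod Y} (hW : IsVectorBundle W) {i : Y ⟶ X} (hi : IsClosedSubspace i)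
variable {F₀ : FramedBundle i W}

lemma flatMap_act {N N' : OMod (thick A X)} (f : N ⟶ N') (a : A) :
    act a N ≫ (show flat N ⟶ flat N' from (pushforward (thickProj A X)).map f) =
      (show flat N ⟶ flat N' from (pushforward (thickProj A X)).map f) ≫ act a N' := by
  refine hom_ext' fun U x => ?_
  obtain ⟨x, rfl⟩ := toFlat_surjective N U x
  exact map_smul (onSec f (up A U)) (thickFun A U (a ⊗ₜ 1)) x

/-- An isomorphism of deformations induces a map of extensions. -/
lemma Deformation.relExt_isMap_of_iso {D D' : Deformation A F₀} (f : D.family.E ⟶ D'.family.E)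
    (h1 : D'.family.restr.pre f = D.family.restr) (h2 : D'.spec.pre f = D.spec) :
    RelExt.IsMap (D.relExt b hW hi) (D'.relExt b hW hi) (𝟙 _)
      (show flat D.family.E ⟶ flat D'.family.E from (pushforward (thickProj A X)).map f) := by
  let g : flat D.family.E ⟶ flat D'.family.E := (pushforward (thickProj A X)).map f
  have hσ : g ≫ FramedDeformations.spec D'.spec = FramedDeformations.spec D.spec := by
    rw [← h2]
    rfl
  have hr : g ≫ flatHom D'.family.restr = flatHom D.family.restr := by
    rw [← h1]
    rfl
  refine ⟨?_, hσ, ?_⟩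
  · refine Eq.trans ?_ (Category.id_comp _).symm
    show epsMaps b D.spec_isPull D.family.isVectorBundle ≫ g =
      epsMaps b D'.spec_isPull D'.family.isVectorBundle
    refine biproduct.hom_ext' _ _ fun k => ?_
    have := epi_spec D.spec_isPull D.family.isVectorBundle
    have h3 : act (b.eps k) D.family.E ≫ g = g ≫ act (b.eps k) D'.family.E := flatMap_act f _
    rw [D.act_eps b, D'.act_eps b, ← Category.assoc g, hσ, Category.assoc, Category.assoc] at h3
    exact (cancel_epi _).1 h3
  · refine Eq.trans ?_ (Category.comp_id _).symm
    show g ≫ biproduct.lift (D'.restrCoeff b hW) = biproduct.lift (D.restrCoeff b hW)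
    refine biproduct.hom_ext _ _ fun k => ?_
    rw [Category.assoc, biproduct.lift_π, biproduct.lift_π, restrCoeff, restrCoeff, ← hr,
      Category.assoc]

/-- The class of a deformation, in the extensions of `E₀` by a sum of copies of `E₀ ⊗ J`. -/
def Deformation.extCls (D : Deformation A F₀) :
    Ext.{1} F₀.E (⨁ fun _ : ι => tensor F₀.E (idealSheaf i)) 1 :=
  (D.relExt b hW hi).cls (sumComplex_shortExact (F₀.complex_shortExact hi))

lemma Deformation.extCls_eq_of_iso {D D' : Deformation A F₀} (h : D.Iso D') :
    D.extCls b hW hi = D'.extCls b hW hi := by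
  rw [Deformation.iso_iff] at h
  obtain ⟨f, h1, h2⟩ := h
  have h3 := RelExt.cls_comp_of_map (Deformation.relExt_isMap_of_iso b hW hi f.hom h1 h2)
    (sumComplex_shortExact (F₀.complex_shortExact hi))
    (sumComplex_shortExact (F₀.complex_shortExact hi))
  exact (Ext.comp_mk₀_id _).symm.trans h3

lemma Deformation.iso_of_extCls_eq {D D' : Deformation A F₀}
    (h : D.extCls b hW hi = D'.extCls b hW hi) : D.Iso D' := by
  obtain ⟨g, hg⟩ := RelExt.exists_iso_of_cls_eq
    (sumComplex_shortExact (F₀.complex_shortExact hi)) h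
  exact Deformation.iso_of_relExt b hW hi g hg

lemma Deformation.exists_extCls_eq
    (x : Ext.{1} F₀.E (⨁ fun _ : ι => tensor F₀.E (idealSheaf i)) 1) :
    ∃ D : Deformation A F₀, D.extCls b hW hi = x := by
  obtain ⟨T, rfl⟩ := RelExt.exists_cls_eq (sumComplex_shortExact (F₀.complex_shortExact hi)) x
  obtain ⟨D, g, hg⟩ := exists_relExt_isMap b hW hi T
  have h3 := RelExt.cls_comp_of_map hg
    (sumComplex_shortExact (F₀.complex_shortExact hi))
    (sumComplex_shortExact (F₀.complex_shortExact hi))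
  exact ⟨D, h3.symm.trans (Ext.comp_mk₀_id _)⟩

/-- Base change along `A → B` acts on classes by the matrix of `A → B` on the maximal ideals. -/
lemma Deformation.extCls_baseChange (φ : A →ₐ[ℂ] B) (D : Deformation A F₀) :
    (D.baseChange φ).extCls b' hW hi = (D.extCls b hW hi).comp
      (Ext.mk₀ (scalarMatrix (baseChangeMatrix b b' φ) _)) (add_zero 1) :=
  (RelExt.cls_comp_of_map (D.relExt_isMap b b' hW hi φ)
    (sumComplex_shortExact (F₀.complex_shortExact hi))
    (sumComplex_shortExact (F₀.complex_shortExact hi))).symm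

/-- The components of the class of a deformation, one for each basis element of the maximal
ideal. -/
def Def.comps (d : Def A F₀) (k : ι) : Ext.{1} F₀.E (tensor F₀.E (idealSheaf i)) 1 :=
  (Quotient.lift (fun D : Deformation A F₀ => D.extCls b hW hi)
    (fun _ _ h => Deformation.extCls_eq_of_iso b hW hi h) d).comp
      (Ext.mk₀ (biproduct.π _ k)) (add_zero 1)

lemma Def.comps_cls (D : Deformation A F₀) (k : ι) : Def.comps b hW hi D.cls k =
    (D.extCls b hW hi).comp (Ext.mk₀ (biproduct.π _ k)) (add_zero 1) := rfl

/-- Deformations over `A` up to isomorphism are classified by families of classes in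
`Ext¹(E₀, E₀ ⊗ J)`, indexed by the basis elements of the maximal ideal of `A`. -/
lemma Def.comps_bijective :
    Function.Bijective (Def.comps b hW hi : Def A F₀ →
      ι → Ext.{1} F₀.E (tensor F₀.E (idealSheaf i)) 1) := by
  constructor
  · intro d d' h
    induction d using Quotient.inductionOn with | _ D =>
    induction d' using Quotient.inductionOn with | _ D' =>
    refine Quotient.sound (Deformation.iso_of_extCls_eq b hW hi ?_)
    have h1 : ∀ x : Ext.{1} F₀.E (⨁ fun _ : ι => tensor F₀.E (idealSheaf i)) 1,
        x = ∑ k, (x.comp (Ext.mk₀ (biproduct.π _ k)) (add_zero 1)).comp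
          (Ext.mk₀ (biproduct.ι (fun _ : ι => tensor F₀.E (idealSheaf i)) k)) (add_zero 1) := by
      intro x
      conv_lhs => rw [← Ext.comp_mk₀_id x, ← biproduct.total, Ext.mk₀_sum, Ext.comp_sum]
      refine Finset.sum_congr rfl fun k _ => ?_
      rw [Ext.comp_assoc_of_second_deg_zero, Ext.mk₀_comp_mk₀]
    rw [h1 (D.extCls b hW hi), h1 (D'.extCls b hW hi)]
    refine Finset.sum_congr rfl fun k _ => ?_
    exact congrArg (fun y => Ext.comp y
      (Ext.mk₀ (biproduct.ι (fun _ : ι => tensor F₀.E (idealSheaf i)) k)) (add_zero 1))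
      (congrFun h k)
  · intro y
    obtain ⟨D, hD⟩ := Deformation.exists_extCls_eq (A := A) b hW hi
      (∑ k, (y k).comp (Ext.mk₀ (biproduct.ι (fun _ : ι => tensor F₀.E (idealSheaf i)) k))
        (add_zero 1))
    refine ⟨D.cls, funext fun k => ?_⟩
    rw [Def.comps_cls, hD, Ext.sum_comp, Finset.sum_eq_single k]
    · rw [Ext.comp_assoc_of_second_deg_zero, Ext.mk₀_comp_mk₀, biproduct.ι_π_self,
        Ext.comp_mk₀_id]
    · intro l _ hl
      rw [Ext.comp_assoc_of_second_deg_zero, Ext.mk₀_comp_mk₀, biproduct.ι_π_ne _ hl,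
        Ext.mk₀_zero, Ext.comp_zero]
    · simp

/-- A homomorphism `A → B` acts on components by its matrix on the maximal ideals. -/
lemma Def.comps_map (φ : A →ₐ[ℂ] B) (d : Def A F₀) (l : κ) :
    Def.comps b' hW hi (Def.map φ d) l =
      ∑ k, baseChangeMatrix b b' φ k l • Def.comps b hW hi d k := by
  induction d using Quotient.inductionOn with | _ D =>
  refine (congrArg (fun y => Ext.comp y (Ext.mk₀ (biproduct.π _ l)) (add_zero 1))
    (D.extCls_baseChange b b' hW hi φ)).trans ?_
  rw [Ext.comp_assoc_of_second_deg_zero, Ext.mk₀_comp_mk₀, scalarMatrix_π, Ext.mk₀_sum,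
    Ext.comp_sum]
  refine Finset.sum_congr rfl fun k _ => ?_
  rw [Ext.mk₀_smul, Ext.comp_smul]
  rfl

end Classes

section Dual

lemma aug_dual (x : Dual) : aug Dual x = x.fst :=
  (DFunLike.congr_fun (aug_unique (TrivSqZeroExt.fstHom ℂ ℂ ℂ)) x).symm

/-- The basis `ε` of the maximal ideal of `ℂ[ε]`. -/
def dualBasis : SqZeroBasis Dual Unit where
  eps _ := DualNumber.eps
  coeff _ := TrivSqZeroExt.sndHom ℂ ℂ
  eps_mul_eps _ _ := DualNumber.eps_mul_eps
  coeff_eps _ _ := by simp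
  decomp x := by
    rw [aug_dual]
    ext <;> simp [TrivSqZeroExt.algebraMap_eq_inl]

lemma aug_doubleDual (x : doubleDual) : aug doubleDual x = x.1.1.fst :=
  (DFunLike.congr_fun (aug_unique ((TrivSqZeroExt.fstHom ℂ ℂ ℂ).comp doubleDualFst)) x).symm

/-- The basis `(ε, 0)` (index `true`), `(0, ε)` (index `false`) of the maximal ideal of
`ℂ[ε] ×_ℂ ℂ[ε]`. -/
def doubleDualBasis : SqZeroBasis doubleDual Bool where
  eps k := ⟨if k then (DualNumber.eps, 0) else (0, DualNumber.eps), by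
    cases k <;> simp [mem_doubleDual]⟩
  coeff k := (TrivSqZeroExt.sndHom ℂ ℂ).comp
    (if k then doubleDualFst.toLinearMap else doubleDualSnd.toLinearMap)
  eps_mul_eps k l := by
    apply Subtype.ext
    cases k <;> cases l <;> simp
  coeff_eps k l := by
    cases k <;> cases l <;> simp [doubleDualFst, doubleDualSnd]
  decomp x := by
    rw [aug_doubleDual]
    have h := (mem_doubleDual x.1).1 x.2
    apply Subtype.ext
    simp [doubleDualFst, doubleDualSnd]
    ext <;> simp [TrivSqZeroExt.algebraMap_eq_inl, h]

lemma baseChangeMatrix_fst (k : Bool) :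
    baseChangeMatrix doubleDualBasis dualBasis doubleDualFst k () = if k then 1 else 0 := by
  cases k <;> simp [baseChangeMatrix, doubleDualBasis, dualBasis, doubleDualFst]

lemma baseChangeMatrix_snd (k : Bool) :
    baseChangeMatrix doubleDualBasis dualBasis doubleDualSnd k () = if k then 0 else 1 := by
  cases k <;> simp [baseChangeMatrix, doubleDualBasis, dualBasis, doubleDualSnd]

lemma baseChangeMatrix_add (k : Bool) :
    baseChangeMatrix doubleDualBasis dualBasis doubleDualAdd k () = 1 := by
  cases k <;> simp [baseChangeMatrix, doubleDualBasis, dualBasis, doubleDualAdd]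

lemma baseChangeMatrix_scale (c : ℂ) :
    baseChangeMatrix dualBasis dualBasis (dualScale c) () () = c := by
  simp [baseChangeMatrix, dualBasis, dualScale]

end Dual

/-! ### First order deformations -/

section FirstOrder

open Abelian

variable {W : OMod Y} (hW : IsVectorBundle W) {i : Y ⟶ X} (hi : IsClosedSubspace i)
variable {F₀ : FramedBundle i W}

/-- The map `E₀ → E`, `e₀ ↦ ε e` for any local section `e` of `E` that restricts to `e₀` on the
closed fibre. -/
abbrev Deformation.eps (D : Deformation Dual F₀) : F₀.E ⟶ flat D.family.E :=
  epsMap dualBasis D.spec_isPull D.family.isVectorBundle ()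

lemma Deformation.eps_spec (D : Deformation Dual F₀) :
    D.eps ≫ FramedDeformations.spec D.spec = 0 := epsMap_spec _ _ _ _

lemma Deformation.ι_epsMaps (D : Deformation Dual F₀) :
    biproduct.ι (fun _ : Unit => F₀.E) () ≫
      epsMaps dualBasis D.spec_isPull D.family.isVectorBundle = D.eps := biproduct.ι_desc _ _

lemma π_ι_unit {𝒞 : Type*} [Category* 𝒞] [Preadditive 𝒞] [HasFiniteBiproducts 𝒞] (M : 𝒞) :
    biproduct.π (fun _ : Unit => M) () ≫ biproduct.ι (fun _ : Unit => M) () = 𝟙 _ := by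
  rw [← biproduct.total, Fintype.sum_unique]

lemma Deformation.π_eps (D : Deformation Dual F₀) :
    biproduct.π (fun _ : Unit => F₀.E) () ≫ D.eps =
      epsMaps dualBasis D.spec_isPull D.family.isVectorBundle := by
  rw [← D.ι_epsMaps, ← Category.assoc, π_ι_unit, Category.id_comp]

/-- The extension of `E₀` by `E₀` given by a deformation over `ℂ[ε]`, with its trivialization along
`Y`. This is `Deformation.relExt` without the sums indexed by `Unit`. -/
def Deformation.firstOrder (D : Deformation Dual F₀) : RelExt (F₀.complex hi) F₀.E where
  E := flat D.family.E
  η := D.eps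
  σ := FramedDeformations.spec D.spec
  zero := D.eps_spec
  shortExact := ShortComplex.shortExact_of_iso
    (ShortComplex.isoMk
      (S₁ := ShortComplex.mk _ _ (epsMaps_spec dualBasis D.spec_isPull D.family.isVectorBundle))
      (S₂ := ShortComplex.mk _ _ D.eps_spec)
      { hom := biproduct.π (fun _ : Unit => F₀.E) ()
        inv := biproduct.ι (fun _ : Unit => F₀.E) ()
        hom_inv_id := π_ι_unit _
        inv_hom_id := biproduct.ι_π_self _ _ }
      (Iso.refl _) (Iso.refl _) (D.π_eps.trans (Category.comp_id _).symm)
      ((Category.id_comp _).trans (Category.comp_id _).symm))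
    (thick_shortExact dualBasis D.spec_isPull D.family.isVectorBundle)
  r := D.restrCoeff dualBasis hW ()
  η_r := (D.epsMap_restrCoeff dualBasis hW () ()).trans (if_pos rfl)

lemma Deformation.cls_firstOrder (D : Deformation Dual F₀) :
    (D.firstOrder hW hi).cls (F₀.complex_shortExact hi) =
      Def.comps dualBasis hW hi D.cls () := by
  let φ : sumComplex Unit (F₀.complex hi) ⟶ F₀.complex hi :=
    { τ₁ := biproduct.π (fun _ : Unit => (F₀.complex hi).X₁) ()
      τ₂ := biproduct.π (fun _ : Unit => (F₀.complex hi).X₂) ()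
      τ₃ := biproduct.π (fun _ : Unit => (F₀.complex hi).X₃) ()
      comm₁₂ := (biproduct.map_π (fun _ : Unit => (F₀.complex hi).f) ()).symm
      comm₂₃ := (biproduct.map_π (fun _ : Unit => (F₀.complex hi).g) ()).symm }
  have h : RelExt.IsMap (D.relExt dualBasis hW hi) (D.firstOrder hW hi) φ (𝟙 (flat D.family.E)) :=
    { η := (Category.comp_id _).trans D.π_eps.symm
      σ := Category.id_comp _
      r := (Category.id_comp _).trans (biproduct.lift_π (D.restrCoeff dualBasis hW) ()).symm }
  exact (RelExt.cls_comp_of_map h (sumComplex_shortExact (F₀.complex_shortExact hi))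
    (F₀.complex_shortExact hi)).symm

section Induced

variable {F : OMod X} {a : tensor F₀.E (idealSheaf i) ⟶ F} {p : F ⟶ F₀.E}
variable (D : Deformation Dual F₀) (u : F ⟶ flat D.family.E)

lemma onSec_eps (U : Opens X.carrier) (e : Sec D.family.E (up Dual U)) :
    onSec D.eps U (D.spec.toFun (up Dual U) U le_rfl e) = toFlat _ U (epsMul e) :=
  onSec_epsMap dualBasis D.spec_isPull D.family.isVectorBundle () U (toFlat _ U e)

lemma ofHom_toFun (U : Opens X.carrier) (x : Sec F U) :
    (SemiHom.ofHom (thickProj Dual X) u).toFun U (up Dual U) le_rfl x =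
      (toFlat D.family.E U).symm (onSec u U x) :=
  rest_self D.family.E (U := up Dual U) le_rfl _

/-- The condition on the closed fibre in `IsInducedBy`, in terms of `O_X`-modules. -/
lemma fibre_iff : (SemiHom.ofHom (thickProj Dual X) u).comp (thickPoint_comp_proj (aug Dual) X)
    D.spec = (idSemi F).post p ↔ u ≫ spec D.spec = p := by
  have h1 : ∀ (U : Opens X.carrier) (x : Sec F U),
      ((SemiHom.ofHom (thickProj Dual X) u).comp (thickPoint_comp_proj (aug Dual) X) D.spec).toFun
        U U le_rfl x = onSec (u ≫ spec D.spec) U x := fun U x =>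
    congrArg (D.spec.toFun (up Dual U) U le_rfl) (ofHom_toFun D u U x)
  have h2 : ∀ (U : Opens X.carrier) (x : Sec F U),
      ((idSemi F).post p).toFun U U le_rfl x = onSec p U x := fun U x =>
    congrArg (onSec p U) (rest_self F (le_refl U) x)
  constructor
  · intro h
    refine hom_ext' fun U x => ?_
    rw [← h1, ← h2, h]
  · intro h
    refine SemiHom.ext' fun U x => ?_
    refine (h1 U x).trans (Eq.trans ?_ (h2 U x).symm)
    rw [h]

/-- The condition on the multiples of `ε` in `IsInducedBy`, in terms of `O_X`-modules. Sections of
`E₀` lift to `E` only locally, which is enough since equality of sections is local. -/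
lemma eps_iff : (∀ (U : Opens X.carrier) (z : Sec (tensor F₀.E (idealSheaf i)) U)
      (e : Sec D.family.E U),
      D.spec.toFun U U le_rfl e = onSec (tensorIdealHom i F₀.E) U z →
        (SemiHom.ofHom (thickProj Dual X) u).toFun U U le_rfl (onSec a U z) = epsMul e) ↔
    a ≫ u = tensorIdealHom i F₀.E ≫ D.eps := by
  constructor
  · intro h
    refine hom_ext' fun U z => sec_ext _ fun q hq => ?_
    obtain ⟨V, hV, hqV, e, he⟩ := locSurj_spec D.spec_isPull D.family.isVectorBundle U
      (onSec (tensorIdealHom i F₀.E) U z) q hq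
    refine ⟨V, hV, hqV, ?_⟩
    obtain ⟨e, rfl⟩ := toFlat_surjective _ V e
    have he' : D.spec.toFun (up Dual V) V le_rfl e =
        onSec (tensorIdealHom i F₀.E) V (rest _ hV z) := he.trans (onSec_rest _ _ _).symm
    have h1 := h V (rest _ hV z) e he'
    have h2 : onSec u V (onSec a V (rest _ hV z)) = toFlat _ V (epsMul e) :=
      (congrArg (toFlat D.family.E V) (ofHom_toFun D u V _)).symm.trans
        (congrArg (toFlat D.family.E V) h1)
    rw [← onSec_rest, ← onSec_rest, onSec_comp, onSec_comp, h2, ← onSec_eps, he']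
  · intro h
    have key : ∀ (U : Opens X.carrier) (z : Sec (tensor F₀.E (idealSheaf i)) U)
        (e : Sec D.family.E (up Dual U)),
        D.spec.toFun (up Dual U) U le_rfl e = onSec (tensorIdealHom i F₀.E) U z →
          onSec u U (onSec a U z) = toFlat _ U (epsMul e) := by
      intro U z e he
      rw [← onSec_comp, h, onSec_comp, ← onSec_eps, he]
    exact fun U z e he => (ofHom_toFun D u U _).trans
      (congrArg (toFlat D.family.E U).symm (key U z e he))

/-- The condition on the framing in `IsInducedBy`: since `u` is compatible with the projections to
the closed fibre, only the coefficient of `ε` of the framing matters, and it has to vanish. -/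
lemma framing_iff (hu : u ≫ spec D.spec = p) :
    (SemiHom.ofHom (thickProj Dual X) u).comp (thickHom_comp_proj Dual i) D.family.restr =
      (F₀.restr.pre p).comp rfl (constFamilyUnit Dual W) ↔
    u ≫ D.restrCoeff dualBasis hW () = 0 := by
  have h0 : (SemiHom.ofHom (thickProj Dual X) u).comp (thickHom_comp_proj Dual i) D.family.restr =
      (F₀.restr.pre p).comp rfl (constFamilyUnit Dual W) ↔
      u ≫ flatHom D.family.restr = p ≫ F₀.restr.toHom ≫ (pushforward i).map (constSec Dual W) := by
    have h1 : ∀ (U : Opens X.carrier) (x : Sec F U),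
        ((SemiHom.ofHom (thickProj Dual X) u).comp (thickHom_comp_proj Dual i)
          D.family.restr).toFun U (up Dual ((Opens.map i.hom.base).obj U)) le_rfl x =
        onSec (u ≫ flatHom D.family.restr) U x := fun U x =>
      congrArg (D.family.restr.toFun (up Dual U) (up Dual ((Opens.map i.hom.base).obj U)) le_rfl)
        (ofHom_toFun D u U x)
    have h2 : ∀ (U : Opens X.carrier) (x : Sec F U),
        ((F₀.restr.pre p).comp rfl (constFamilyUnit Dual W)).toFun U
          (up Dual ((Opens.map i.hom.base).obj U)) le_rfl x =
        onSec (p ≫ F₀.restr.toHom ≫ (pushforward i).map (constSec Dual W)) U x := fun U x => rfl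
    constructor
    · intro h
      refine hom_ext' fun U x => ?_
      rw [← h1, ← h2, h]
    · intro h
      refine SemiHom.ext' fun U x => ?_
      refine (h1 U x).trans (Eq.trans ?_ (h2 U x).symm)
      rw [h]
  rw [h0]
  have h3 : ∀ k : Unit, (p ≫ F₀.restr.toHom ≫ (pushforward i).map (constSec Dual W)) ≫
      (pushforward i).map (constCoeff dualBasis hW ≫ biproduct.π _ k) = 0 := by
    intro k
    rw [Category.assoc, Category.assoc, ← Functor.map_comp, ← Category.assoc (constSec Dual W),
      constSec_coeff, zero_comp, Functor.map_zero, comp_zero, comp_zero]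
  constructor
  · intro h
    rw [Deformation.restrCoeff, ← Category.assoc, h, h3]
  · intro h
    refine hom_ext_constFamily dualBasis hW ?_ fun k => ?_
    · have h4 := flatHom_spec _ _ _ _ D.compat
      rw [Category.assoc, h4, Category.assoc, Category.assoc, ← Functor.map_comp, constSec_spec,
        CategoryTheory.Functor.map_id, Category.comp_id, ← hu, Category.assoc]
      rfl
    · rw [h3, Category.assoc]
      exact h

/-- The maps `u` that exhibit `D` as the deformation defined by an extension, in terms of the
`O_X`-module underlying the family. -/
lemma exists_isInducedBy_iff :
    (∃ v : SemiHom (thickProj Dual X) F D.family.E, IsInducedBy a p D v) ↔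
    ∃ u : F ⟶ flat D.family.E, a ≫ u = tensorIdealHom i F₀.E ≫ D.eps ∧ u ≫ spec D.spec = p ∧
      u ≫ D.restrCoeff dualBasis hW () = 0 := by
  rw [← (SemiHom.equiv (thickProj Dual X) F D.family.E).exists_congr_right]
  refine exists_congr fun u => ⟨fun h => ?_, fun h => ?_⟩
  · have h1 := (fibre_iff D u).1 h.fibre
    exact ⟨(eps_iff D u).1 h.eps, h1, (framing_iff hW D u h1).1 h.framing⟩
  · exact ⟨(fibre_iff D u).2 h.2.1, (eps_iff D u).2 h.1, (framing_iff hW D u h.2.1).2 h.2.2⟩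

end Induced

/-- The classification sends a deformation to the class of an extension if and only if the
deformation is the one defined by the extension. -/
lemma extClass_eq_comps_iff {F : OMod X} {a : tensor F₀.E (idealSheaf i) ⟶ F} {p : F ⟶ F₀.E}
    {w : a ≫ p = 0} (hS : (ShortComplex.mk a p w).ShortExact) (D : Deformation Dual F₀) :
    hS.extClass = Def.comps dualBasis hW hi D.cls () ↔
      ∃ u : SemiHom (thickProj Dual X) F D.family.E, IsInducedBy a p D u := by
  rw [exists_isInducedBy_iff hW, ← Deformation.cls_firstOrder hW hi]
  exact (D.firstOrder hW hi).extClass_eq_cls_iff (F₀.complex_shortExact hi) hS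

variable (F₀) in
/-- First order deformations are classified by `Ext¹(E₀, E₀ ⊗ J)`. -/
def defEquivExt : Def Dual F₀ ≃ Ext.{1} F₀.E (tensor F₀.E (idealSheaf i)) 1 :=
  (Equiv.ofBijective _ (Def.comps_bijective dualBasis hW hi)).trans (Equiv.funUnique Unit _)

lemma defEquivExt_apply (d : Def Dual F₀) :
    defEquivExt hW hi F₀ d = Def.comps dualBasis hW hi d () := rfl

/-- The projections from `ℂ[ε] ×_ℂ ℂ[ε]` to `ℂ[ε]` read off the two components of a class. -/
lemma defEquivExt_fst (d : Def doubleDual F₀) : defEquivExt hW hi F₀ (Def.map doubleDualFst d) =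
    Def.comps doubleDualBasis hW hi d true := by
  rw [defEquivExt_apply, Def.comps_map doubleDualBasis dualBasis]
  simp [baseChangeMatrix_fst]

lemma defEquivExt_snd (d : Def doubleDual F₀) : defEquivExt hW hi F₀ (Def.map doubleDualSnd d) =
    Def.comps doubleDualBasis hW hi d false := by
  rw [defEquivExt_apply, Def.comps_map doubleDualBasis dualBasis]
  simp [baseChangeMatrix_snd]

lemma defEquivExt_add (d : Def doubleDual F₀) : defEquivExt hW hi F₀ (Def.map doubleDualAdd d) =
    Def.comps doubleDualBasis hW hi d true + Def.comps doubleDualBasis hW hi d false := by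
  rw [defEquivExt_apply, Def.comps_map doubleDualBasis dualBasis]
  simp [baseChangeMatrix_add]

lemma defEquivExt_scale (c : ℂ) (d : Def Dual F₀) :
    defEquivExt hW hi F₀ (Def.map (dualScale c) d) = c • defEquivExt hW hi F₀ d := by
  rw [defEquivExt_apply, Def.comps_map dualBasis dualBasis]
  simp [baseChangeMatrix_scale, defEquivExt_apply]

variable (F₀) in
include hW hi in
lemma map_fst_snd_bijective : Function.Bijective (fun d : Def doubleDual F₀ =>
    (Def.map doubleDualFst d, Def.map doubleDualSnd d)) := by
  constructor
  · intro d d' h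
    have h1 : Def.map doubleDualFst d = Def.map doubleDualFst d' := congrArg Prod.fst h
    have h2 : Def.map doubleDualSnd d = Def.map doubleDualSnd d' := congrArg Prod.snd h
    apply (Def.comps_bijective doubleDualBasis hW hi).1
    funext k
    cases k
    · exact (defEquivExt_snd hW hi d).symm.trans ((congrArg _ h2).trans (defEquivExt_snd hW hi d'))
    · exact (defEquivExt_fst hW hi d).symm.trans ((congrArg _ h1).trans (defEquivExt_fst hW hi d'))
  · rintro ⟨x, y⟩
    obtain ⟨d, hd⟩ := (Def.comps_bijective doubleDualBasis hW hi).2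
      (fun k => if k then defEquivExt hW hi F₀ x else defEquivExt hW hi F₀ y)
    refine ⟨d, Prod.ext ((defEquivExt hW hi F₀).injective ?_)
      ((defEquivExt hW hi F₀).injective ?_)⟩
    · exact (defEquivExt_fst hW hi d).trans (congrFun hd true)
    · exact (defEquivExt_snd hW hi d).trans (congrFun hd false)

end FirstOrder

end
end FramedDeformations

/-- First order deformations of a framed vector bundle `F₀ = (E₀, α₀)`. The set
`Def(E₀, α₀)(ℂ[ε])` carries the vector space structure that comes from the maps
`a + b ε ↦ a + c b ε` and `ℂ[ε] ×_ℂ ℂ[ε] → ℂ[ε]`, and it is isomorphic to `Ext¹(E₀, E₀ ⊗ J)` by the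
map that sends the class of an extension to the class of the deformation defined by it. -/
theorem theorem1p2 {X Y : CSpace} (hX : IsAnalytic X) (hY : IsAnalytic Y)
    (i : Y ⟶ X) (hi : IsClosedSubspace i) (W : OMod Y) (hW : IsVectorBundle W)
    (F₀ : FramedBundle i W) :
    Function.Bijective (fun d : Def doubleDual F₀ =>
      (Def.map doubleDualFst d, Def.map doubleDualSnd d)) ∧
    ∃ (_ : AddCommGroup (Def Dual F₀)) (_ : Module ℂ (Def Dual F₀)),
      (∀ d : Def doubleDual F₀,
        Def.map doubleDualFst d + Def.map doubleDualSnd d = Def.map doubleDualAdd d) ∧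
      (∀ (c : ℂ) (d : Def Dual F₀), c • d = Def.map (dualScale c) d) ∧
      ∃ Φ : Abelian.Ext.{1} F₀.E (tensor F₀.E (idealSheaf i)) 1 ≃ₗ[ℂ] Def Dual F₀,
        ∀ (F : OMod X) (a : tensor F₀.E (idealSheaf i) ⟶ F) (p : F ⟶ F₀.E) (w : a ≫ p = 0)
          (hS : (ShortComplex.mk a p w).ShortExact) (D : Deformation Dual F₀),
          Φ hS.extClass = D.cls ↔
            ∃ u : SemiHom (thickProj Dual X) F D.family.E, IsInducedBy a p D u := by
  refine ⟨map_fst_snd_bijective hW hi F₀, ?_⟩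
  let e := defEquivExt hW hi F₀
  let := e.addCommGroup
  let := e.module ℂ
  refine ⟨inferInstance, inferInstance, fun d => ?_, fun c d => ?_, (e.linearEquiv ℂ).symm, ?_⟩
  · apply e.injective
    have h : e (Def.map doubleDualFst d + Def.map doubleDualSnd d) =
        e (Def.map doubleDualFst d) + e (Def.map doubleDualSnd d) := map_add (e.linearEquiv ℂ) _ _
    rw [h]
    refine Eq.trans ?_ (defEquivExt_add hW hi d).symm
    exact congrArg₂ (· + ·) (defEquivExt_fst hW hi d) (defEquivExt_snd hW hi d)
  · apply e.injective
    have h : e (c • d) = c • e d := map_smul (e.linearEquiv ℂ) _ _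
    rw [h]
    exact (defEquivExt_scale hW hi c d).symm
  · intro F a p w hS D
    rw [← extClass_eq_comps_iff hW hi hS D]
    exact (e.symm_apply_eq (x := hS.extClass) (y := D.cls))
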